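/- Let $\Bbbk$ be a field of characteristic $0$ and let $A=\sigma(\Bbbk[t_1,t_2])\langle x_1,x_2,x_3\rangle$ be a skew PBW extension of the commutative polynomial ring $R=\Bbbk[t_1,t_2]$ that is a $\Bbbk$-algebra. That is: $R$ is a $\Bbbk$-subalgebra of $A$; $x_1,x_2,x_3\in A\setminus R$; $A$ is a free left $R$-module with basis $\{x_1^{\alpha_1}x_2^{\alpha_2}x_3^{\alpha_3}\mid \alpha\in\mathbb N^3\}$; for each $i$ and each $r\in R\setminus\{0\}$ there is $c_{i,r}\in R\setminus\{0\}$ with $x_ir-c_{i,r}x_i\in R$; and for all $i,j$ there is $d_{i,j}\in R\setminus\{0\}$ with $x_jx_i-d_{i,j}x_ix_j\in R+Rx_1+Rx_2+Rx_3$. Suppose that $$x_it_l=a_{ill}\,t_lx_i+b_{il}x_i+p_i\quad(1\le i\le 3,\ l=1,2),\qquad x_jx_i=c_{i,j}x_ix_j+q_{i,j}^{(0)}+\sum_{k=1}^{3}q_{i,j}^{(k)}x_k\quad(1\le i<j\le 3),$$ where $a_{ill},c_{i,j}\in\Bbbk\setminus\{0\}$ and $b_{il},p_i,q_{i,j}^{(0)},q_{i,j}^{(k)}\in\Bbbk$.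 Put $c_{r,t}:=c_{t,r}^{-1}$ and $q_{r,t}^{(k)}:=-c_{t,r}^{-1}q_{t,r}^{(k)}$ for $t<r$ and $1\le k\le 3$, and $c_{r,r}:=1$, $q_{r,r}^{(k)}:=0$. Suppose that for all $i,s\in\{1,2,3\}$ and $l\in\{1,2\}$ $$b_{sl}(a_{ill}-1)=b_{il}(a_{sll}-1),\qquad q_{s,i}^{(s)}(a_{ill}-1)=0,\qquad p_i(c_{s,i}-a_{sll})=b_{il}q_{s,i}^{(s)},$$ and that for all $s,i,j,k\in\{1,2,3\}$ with $i<j$ $$q_{i,j}^{(s)}(c_{s,j}c_{s,i}-1)=0,\qquad q_{s,j}^{(s)}(c_{i,j}-1)=q_{i,j}^{(i)}(c_{s,j}-1),\qquad q_{s,i}^{(s)}(c_{i,j}-1)=q_{i,j}^{(j)}(c_{s,i}-1),$$ $$q_{i,j}^{(k)}(c_{s,j}c_{s,i}-c_{k,s}^{-1})=0,$$ $$\sum_{m=1}^{s-1}c_{m,s}^{-1}q_{i,j}^{(m)}q_{m,s}^{(s)}-\sum_{m=s+1}^{3}q_{i,j}^{(m)}q_{m,s}^{(s)}+q_{s,i}^{(s)}q_{s,j}^{(s)}(1-c_{i,j})+(c_{s,j}c_{s,i}-1)q_{i,j}^{(0)}=0.$$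 Then $A$ is differentially smooth. Here an affine $\Bbbk$-algebra $A$ is differentially smooth if its Gelfand–Kirillov dimension is an integer $n$ and it admits an $n$-dimensional connected integrable differential calculus, in the following sense. A differential calculus over $A$ is a differential graded $\Bbbk$-algebra $(\Omega A=\bigoplus_{m\ge0}\Omega^mA,\wedge,d)$ with $\Omega^0A=A$ and $\Omega^mA=A\,dA\wedge\cdots\wedge dA$ ($m$ factors $dA$). It is connected if $\ker(d|_A)=\Bbbk$, and $n$-dimensional if $\Omega^nA\ne0$ and $\Omega^mA=0$ for $m>n$. Let $\mathcal I_mA$ be the $A$-bimodule of right $A$-linear maps $\Omega^mA\to A$, with $(a\cdot\phi\cdot b)(\omega)=a\phi(b\omega)$, and let $(\phi\cdot\omega)(\omega')=\phi(\omega\wedge\omega')$. A divergence is a $\Bbbk$-linear map $\nabla:\mathcal I_1A\to A$ with $\nabla(\phi\cdot a)=\nabla(\phi)a+\phi(da)$; it extends to $\nabla_m:\mathcal I_{m+1}A\to\mathcal I_mA$ by $\nabla_m(\phi)(\omega)=\nabla(\phi\cdot\omega)+(-1)^{m+1}\phi(d\omega)$, where $\mathcal I_0A=A$ and $\nabla_0=\nabla$.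 The $n$-dimensional calculus is integrable if there are a divergence $\nabla$ with $\nabla\circ\nabla_1=0$, an algebra automorphism $\nu$ of $A$ and $\Bbbk$-linear bijections $\Theta_m:\Omega^mA\to\mathcal I_{n-m}A$ ($0\le m\le n$) such that $\Theta_m(a\omega b)=\nu(a)\cdot\Theta_m(\omega)\cdot b$ for all $a,b\in A$, $\omega\in\Omega^mA$, and $\Theta_{m+1}\circ d=\nabla_{n-m-1}\circ\Theta_m$ for $0\le m<n$. -/

import Mathlib

open Filter

universe u v

/-- `ι : R → A` (an inclusion of rings) and `x₁, …, xₙ ∈ A` present `A` as a skew PBW extension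
`σ(R)⟨x₁, …, xₙ⟩` of `R`. -/
structure IsSkewPBWExtension {R : Type*} {A : Type*} [Ring R] [Ring A] (ι : R →+* A) {n : ℕ}
    (x : Fin n → A) : Prop where
  injective : Function.Injective ι
  notMem : ∀ i, x i ∉ Set.range ι
  /-- `A` is a free left `R`-module on the monomials `x₁ ^ α₁ ⋯ xₙ ^ αₙ`: every element of `A` is
  in exactly one way a finite sum `∑ r_α x ^ α`. -/
  basis : Function.Bijective fun f : (Fin n → ℕ) →₀ R =>
    f.sum fun α r => ι r * (List.ofFn fun i => x i ^ α i).prod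
  comm_coeff : ∀ i, ∀ r : R, r ≠ 0 → ∃ c : R, c ≠ 0 ∧ ∃ r₀ : R, x i * ι r - ι c * x i = ι r₀
  comm_var : ∀ i j, ∃ e : R, e ≠ 0 ∧ ∃ (r₀ : R) (r : Fin n → R),
    x j * x i - ι e * x i * x j = ι r₀ + ∑ m, ι (r m) * x m

/-- The Gelfand–Kirillov dimension of a `k`-algebra: the supremum over the finite-dimensional
subspaces `V` of `limsup log (dim (k + V) ^ n) / log n`, where `(k + V) ^ n` is the span of all
products of at most `n` elements of `V`. For an affine algebra, every `V` that generates the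
algebra attains the supremum. -/
noncomputable def gkDim (k : Type v) (A : Type u) [Field k] [Ring A] [Algebra k A] : EReal :=
  ⨆ V : {V : Submodule k A // V.FG},
    limsup (fun n : ℕ =>
      ((Real.log (Module.finrank k ↥((1 ⊔ V.1) ^ n)) / Real.log n : ℝ) : EReal)) atTop

/-- A differential calculus `(ΩA, d)` over the `k`-algebra `A`: a differential graded algebra
`ΩA = ⨁ Ωⁿ A` with `Ω⁰ A = A` (through `coeff`) and `Ωⁿ A = A dA ∧ ⋯ ∧ dA`. The product `∧` is
written `*`. Since `ΩA` is generated by `A` and `dA`, taking it in the universe of `A` is no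
restriction. -/
structure DifferentialCalculus (k : Type v) (A : Type u) [Field k] [Ring A] [Algebra k A] where
  /-- the algebra `ΩA` of all forms -/
  Form : Type u
  [ring : Ring Form]
  [algebra : Algebra k Form]
  /-- the space `Ωⁿ A` of `n`-forms -/
  degree : ℕ → Submodule k Form
  [graded : GradedAlgebra degree]
  d : Form →ₗ[k] Form
  d_mem : ∀ (n : ℕ) (ω : Form), ω ∈ degree n → d ω ∈ degree (n + 1)
  d_mul : ∀ (n : ℕ) (ω η : Form), ω ∈ degree n → d (ω * η) = d ω * η + (-1) ^ n * (ω * d η)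
  d_d : ∀ ω, d (d ω) = 0
  coeff : A →ₐ[k] Form
  coeff_injective : Function.Injective coeff
  mem_degree_zero : ∀ ω, ω ∈ degree 0 ↔ ∃ a, coeff a = ω
  density : ∀ n : ℕ, degree n =
    Submodule.span k {ω | ∃ (a : A) (b : Fin n → A),
      ω = coeff a * (List.ofFn fun i => d (coeff (b i))).prod}

namespace DifferentialCalculus

attribute [instance] DifferentialCalculus.ring DifferentialCalculus.algebra
  DifferentialCalculus.graded

variable {k : Type v} {A : Type u} [Field k] [Ring A] [Algebra k A] (C : DifferentialCalculus k A)

theorem coeff_mem (a : A) : C.coeff a ∈ C.degree 0 := (C.mem_degree_zero _).2 ⟨a, rfl⟩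

/-- The calculus is connected: `ker (d : A → Ω¹ A) = k`. -/
def IsConnected : Prop :=
  ∀ a : A, C.d (C.coeff a) = 0 ↔ ∃ c : k, a = algebraMap k A c

/-- The calculus has dimension `n`. -/
def HasDimension (n : ℕ) : Prop :=
  C.degree n ≠ ⊥ ∧ ∀ m, n < m → C.degree m = ⊥

/-- The left action of `A` on `m`-forms. -/
def lmul {m : ℕ} (a : A) (ω : C.degree m) : C.degree m :=
  ⟨C.coeff a * ω, by
    have h := SetLike.mul_mem_graded (A := C.degree) (C.coeff_mem a) ω.2
    rwa [zero_add] at h⟩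

/-- The right action of `A` on `m`-forms. -/
def rmul {m : ℕ} (ω : C.degree m) (a : A) : C.degree m :=
  ⟨(ω : C.Form) * C.coeff a, SetLike.mul_mem_graded (A := C.degree) ω.2 (C.coeff_mem a)⟩

/-- The product of an `m`-form and an `l`-form. -/
def wedge {m l : ℕ} (ω : C.degree m) (η : C.degree l) : C.degree (m + l) :=
  ⟨(ω : C.Form) * η, SetLike.mul_mem_graded (A := C.degree) ω.2 η.2⟩

/-- The differential of an `m`-form. -/
def diff {m : ℕ} (ω : C.degree m) : C.degree (m + 1) := ⟨C.d ω, C.d_mem m ω ω.2⟩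

/-- The differential of an element of `A`. -/
def diffCoeff (a : A) : C.degree 1 := ⟨C.d (C.coeff a), C.d_mem 0 _ (C.coeff_mem a)⟩

/-- The integral forms `I_m A`: the right `A`-linear maps `Ωᵐ A → A`. -/
def integralForms (m : ℕ) : Submodule k (C.degree m →ₗ[k] A) where
  carrier := {φ | ∀ ω a, φ (C.rmul ω a) = φ ω * a}
  add_mem' := fun hφ hψ ω a => by
    simp only [LinearMap.add_apply, add_mul, hφ ω a, hψ ω a]
  zero_mem' := fun ω a => by simp
  smul_mem' := fun c φ hφ ω a => by
    simp only [LinearMap.smul_apply, hφ ω a, smul_mul_assoc]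

variable {C}

/-- The left action `(a · φ)(ω) = a φ(ω)` of `A` on integral forms. -/
def integralLmul {m : ℕ} (a : A) (φ : C.integralForms m) : C.integralForms m :=
  ⟨(LinearMap.mulLeft k a) ∘ₗ φ.1, fun ω b => by
    simp only [LinearMap.comp_apply, LinearMap.mulLeft_apply, φ.2 ω b, mul_assoc]⟩

/-- The right action `(φ · a)(ω) = φ(a ω)` of `A` on integral forms. -/
def integralRmul {m : ℕ} (φ : C.integralForms m) (a : A) : C.integralForms m :=
  ⟨{  toFun := fun ω => φ.1 (C.lmul a ω)
      map_add' := fun ω η => by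
        rw [← map_add]; congr 1; exact Subtype.ext (mul_add _ _ _)
      map_smul' := fun c ω => by
        rw [RingHom.id_apply, ← map_smul]; congr 1; exact Subtype.ext (mul_smul_comm _ _ _) },
    fun ω b => by
      change φ.1 _ = φ.1 _ * b
      rw [← φ.2]; congr 1; exact Subtype.ext (mul_assoc _ _ _).symm⟩

/-- The right action `(φ · ω)(η) = φ(ω ∧ η)` of forms on integral forms. -/
def contract {m l : ℕ} (φ : C.integralForms (m + l)) (ω : C.degree m) : C.integralForms l :=
  ⟨{  toFun := fun η => φ.1 (C.wedge ω η)
      map_add' := fun η ζ => by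
        rw [← map_add]; congr 1; exact Subtype.ext (mul_add _ _ _)
      map_smul' := fun c η => by
        rw [RingHom.id_apply, ← map_smul]; congr 1; exact Subtype.ext (mul_smul_comm _ _ _) },
    fun η b => by
      change φ.1 _ = φ.1 _ * b
      rw [← φ.2]; congr 1; exact Subtype.ext (mul_assoc _ _ _).symm⟩

variable (C)

/-- A divergence (hom-connection) on `A`. -/
structure Divergence where
  toLin : C.integralForms 1 →ₗ[k] A
  leibniz : ∀ (φ : C.integralForms 1) (a : A),
    toLin (integralRmul φ a) = toLin φ * a + φ.1 (C.diffCoeff a)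

variable {C}

/-- The extension `∇_m : I_{m+1} A → I_m A` of a divergence `∇`,
`∇_m(φ)(ω) = ∇(φ · ω) + (-1) ^ (m + 1) φ(d ω)`. -/
def Divergence.extend (D : C.Divergence) (m : ℕ) (φ : C.integralForms (m + 1)) :
    C.integralForms m :=
  ⟨{  toFun := fun ω => D.toLin (contract φ ω) + (-1) ^ (m + 1) * φ.1 (C.diff ω)
      map_add' := fun ω η => by
        have h1 : contract φ (ω + η) = contract φ ω + contract φ η := by
          refine Subtype.ext (LinearMap.ext fun ζ => ?_)
          change φ.1 _ = φ.1 _ + φ.1 _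
          rw [← map_add]; congr 1; exact Subtype.ext (add_mul _ _ _)
        have h2 : C.diff (ω + η) = C.diff ω + C.diff η := Subtype.ext (map_add C.d _ _)
        rw [h1, h2, map_add, map_add]; noncomm_ring
      map_smul' := fun c ω => by
        have h1 : contract φ (c • ω) = c • contract φ ω := by
          refine Subtype.ext (LinearMap.ext fun ζ => ?_)
          change φ.1 _ = c • φ.1 _
          rw [← map_smul]; congr 1; exact Subtype.ext (smul_mul_assoc _ _ _)
        have h2 : C.diff (c • ω) = c • C.diff ω := Subtype.ext (map_smul C.d _ _)
        rw [h1, h2, map_smul, map_smul, RingHom.id_apply, smul_add, mul_smul_comm] },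
    fun ω a => by
      change D.toLin (contract φ (C.rmul ω a)) + (-1) ^ (m + 1) * φ.1 (C.diff (C.rmul ω a)) =
        (D.toLin (contract φ ω) + (-1) ^ (m + 1) * φ.1 (C.diff ω)) * a
      have h1 : contract φ (C.rmul ω a) = integralRmul (contract φ ω) a := by
        refine Subtype.ext (LinearMap.ext fun ζ => ?_)
        change φ.1 _ = φ.1 _
        congr 1; exact Subtype.ext (mul_assoc _ _ _)
      have h2 : C.diff (C.rmul ω a) =
          C.rmul (C.diff ω) a + ((-1 : k) ^ m) • C.wedge ω (C.diffCoeff a) := by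
        refine Subtype.ext ?_
        change C.d ((ω : C.Form) * C.coeff a) =
          C.d ω * C.coeff a + ((-1 : k) ^ m) • ((ω : C.Form) * C.d (C.coeff a))
        rw [C.d_mul m _ _ ω.2, Algebra.smul_def, map_pow, map_neg, map_one]
      have h3 : (contract φ ω).1 (C.diffCoeff a) = φ.1 (C.wedge ω (C.diffCoeff a)) := rfl
      have h4 : ((-1 : A) ^ (m + 1)) * ((-1 : k) ^ m • φ.1 (C.wedge ω (C.diffCoeff a))) =
          - φ.1 (C.wedge ω (C.diffCoeff a)) := by
        rw [Algebra.smul_def, map_pow, map_neg, map_one, ← mul_assoc, ← pow_add,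
          show m + 1 + m = 2 * m + 1 by ring, pow_succ, pow_mul]
        simp
      rw [h1, h2, D.leibniz, h3, map_add, map_smul, φ.2, mul_add, h4]
      noncomm_ring⟩

/-- The curvature `∇ ∘ ∇₁` vanishes, so that the integral forms with the maps `∇_m` are a complex
of integral forms. -/
def Divergence.IsFlat (D : C.Divergence) : Prop :=
  ∀ φ : C.integralForms (1 + 1), D.toLin (D.extend 1 φ) = 0

variable (C)

/-- The `n`-dimensional calculus is integrable: for some complex of integral forms and some
automorphism `ν` of `A` there are bimodule isomorphisms `Θ_l : Ωˡ A → ^ν I_{n-l} A`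
(`l = 0, …, n`; below `m = n - l`) that intertwine `d` with the maps `∇_m`. Here `I₀ A`, the right
`A`-linear maps `A → A`, stands for `A`, and the last map `∇ : I₁ A → A` of the complex is then
`∇₀`, since `∇₀(φ)(a) = ∇(φ) a`. -/
def IsIntegrable (n : ℕ) : Prop :=
  C.HasDimension n ∧
  ∃ D : C.Divergence, D.IsFlat ∧
  ∃ ν : A ≃ₐ[k] A,
  ∃ Θ : ∀ l m : ℕ, l + m = n → (C.degree l ≃ₗ[k] C.integralForms m),
    (∀ (l m : ℕ) (h : l + m = n) (a b : A) (ω : C.degree l),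
      Θ l m h (C.rmul (C.lmul a ω) b) = integralRmul (integralLmul (ν a) (Θ l m h ω)) b) ∧
    (∀ (l m : ℕ) (h : l + (m + 1) = n) (h' : l + 1 + m = n) (ω : C.degree l),
      Θ (l + 1) m h' (C.diff ω) = D.extend m (Θ l (m + 1) h ω))

end DifferentialCalculus

/-- `A` is differentially smooth: an affine algebra whose Gelfand–Kirillov dimension is an integer
`n` and which admits an `n`-dimensional connected integrable differential calculus. -/
def IsDifferentiallySmooth (k : Type v) (A : Type u) [Field k] [Ring A] [Algebra k A] : Prop :=
  Algebra.FiniteType k A ∧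
  ∃ n : ℕ, gkDim k A = ((n : ℝ) : EReal) ∧
  ∃ C : DifferentialCalculus k A, C.IsConnected ∧ C.IsIntegrable n

/-! A translation of the variables `t_l` achieves `b_{sl} (a_{ill} - 1) = 0` (`exists_translate`).
Then `A` is an algebra on five ordered generators `t₁ < t₂ < x₁ < x₂ < x₃` with quadratic relations,
and the ordered monomials are a `k`-basis. Such an algebra is presented by its relations
(`QuadRel.exists_algHom`) and has Gelfand–Kirillov dimension 5 (`gkDim_eq_card`). What is needed is
a connected integrable calculus of dimension 5.

The forms are sought as the free right `A`-module on exterior monomials `e_S` with `e_s e_t =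
-ε_{st} e_t e_s` and `y_j e_s = G_{js} e_s y_j + ∑_r n^j_{rs} e_r`. They are realized as operators
on the functions `Finset I → A`: `e_s` is a creation operator, and `y_j` is a scaling plus a
combination of products of a creation and an annihilation operator. Associativity is then automatic,
and the existence of the calculus reduces to scalar identities, `FormData.Compatible` and
`FormData.HasDifferential`. They make the operators satisfy the relations of `A` (`holds_gen`) and
the values `d y_j` extend to a derivation (`QuadRel.exists_derivation`).

Integrability comes from the volume form. The coefficient of `e_univ` in `ω ∧ η` is a perfect
pairing between complementary degrees; it identifies forms with integral forms, and the divergence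
is transported from `d`. The signs match because the dimension is odd
(`DifferentialCalculus.Volume.isIntegrable`). Connectedness follows from the leading terms of the
partial derivatives in characteristic zero (`exists_eq_algebraMap`).

It remains to choose the structure constants. When all `c_{ij} = 1`, the matrices by which the `x_i`
act on the `d x_s` must form a left-symmetric structure on the Lie algebra with structure constants
`q`. The overlaps `x_j x_i t_l` and `x_i t_l t_m`, the Jacobi identity and the hypotheses leave few
vanishing patterns for `q` (`SkewParams.consistent`, `struct_cases`). In most of them nearly
diagonal matrices work; in another the derived algebra is a line, and all matrices are multiples of
one matrix. The last pattern is a colour version of `so₃`, and `so₃` has no left-symmetric structure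
in characteristic zero. There `t₁` helps: a logarithmic form takes the place of `d t₁`, and together
with the `d x_i` it carries the left multiplication of a quaternion algebra (`logData`). -/

/-- Structure constants of a system of relations
`y_j y_i = c_{ij} y_i y_j + κ_{ij} + ∑ q_{ij}^m y_m`. -/
structure QuadRel (k I : Type*) where
  c : I → I → k
  κ : I → I → k
  q : I → I → I → k

/-- The family `y` satisfies the relations for all `i < j`. -/
def QuadRel.Holds {k I : Type*} [Field k] [LinearOrder I] [Fintype I] (R : QuadRel k I)
    {B : Type*} [Ring B] [Algebra k B] (y : I → B) : Prop :=
  ∀ i j, i < j → y j * y i =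
    R.c i j • (y i * y j) + algebraMap k B (R.κ i j) + ∑ m, R.q i j m • y m

/-! ### Words, ordered monomials and reordering. -/

/-- The product of the family `y` along a word. -/
def wordProd {I B : Type*} [Monoid B] (y : I → B) (l : List I) : B := (l.map y).prod

/-- The ordered monomial with the given multiset of letters. -/
def sortedProd {I B : Type*} [LinearOrder I] [Monoid B] (y : I → B) (m : Multiset I) : B :=
  wordProd y m.sort

section Words

variable {I B : Type*} [Monoid B] (y : I → B)

@[simp] theorem wordProd_nil : wordProd y [] = 1 := rfl

@[simp] theorem wordProd_cons (i : I) (l : List I) :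
    wordProd y (i :: l) = y i * wordProd y l := by simp [wordProd]

@[simp] theorem wordProd_append (l l' : List I) :
    wordProd y (l ++ l') = wordProd y l * wordProd y l' := by simp [wordProd]

@[simp] theorem sortedProd_zero [LinearOrder I] : sortedProd y (0 : Multiset I) = 1 := by
  simp [sortedProd]

theorem sortedProd_cons [LinearOrder I] {i : I} {m : Multiset I} (h : ∀ j ∈ m, i ≤ j) :
    sortedProd y (i ::ₘ m) = y i * sortedProd y m := by
  rw [sortedProd, Multiset.sort_cons _ _ _ h, wordProd_cons, sortedProd]

theorem sortedProd_coe [LinearOrder I] {l : List I} (h : l.Pairwise (· ≤ ·)) :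
    sortedProd y (l : Multiset I) = wordProd y l := by
  induction l with
  | nil => simp
  | cons a l ih =>
    rw [List.pairwise_cons] at h
    rw [← Multiset.cons_coe, sortedProd_cons _ (by simpa using h.1), ih h.2, wordProd_cons]

end Words

/-- A property of words of a fixed length that is stable under exchanging adjacent letters is
stable under permutations. -/
theorem List.Perm.iff_of_swap {I : Type*} [LinearOrder I] {n : ℕ} (C : List I → Prop)
    (hC : ∀ i j, i < j → ∀ l l', (l ++ j :: i :: l').length = n →
      (C (l ++ j :: i :: l') ↔ C (l ++ i :: j :: l')))
    {l l' : List I} (h : l.Perm l') :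
    ∀ p : List I, (p ++ l).length = n → (C (p ++ l) ↔ C (p ++ l')) := by
  induction h with
  | nil => intro p _; rfl
  | cons x _ ih =>
    intro p hp
    simpa using ih (p ++ [x]) (by simpa using hp)
  | swap x z l =>
    intro p hp
    rcases lt_trichotomy x z with h | h | h
    · exact hC x z h p l hp
    · subst h; rfl
    · exact (hC z x h p l (by simpa using hp)).symm
  | trans h₁ _ ih₁ ih₂ =>
    intro p hp
    exact (ih₁ p hp).trans (ih₂ p (by simpa [h₁.length_eq] using hp))

/-- The tool for every reordering below. Swaps are only required to preserve `C` at the length of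
`l`, so that corrections by shorter words can be left to an outer induction on the length. -/
theorem List.iff_sort_of_swap {I : Type*} [LinearOrder I] (C : List I → Prop) (l : List I)
    (hC : ∀ i j, i < j → ∀ p p', (p ++ j :: i :: p').length = l.length →
      (C (p ++ j :: i :: p') ↔ C (p ++ i :: j :: p'))) :
    C l ↔ C (l : Multiset I).sort := by
  have h : l.Perm (l : Multiset I).sort := by
    rw [← Multiset.coe_eq_coe, Multiset.sort_eq]
  exact h.iff_of_swap C hC [] rfl

/-! ### The filtration by word length, and presentation by quadratic relations. -/

namespace QuadRel

section Filtration

variable {k I : Type*} [Field k] {A : Type*} [Ring A] [Algebra k A] {y : I → A}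

/-- The span of the words of length less than `m`. -/
def filt (k : Type*) [Field k] {I A : Type*} [Ring A] [Algebra k A] (y : I → A) (m : ℕ) :
    Submodule k A :=
  -- The bound is strict: step `0` is zero, and step `l.length` contains exactly what is of lower
  -- order than the word `l`.
  Submodule.span k (wordProd y '' {l | l.length < m})

theorem wordProd_mem_filt {l : List I} {m : ℕ} (h : l.length < m) :
    wordProd y l ∈ filt k y m := Submodule.subset_span ⟨l, h, rfl⟩

theorem filt_mono {m m' : ℕ} (h : m ≤ m') : filt k y m ≤ filt k y m' :=
  Submodule.span_mono (Set.image_mono fun _ hl => lt_of_lt_of_le hl h)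

theorem mul_mem_filt (i : I) {a : A} {m : ℕ} (h : a ∈ filt k y m) :
    y i * a ∈ filt k y (m + 1) := by
  induction h using Submodule.span_induction with
  | mem x hx =>
    obtain ⟨l, hl, rfl⟩ := hx
    rw [← wordProd_cons]
    exact wordProd_mem_filt (by simpa using hl)
  | zero => simp
  | add x z _ _ hx hz => rw [mul_add]; exact add_mem hx hz
  | smul c x _ hx => rw [mul_smul_comm]; exact Submodule.smul_mem _ _ hx

theorem filt_zero : filt k y 0 = ⊥ := by simp [filt]

theorem wordProd_mem_adjoin (l : List I) : wordProd y l ∈ Algebra.adjoin k (Set.range y) := by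
  induction l with
  | nil => exact one_mem _
  | cons i l ih =>
    rw [wordProd_cons]; exact mul_mem (Algebra.subset_adjoin ⟨i, rfl⟩) ih

theorem exists_mem_filt [LinearOrder I] (b : Module.Basis (Multiset I) k A)
    (hb : ∀ m, b m = sortedProd y m)
    (a : A) : ∃ n, a ∈ filt k y n := by
  have : a ∈ Submodule.span k (Set.range b) := by rw [b.span_eq]; trivial
  induction this using Submodule.span_induction with
  | mem x hx =>
    obtain ⟨m, rfl⟩ := hx
    exact ⟨m.card + 1, by rw [hb]; exact wordProd_mem_filt (by simp)⟩
  | zero => exact ⟨0, zero_mem _⟩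
  | add x z _ _ hx hz =>
    obtain ⟨n, hn⟩ := hx
    obtain ⟨n', hn'⟩ := hz
    exact ⟨max n n', add_mem (filt_mono (le_max_left _ _) hn) (filt_mono (le_max_right _ _) hn')⟩
  | smul c x _ hx => exact hx.imp fun n hn => Submodule.smul_mem _ _ hn

theorem adjoin_eq_top [LinearOrder I] (b : Module.Basis (Multiset I) k A)
    (hb : ∀ m, b m = sortedProd y m) :
    Algebra.adjoin k (Set.range y) = ⊤ := by
  refine eq_top_iff.2 fun a _ => ?_
  have : a ∈ Submodule.span k (Set.range b) := by rw [b.span_eq]; trivial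
  refine (Submodule.span_le (p := (Algebra.adjoin k (Set.range y)).toSubmodule)).2 ?_ this
  rintro _ ⟨m, rfl⟩
  rw [hb]
  exact wordProd_mem_adjoin _

end Filtration

variable {k I : Type*} [Field k] [LinearOrder I] [Fintype I] {R : QuadRel k I}

theorem Holds.wordProd_swap {B : Type*} [Ring B] [Algebra k B] {y : I → B} (h : R.Holds y)
    {i j : I} (hij : i < j) (l l' : List I) :
    wordProd y (l ++ j :: i :: l') = R.c i j • wordProd y (l ++ i :: j :: l') +
      R.κ i j • wordProd y (l ++ l') + ∑ m, R.q i j m • wordProd y (l ++ m :: l') := by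
  simp only [wordProd_append, wordProd_cons]
  rw [← mul_assoc (y j), h i j hij]
  simp only [add_mul, mul_add, Finset.sum_mul, Finset.mul_sum, smul_mul_assoc, mul_smul_comm,
    mul_assoc, Algebra.algebraMap_eq_smul_one, one_mul]

variable {A : Type*} [Ring A] [Algebra k A] {y : I → A}

/-- Modulo shorter words, exchanging adjacent letters only rescales a word by a nonzero scalar, so
membership can be tested on the sorted word. -/
theorem wordProd_mem_span_sorted (h : R.Holds y) (hc : ∀ i j, i < j → R.c i j ≠ 0) (l : List I) :
    wordProd y l ∈ Submodule.span k (sortedProd y '' {m | m.card ≤ l.length}) := by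
  induction hn : l.length using Nat.strong_induction_on generalizing l with
  | _ n ih =>
    have hmono : ∀ l' : List I, l'.length < n →
        wordProd y l' ∈ Submodule.span k (sortedProd y '' {m | m.card ≤ n}) := fun l' hl' =>
      Submodule.span_mono (Set.image_mono (Set.ofPred_subset_ofPred.2 fun m hm =>
        hm.trans hl'.le)) (ih _ hl' l' rfl)
    refine (List.iff_sort_of_swap (fun l => wordProd y l ∈ Submodule.span k
      (sortedProd y '' {m | m.card ≤ n})) l fun i j hij p p' hp => ?_).2 ?_
    · rw [hn] at hp
      simp only [List.length_append, List.length_cons] at hp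
      simp only [h.wordProd_swap hij p p']
      have h1 : R.κ i j • wordProd y (p ++ p') + ∑ m, R.q i j m • wordProd y (p ++ m :: p') ∈
          Submodule.span k (sortedProd y '' {m | m.card ≤ n}) := by
        refine add_mem (Submodule.smul_mem _ _ (hmono _ ?_))
          (sum_mem fun m _ => Submodule.smul_mem _ _ (hmono _ ?_))
        · simp only [List.length_append]; omega
        · simp only [List.length_append, List.length_cons]; omega
      rw [add_assoc, Submodule.add_mem_iff_left _ h1, Submodule.smul_mem_iff _ (hc i j hij)]
    · exact Submodule.subset_span ⟨l, by simp [hn], rfl⟩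

theorem filt_eq_span_sorted (h : R.Holds y) (hc : ∀ i j, i < j → R.c i j ≠ 0) (n : ℕ) :
    filt k y n = Submodule.span k (sortedProd y '' {m | m.card < n}) := by
  apply le_antisymm
  · rw [filt, Submodule.span_le]
    rintro _ ⟨l, hl, rfl⟩
    exact Submodule.span_mono (Set.image_mono (Set.ofPred_subset_ofPred.2 fun m hm =>
      lt_of_le_of_lt hm hl)) (wordProd_mem_span_sorted h hc l)
  · rw [Submodule.span_le]
    rintro _ ⟨m, hm, rfl⟩
    exact wordProd_mem_filt (by simpa using hm)

/-- An algebra whose ordered monomials are a basis is presented by its relations. -/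
theorem exists_algHom (h : R.Holds y) (hc : ∀ i j, i < j → R.c i j ≠ 0)
    (b : Module.Basis (Multiset I) k A) (hb : ∀ m, b m = sortedProd y m)
    {B : Type*} [Ring B] [Algebra k B] (z : I → B) (hz : R.Holds z) :
    ∃ f : A →ₐ[k] B, ∀ i, f (y i) = z i := by
  -- The map is prescribed on ordered monomials. That it sends each word in `y` to the same word in
  -- `z` is stable under swaps, because a swap changes both sides by the same combination of shorter
  -- words. No confluence check is needed, since the basis is given.
  let f : A →ₗ[k] B := b.constr k (sortedProd z)
  have hf (m : Multiset I) : f (sortedProd y m) = sortedProd z m := by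
    rw [← hb, Module.Basis.constr_basis]
  have hw (l : List I) : f (wordProd y l) = wordProd z l := by
    induction hn : l.length using Nat.strong_induction_on generalizing l with
    | _ n ih =>
      refine (List.iff_sort_of_swap (fun l => f (wordProd y l) = wordProd z l) l
        fun i j hij p p' hp => ?_).2 (hf l)
      rw [hn] at hp
      simp only [List.length_append, List.length_cons] at hp
      have h1 : f (wordProd y (p ++ p')) = wordProd z (p ++ p') :=
        ih _ (by simp only [List.length_append]; omega) _ rfl
      have h2 : ∀ m, f (wordProd y (p ++ m :: p')) = wordProd z (p ++ m :: p') := fun m =>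
        ih _ (by simp only [List.length_append, List.length_cons]; omega) _ rfl
      simp only [h.wordProd_swap hij p p', hz.wordProd_swap hij p p', map_add, map_smul, map_sum,
        h1, h2, add_left_inj]
      exact (smul_right_injective B (hc i j hij)).eq_iff
  have hspan (a : A) : a ∈ Submodule.span k (Set.range (wordProd y)) := by
    have : a ∈ Submodule.span k (Set.range b) := by rw [b.span_eq]; trivial
    refine Submodule.span_mono ?_ this
    rintro _ ⟨m, rfl⟩
    rw [hb]
    exact ⟨_, rfl⟩
  have hmul (a a' : A) : f (a * a') = f a * f a' := by
    induction hspan a using Submodule.span_induction with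
    | mem x hx =>
      obtain ⟨l, rfl⟩ := hx
      induction hspan a' using Submodule.span_induction with
      | mem x hx =>
        obtain ⟨l', rfl⟩ := hx
        rw [← wordProd_append, hw, hw, hw, wordProd_append]
      | zero => simp
      | add x z _ _ hx hz => rw [mul_add, map_add, hx, hz, map_add, mul_add]
      | smul c x _ hx => rw [mul_smul_comm, map_smul, hx, map_smul, mul_smul_comm]
    | zero => simp
    | add x z _ _ hx hz => rw [add_mul, map_add, hx, hz, map_add, add_mul]
    | smul c x _ hx => rw [smul_mul_assoc, map_smul, hx, map_smul, smul_mul_assoc]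
  have h1 := hw []
  rw [wordProd_nil, wordProd_nil] at h1
  have hi (i : I) := hw [i]
  simp only [wordProd_cons, wordProd_nil, mul_one] at hi
  exact ⟨AlgHom.ofLinearMap f h1 hmul, hi⟩

end QuadRel

/-- An endomorphism that rescales and shifts each generator is bijective. -/
theorem QuadRel.bijective_of_affine {k I A : Type*} [Field k] [Finite I] [Ring A] [Algebra k A]
    {y : I → A} (hy : Algebra.adjoin k (Set.range y) = ⊤) (f : A →ₐ[k] A) (g c : I → k)
    (hg : ∀ i, g i ≠ 0) (hf : ∀ i, f (y i) = g i • y i + algebraMap k A (c i)) :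
    Function.Bijective f := by
  -- Each filtration step is finite-dimensional and `f` maps it onto itself, so `f` is injective on
  -- it, and the steps exhaust `A`.
  have hfin (m : ℕ) : Module.Finite k (QuadRel.filt k y m) :=
    Module.Finite.span_of_finite k ((List.finite_length_lt I m).image _)
  have hle (m : ℕ) : ∀ a ∈ QuadRel.filt k y m, f a ∈ QuadRel.filt k y m := by
    intro a ha
    refine (Submodule.span_le (p := (QuadRel.filt k y m).comap f.toLinearMap)).2 ?_ ha
    rintro _ ⟨l, hl, rfl⟩
    change f (wordProd y l) ∈ QuadRel.filt k y m
    clear ha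
    induction l generalizing m with
    | nil => rw [wordProd_nil, map_one]; exact QuadRel.wordProd_mem_filt (l := []) hl
    | cons i l ih =>
      obtain ⟨m, rfl⟩ : ∃ m', m = m' + 1 :=
        ⟨m - 1, by have : l.length + 1 < m := by simpa using hl
                   omega⟩
      have hl' : l.length < m := by simpa using hl
      have := ih m hl'
      rw [wordProd_cons, map_mul, hf, add_mul, smul_mul_assoc, ← Algebra.smul_def]
      exact add_mem (Submodule.smul_mem _ _ (QuadRel.mul_mem_filt i this))
        (Submodule.smul_mem _ _ (QuadRel.filt_mono m.le_succ this))
  have hsurj (m : ℕ) : ∀ a ∈ QuadRel.filt k y m, ∃ a' ∈ QuadRel.filt k y m, f a' = a := by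
    intro a ha
    refine (Submodule.span_le (p := (QuadRel.filt k y m).map f.toLinearMap)).2 ?_ ha
    rintro _ ⟨l, hl, rfl⟩
    change ∃ a' ∈ QuadRel.filt k y m, f a' = wordProd y l
    clear ha
    induction l generalizing m with
    | nil => exact ⟨1, QuadRel.wordProd_mem_filt (l := []) hl, by simp⟩
    | cons i l ih =>
      obtain ⟨m, rfl⟩ : ∃ m', m = m' + 1 :=
        ⟨m - 1, by have : l.length + 1 < m := by simpa using hl
                   omega⟩
      have hl' : l.length < m := by simpa using hl
      obtain ⟨a, ha, hal⟩ := ih m hl'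
      -- With `f a` equal to the tail of the word, this solves the affine rule for the first letter.
      refine ⟨(g i)⁻¹ • (y i * a - c i • a), Submodule.smul_mem _ _ (sub_mem
        (QuadRel.mul_mem_filt i ha)
        (Submodule.smul_mem _ _ (QuadRel.filt_mono m.le_succ ha))), ?_⟩
      rw [map_smul, map_sub, map_mul, map_smul, hf, add_mul, ← Algebra.smul_def,
        add_sub_cancel_right, hal, smul_mul_assoc, smul_smul, inv_mul_cancel₀ (hg i), one_smul,
        wordProd_cons]
  have hall (a : A) : ∃ m, a ∈ QuadRel.filt k y m := by
    have h : a ∈ Submodule.span k (Set.range (wordProd y)) := by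
      have h' : a ∈ (Algebra.adjoin k (Set.range y)).toSubmodule := by rw [hy]; trivial
      rw [Algebra.adjoin_eq_span] at h'
      refine Submodule.span_mono ?_ h'
      intro x hx
      induction hx using Submonoid.closure_induction with
      | mem x hx => obtain ⟨i, rfl⟩ := hx; exact ⟨[i], by simp⟩
      | one => exact ⟨[], rfl⟩
      | mul x z _ _ hx hz =>
        obtain ⟨l, rfl⟩ := hx
        obtain ⟨l', rfl⟩ := hz
        exact ⟨l ++ l', by simp⟩
    induction h using Submodule.span_induction with
    | mem x hx =>
      obtain ⟨l, rfl⟩ := hx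
      exact ⟨_, QuadRel.wordProd_mem_filt l.length.lt_succ_self⟩
    | zero => exact ⟨0, zero_mem _⟩
    | add x z _ _ hx hz =>
      obtain ⟨n, hn⟩ := hx
      obtain ⟨n', hn'⟩ := hz
      exact ⟨max n n', add_mem (QuadRel.filt_mono (le_max_left _ _) hn)
        (QuadRel.filt_mono (le_max_right _ _) hn')⟩
    | smul c x _ hx => exact hx.imp fun n hn => Submodule.smul_mem _ _ hn
  constructor
  · rw [injective_iff_map_eq_zero]
    intro a ha
    obtain ⟨m, hm⟩ := hall a
    have := hfin m
    let fm : QuadRel.filt k y m →ₗ[k] QuadRel.filt k y m := f.toLinearMap.restrict (hle m)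
    have hs : Function.Surjective fm := fun b => by
      obtain ⟨a', ha', h⟩ := hsurj m b.1 b.2
      exact ⟨⟨a', ha'⟩, Subtype.ext h⟩
    have hi := LinearMap.injective_iff_surjective.2 hs
    have : (⟨a, hm⟩ : QuadRel.filt k y m) = 0 := hi (by
      rw [map_zero]; exact Subtype.ext ha)
    exact congrArg Subtype.val this
  · intro a
    obtain ⟨m, hm⟩ := hall a
    obtain ⟨a', -, h⟩ := hsurj m a hm
    exact ⟨a', h⟩

/-! ### Creation and annihilation operators on a colour exterior algebra with coefficients -/

namespace ColorExt

variable {k I : Type*} [Field k] [LinearOrder I]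

/-- The scalar by which `e_S e_T` differs from the ordered monomial `e_{S ∪ T}` when
`e_s e_t = -ε_{st} e_t e_s`. -/
def sgn (ε : I → I → k) (S T : Finset I) : k :=
  ∏ s ∈ S, ∏ t ∈ T, if t < s then -ε s t else 1

variable {ε : I → I → k}

@[simp] theorem sgn_empty_left (T : Finset I) : sgn ε ∅ T = 1 := by simp [sgn]

@[simp] theorem sgn_empty_right (S : Finset I) : sgn ε S ∅ = 1 := by simp [sgn]

theorem sgn_union_left {S S' : Finset I} (h : Disjoint S S') (T : Finset I) :
    sgn ε (S ∪ S') T = sgn ε S T * sgn ε S' T := by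
  rw [sgn, Finset.prod_union h]; rfl

theorem sgn_union_right (S : Finset I) {T T' : Finset I} (h : Disjoint T T') :
    sgn ε S (T ∪ T') = sgn ε S T * sgn ε S T' := by
  simp only [sgn, Finset.prod_union h, Finset.prod_mul_distrib]

theorem sgn_ne_zero (hε : ∀ i j, ε i j * ε j i = 1) (S T : Finset I) : sgn ε S T ≠ 0 := by
  refine Finset.prod_ne_zero_iff.2 fun s _ => Finset.prod_ne_zero_iff.2 fun t _ => ?_
  split_ifs
  · exact neg_ne_zero.2 (left_ne_zero_of_mul_eq_one (hε s t))
  · exact one_ne_zero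

section Operators

variable (A : Type*) [Ring A] [Algebra k A] (ε)

/-- Left multiplication by `e_S`. -/
def create (S : Finset I) : Module.End k (Finset I → A) where
  toFun f U := if S ⊆ U then sgn ε S (U \ S) • f (U \ S) else 0
  map_add' f g := by ext U; simp only [Pi.add_apply]; split_ifs <;> simp
  map_smul' c f := by
    ext U; simp only [Pi.smul_apply, RingHom.id_apply]; split_ifs <;> simp [smul_comm c]

/-- The left derivative with respect to `e_s`. -/
def annih (s : I) : Module.End k (Finset I → A) where
  -- Under `ε_{ij} ε_{ji} = 1`, transposing `ε` inverts the sign that `create` introduces.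
  toFun f U := if s ∈ U then 0 else sgn (fun i j => ε j i) {s} U • f (insert s U)
  map_add' f g := by ext U; simp only [Pi.add_apply]; split_ifs <;> simp
  map_smul' c f := by
    ext U; simp only [Pi.smul_apply, RingHom.id_apply]; split_ifs <;> simp [smul_comm c]

/-- Left multiplication by `a`, where `a` passes `e_s` at the cost of the scalar `g s`. -/
def scale (g : I → k) (a : A) : Module.End k (Finset I → A) where
  toFun f U := (∏ s ∈ U, g s) • (a * f U)
  map_add' f g := by ext U; simp [mul_add]
  map_smul' c f := by ext U; simp [smul_comm c]

variable {A ε}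

theorem create_apply (S : Finset I) (f : Finset I → A) (U : Finset I) :
    create ε A S f U = if S ⊆ U then sgn ε S (U \ S) • f (U \ S) else 0 := rfl

theorem annih_apply (s : I) (f : Finset I → A) (U : Finset I) : annih ε A s f U =
    if s ∈ U then 0 else sgn (fun i j => ε j i) {s} U • f (insert s U) := rfl

omit [LinearOrder I] in
theorem scale_apply (g : I → k) (a : A) (f : Finset I → A) (U : Finset I) :
    scale A g a f U = (∏ s ∈ U, g s) • (a * f U) := rfl

@[simp] theorem create_empty : create ε A (∅ : Finset I) = 1 := by
  ext f U; simp [create_apply]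

theorem create_mul_create {S T : Finset I} (h : Disjoint S T) :
    create ε A S * create ε A T = sgn ε S T • create ε A (S ∪ T) := by
  ext f U
  simp only [Module.End.mul_apply, LinearMap.smul_apply, Pi.smul_apply, create_apply]
  by_cases hU : S ∪ T ⊆ U
  · obtain ⟨hS, hT⟩ := Finset.union_subset_iff.1 hU
    have hT' : T ⊆ U \ S := Finset.subset_sdiff.2 ⟨hT, h.symm⟩
    have h1 : U \ S = T ∪ (U \ S) \ T := (Finset.union_sdiff_of_subset hT').symm
    have h2 : (U \ S) \ T = U \ (S ∪ T) := sdiff_sdiff_left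
    rw [if_pos hS, if_pos hT', if_pos hU, h2, sgn_union_left h, smul_smul, smul_smul]
    congr 1
    conv_lhs => rw [h1, h2, sgn_union_right _ (h2 ▸ Finset.disjoint_sdiff)]
    ring
  · rw [if_neg hU, smul_zero]
    by_cases hS : S ⊆ U
    · rw [if_pos hS, if_neg, smul_zero]
      exact fun hT => hU (Finset.union_subset hS (hT.trans Finset.sdiff_subset))
    · rw [if_neg hS]

theorem create_mul_create_of_not_disjoint {S T : Finset I} (h : ¬ Disjoint S T) :
    create ε A S * create ε A T = 0 := by
  ext f U
  simp only [Module.End.mul_apply, LinearMap.zero_apply, Pi.zero_apply, create_apply]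
  split_ifs with h1 h2
  · exact absurd (Finset.subset_sdiff.1 h2).2.symm h
  · exact smul_zero _
  · rfl

theorem create_sq (s : I) : create ε A {s} * create ε A {s} = 0 :=
  create_mul_create_of_not_disjoint (by simp)

theorem create_swap (hε : ∀ i j, ε i j * ε j i = 1) {s t : I} (h : s ≠ t) :
    create ε A {s} * create ε A {t} = -ε s t • (create ε A {t} * create ε A {s}) := by
  have h' : Disjoint ({s} : Finset I) {t} := by simpa using h
  rw [create_mul_create h', create_mul_create h'.symm, smul_smul, Finset.union_comm]
  congr 1
  simp only [sgn, Finset.prod_singleton]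
  rcases lt_or_gt_of_ne h with h | h
  · simp [h, h.not_gt, hε]
  · simp [h, h.not_gt]

theorem create_single (S T : Finset I) (a : A) :
    create ε A S (Pi.single T a) =
      if Disjoint S T then sgn ε S T • Pi.single (S ∪ T) a else 0 := by
  ext U
  rw [create_apply]
  split_ifs with h1 h2 h2
  · by_cases hU : U = S ∪ T
    · subst hU
      rw [Finset.union_sdiff_cancel_left h2]; simp
    · rw [Pi.smul_apply, Pi.single_eq_of_ne hU, Pi.single_eq_of_ne, smul_zero, smul_zero]
      rintro rfl
      exact hU (Finset.union_sdiff_of_subset h1).symm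
  · rw [Pi.single_eq_of_ne, smul_zero]; · rfl
    rintro rfl
    exact h2 Finset.disjoint_sdiff
  · rw [Pi.smul_apply, Pi.single_eq_of_ne, smul_zero]
    rintro rfl
    exact h1 Finset.subset_union_left
  · rfl

@[simp] theorem create_vac (S : Finset I) (a : A) :
    create ε A S (Pi.single ∅ a) = Pi.single S a := by
  simp [create_single]

@[simp] theorem annih_vac (s : I) (a : A) : annih ε A s (Pi.single ∅ a) = 0 := by
  ext U
  rw [annih_apply, Pi.single_eq_of_ne (Finset.insert_ne_empty s U)]; simp

@[simp] theorem scale_vac (g : I → k) (a b : A) :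
    scale A g a (Pi.single ∅ b) = Pi.single ∅ (a * b) := by
  ext U
  rw [scale_apply]
  by_cases hU : U = ∅
  · subst hU; simp
  · simp [Pi.single_eq_of_ne hU]

theorem scale_mul_create (g : I → k) (a : A) (s : I) :
    scale A g a * create ε A {s} = g s • (create ε A {s} * scale A g a) := by
  ext f U
  simp only [Module.End.mul_apply, LinearMap.smul_apply, Pi.smul_apply, create_apply, scale_apply]
  split_ifs with h
  · rw [Finset.singleton_subset_iff] at h
    rw [← Finset.mul_prod_erase U g h, Finset.sdiff_singleton_eq_erase, mul_smul_comm]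
    simp only [smul_smul]; congr 1; ring
  · simp

/-- With `annih_mul_create`, this is the colour analogue of the canonical anticommutation relations:
`annih` is a skew derivation. -/
theorem annih_mul_create_self (hε : ∀ i j, ε i j * ε j i = 1) (s : I) :
    annih ε A s * create ε A {s} = 1 - create ε A {s} * annih ε A s := by
  have hsgn (U : Finset I) : sgn (fun i j => ε j i) {s} U * sgn ε {s} U = 1 := by
    simp only [sgn, Finset.prod_singleton]
    rw [← Finset.prod_mul_distrib]
    refine Finset.prod_eq_one fun t _ => ?_
    split_ifs
    · rw [neg_mul_neg, hε]
    · rw [one_mul]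
  ext f U
  simp only [Module.End.mul_apply, LinearMap.sub_apply, Pi.sub_apply, Module.End.one_apply,
    create_apply, annih_apply, Finset.singleton_subset_iff]
  by_cases hs : s ∈ U
  · simp only [hs, if_true, Finset.mem_sdiff, Finset.mem_singleton, not_true_eq_false, and_false,
      if_false]
    rw [smul_smul, mul_comm, hsgn, one_smul, Finset.sdiff_singleton_eq_erase,
      Finset.insert_erase hs, sub_self]
  · simp only [hs, if_false, Finset.mem_insert_self, if_true, sub_zero]
    rw [Finset.sdiff_singleton_eq_erase, Finset.erase_insert hs, smul_smul, hsgn, one_smul]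

theorem annih_mul_create (s u : I) (h : s ≠ u) :
    annih ε A s * create ε A {u} = -ε u s • (create ε A {u} * annih ε A s) := by
  ext f U
  simp only [Module.End.mul_apply, LinearMap.smul_apply, Pi.smul_apply,
    create_apply, annih_apply, Finset.singleton_subset_iff]
  by_cases hs : s ∈ U
  · have : s ∈ U \ {u} := by simp [hs, h]
    simp [hs, this]
  by_cases hu : u ∈ U
  · have h1 : s ∉ U \ {u} := by simp [hs]
    have h2 : insert s U \ {u} = insert s (U \ {u}) := by
      ext t; simp only [Finset.mem_sdiff, Finset.mem_insert, Finset.mem_singleton]; grind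
    have h3 : U = {u} ∪ (U \ {u}) :=
      (Finset.union_sdiff_of_subset (Finset.singleton_subset_iff.2 hu)).symm
    have h4 : insert s (U \ {u}) = {s} ∪ (U \ {u}) := rfl
    simp only [hs, hu, h1, if_true, if_false, Finset.mem_insert_of_mem hu, smul_smul]
    rw [h2]
    congr 1
    have e1 : sgn (fun i j => ε j i) {s} U =
        sgn (fun i j => ε j i) {s} {u} * sgn (fun i j => ε j i) {s} (U \ {u}) := by
      conv_lhs => rw [h3, sgn_union_right _ Finset.disjoint_sdiff]
    have e2 : sgn ε {u} (insert s (U \ {u})) = sgn ε {u} {s} * sgn ε {u} (U \ {u}) := by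
      rw [h4, sgn_union_right _ (by simpa using h1)]
    have e3 : sgn (fun i j => ε j i) {s} {u} * sgn ε {u} {s} = -ε u s := by
      simp only [sgn, Finset.prod_singleton]
      rcases lt_or_gt_of_ne h with h | h <;> simp [h, h.not_gt]
    rw [e1, e2, ← e3]; ring
  · simp [hs, hu, h.symm]

end Operators

end ColorExt

/-! ### The action of the generators of the coefficient algebra on forms. -/

namespace ColorExt

variable {k I : Type*} [Field k] [LinearOrder I] [Fintype I]

/-- Every vector is obtained from the degree zero part by the creation operators. -/
theorem create_induction {A : Type*} [Ring A] [Algebra k A] {ε : I → I → k}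
    (hε : ∀ i j, ε i j * ε j i = 1) {p : (Finset I → A) → Prop}
    (vac : ∀ a, p (Pi.single ∅ a)) (cre : ∀ s f, p f → p (create ε A {s} f))
    (add : ∀ f g, p f → p g → p (f + g)) (smul : ∀ (c : k) f, p f → p (c • f))
    (f : Finset I → A) : p f := by
  have hsingle (S : Finset I) (a : A) : p (Pi.single S a) := by
    induction S using Finset.induction_on with
    | empty => exact vac a
    | insert s S hs ih =>
      have h := cre s _ ih
      rw [create_single, if_pos (by simpa using hs)] at h
      have h' := smul (sgn ε {s} S)⁻¹ _ h
      rwa [smul_smul, inv_mul_cancel₀ (sgn_ne_zero hε _ _), one_smul] at h'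
  rw [← Finset.univ_sum_single f]
  refine Finset.sum_induction _ p (fun f g => add f g) ?_ fun S _ => hsingle S _
  simpa using vac 0

/-- Bimodule structure constants for forms: `y_j e_s = G_{js} e_s y_j + ∑_r n^j_{rs} e_r` and
`e_s e_t = -ε_{st} e_t e_s`. -/
structure FormData (k I : Type*) where
  ε : I → I → k
  G : I → I → k
  n : I → I → I → k

/-- The conditions under which the structure constants of forms are consistent with the exterior
relations and with the relations `R` of the coefficient algebra. -/
structure FormData.Compatible (D : FormData k I) (R : QuadRel k I) : Prop where
  eps_self : ∀ i, D.ε i i = 1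
  eps_swap : ∀ i j, D.ε i j * D.ε j i = 1
  G_ne_zero : ∀ j s, D.G j s ≠ 0
  ext : ∀ j r s u, D.n j r s * (D.G j u - D.ε u s * D.ε r u) = 0
  lin : ∀ i j m s, i < j → R.q i j m * (D.G i s * D.G j s - D.G m s) = 0
  off_left : ∀ i j r s, i < j → D.n i r s * (D.G j r - R.c i j * D.G j s) = 0
  off_right : ∀ i j r s, i < j → D.n j r s * (D.G i s - R.c i j * D.G i r) = 0
  const : ∀ i j r s, i < j → (if r = s then R.κ i j * (D.G i s * D.G j s - 1) else 0) +
    ∑ u, (D.n j r u * D.n i u s - R.c i j * (D.n i r u * D.n j u s)) =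
      ∑ m, R.q i j m * D.n m r s

/-- The operator by which the generator `y_j = a` acts from the left on forms. -/
def FormData.gen (D : FormData k I) {A : Type*} [Ring A] [Algebra k A] (j : I) (a : A) :
    Module.End k (Finset I → A) :=
  scale A (D.G j) a + ∑ r, ∑ s, D.n j r s • (create D.ε A {r} * annih D.ε A s)

namespace FormData.Compatible

variable {D : FormData k I} {R : QuadRel k I} (h : D.Compatible R)
  {A : Type*} [Ring A] [Algebra k A]

include h

/-- The operator `create r * annih s` replaces `e_s` by `e_r`. Passing it over `e_u` costs `ε_{us}`
and `ε_{ru}`, whose product is `G_{ju}` by `ext` wherever `n^j_{rs} ≠ 0`; the additional term arises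
for `s = u`. -/
theorem gen_mul_create (j u : I) (a : A) :
    D.gen j a * create D.ε A {u} =
      D.G j u • (create D.ε A {u} * D.gen j a) + ∑ r, D.n j r u • create D.ε A {r} := by
  have key (r s : I) :
      D.n j r s • (create D.ε A {r} * annih D.ε A s) * create D.ε A {u} =
        D.G j u • (create D.ε A {u} * (D.n j r s • (create D.ε A {r} * annih D.ε A s))) +
          if s = u then D.n j r s • create D.ε A {r} else 0 := by
    by_cases h0 : D.n j r s = 0
    · simp [h0]
    have hG : D.G j u = D.ε u s * D.ε r u := by
      have := (mul_eq_zero.1 (h.ext j r s u)).resolve_left h0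
      exact sub_eq_zero.1 this
    rw [smul_mul_assoc, mul_smul_comm, smul_comm (D.G j u)]
    rw [show (if s = u then D.n j r s • create D.ε A {r} else 0) =
      D.n j r s • if s = u then create D.ε A {r} else 0 by split_ifs <;> simp, ← smul_add]
    congr 1
    rw [mul_assoc]
    by_cases hs : s = u
    · subst hs
      rw [annih_mul_create_self h.eps_swap, if_pos rfl, mul_sub, mul_one, hG, h.eps_self, one_mul,
        ← mul_assoc, ← mul_assoc]
      by_cases hr : r = s
      · subst hr; simp [create_sq]
      · rw [create_swap h.eps_swap hr, smul_mul_assoc, sub_eq_add_neg, add_comm]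
        exact congrArg (· + create D.ε A {r}) (by rw [← neg_one_smul k, smul_smul]; simp)
    · rw [annih_mul_create s u hs, if_neg hs, add_zero, mul_smul_comm, hG, ← mul_assoc,
        ← mul_assoc]
      by_cases hr : r = u
      · subst hr; simp [create_sq]
      · rw [create_swap h.eps_swap hr, smul_mul_assoc, smul_smul, neg_mul_neg]
  simp only [FormData.gen, add_mul, Finset.sum_mul, key, scale_mul_create, Finset.sum_add_distrib,
    Finset.sum_ite_eq', Finset.mem_univ, if_true, mul_add, smul_add, Finset.mul_sum,
    Finset.smul_sum, add_assoc]

omit h in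
theorem gen_vac (j : I) (a b : A) : D.gen j a (Pi.single ∅ b) = Pi.single ∅ (a * b) := by
  simp [FormData.gen, LinearMap.sum_apply]

-- The creation operators generate everything from degree zero. An operator identity can therefore
-- be tested on degree zero, once its defect passes the `e_s` up to scalars.
omit h in
theorem eq_zero_of_comm_create (hε : ∀ i j, D.ε i j * D.ε j i = 1)
    {X : Module.End k (Finset I → A)}
    (hX : ∀ s, ∃ g : k, X * create D.ε A {s} = g • (create D.ε A {s} * X))
    (h0 : ∀ a, X (Pi.single ∅ a) = 0) : X = 0 := by
  refine LinearMap.ext fun f => ?_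
  refine create_induction hε (p := fun f => X f = 0) h0 (fun s f hf => ?_)
    (fun f g hf hg => by rw [map_add, hf, hg, add_zero])
    (fun c f hf => by rw [map_smul, hf, smul_zero]) f
  obtain ⟨g, hg⟩ := hX s
  have := LinearMap.congr_fun hg f
  rw [Module.End.mul_apply, LinearMap.smul_apply, Module.End.mul_apply, hf, map_zero,
    smul_zero] at this
  exact this

/-- The operators of the generators satisfy the relations of the coefficient algebra. -/
theorem holds_gen {y : I → A} (hy : R.Holds y) : R.Holds fun j => D.gen j (y j) := by
  intro i j hij
  rw [← sub_eq_zero]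
  -- The defect of the relation should pass `e_s` with the scalar of `y_j y_i`. The obstructions are
  -- the coefficients of `e_r y_j`, `e_r y_i`, `e_s y_m` and `e_r`, which vanish by `off_left`,
  -- `off_right`, `lin` and `const`. On degree zero the defect is the relation in `A` itself.
  refine eq_zero_of_comm_create h.eps_swap (fun s => ⟨D.G i s * D.G j s, ?_⟩) fun a => ?_
  · set Φ : I → Module.End k (Finset I → A) := fun j => D.gen j (y j) with hΦ
    set E : I → Module.End k (Finset I → A) := fun s => create D.ε A {s} with hE
    have hc (j s : I) : Φ j * E s = D.G j s • (E s * Φ j) + ∑ r, D.n j r s • E r :=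
      h.gen_mul_create j s (y j)
    have hcc (i j : I) : Φ j * Φ i * E s = (D.G i s * D.G j s) • (E s * (Φ j * Φ i)) +
        ∑ r, (D.G i s * D.n j r s) • (E r * Φ i) + ∑ r, (D.n i r s * D.G j r) • (E r * Φ j) +
        ∑ r, (∑ u, D.n j r u * D.n i u s) • E r := by
      rw [mul_assoc, hc, mul_add, mul_smul_comm, ← mul_assoc, hc, add_mul, smul_add, smul_mul_assoc,
        smul_smul, Finset.sum_mul, Finset.smul_sum, Finset.mul_sum, mul_assoc]
      simp only [mul_smul_comm, hc, smul_add, smul_smul, smul_mul_assoc, Finset.sum_add_distrib,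
        Finset.smul_sum]
      rw [Finset.sum_comm]
      simp only [Finset.sum_smul, mul_comm, add_assoc]
    have hoff : ∑ r, (D.n i r s * D.G j r) • (E r * Φ j) =
        R.c i j • ∑ r, (D.G j s * D.n i r s) • (E r * Φ j) := by
      rw [Finset.smul_sum]
      refine Finset.sum_congr rfl fun r _ => ?_
      rw [smul_smul]; congr 1
      linear_combination h.off_left i j r s hij
    have hoff' : ∑ r, (D.G i s * D.n j r s) • (E r * Φ i) =
        R.c i j • ∑ r, (D.n j r s * D.G i r) • (E r * Φ i) := by
      rw [Finset.smul_sum]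
      refine Finset.sum_congr rfl fun r _ => ?_
      rw [smul_smul]; congr 1
      linear_combination h.off_right i j r s hij
    have hlin : (∑ m, R.q i j m • Φ m) * E s =
        (D.G i s * D.G j s) • (E s * ∑ m, R.q i j m • Φ m) +
          ∑ r, (∑ m, R.q i j m * D.n m r s) • E r := by
      simp only [Finset.sum_mul, Finset.mul_sum, smul_mul_assoc, hc, smul_add, mul_smul_comm,
        Finset.sum_add_distrib, Finset.smul_sum, smul_smul, Finset.sum_smul]
      congr 1
      · refine Finset.sum_congr rfl fun m _ => ?_
        congr 1
        linear_combination - h.lin i j m s hij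
      · exact Finset.sum_comm
    have hconst : (∑ r, (∑ u, D.n j r u * D.n i u s) • E r) -
        R.c i j • (∑ r, (∑ u, D.n i r u * D.n j u s) • E r) + R.κ i j • (D.G i s * D.G j s) • E s
        - R.κ i j • E s = ∑ r, (∑ m, R.q i j m * D.n m r s) • E r := by
      simp only [← h.const i j _ s hij, add_smul, Finset.sum_add_distrib, ite_smul, zero_smul,
        Finset.sum_ite_eq', Finset.mem_univ, if_true, Finset.sum_sub_distrib, sub_smul,
        Finset.smul_sum, smul_smul, Finset.mul_sum, mul_sub, mul_one]
      abel
    have hκ : algebraMap k (Module.End k (Finset I → A)) (R.κ i j) =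
      R.κ i j • (1 : Module.End k (Finset I → A)) := Algebra.algebraMap_eq_smul_one _
    rw [sub_mul, add_mul, add_mul, smul_mul_assoc, hcc i j, hcc j i, hlin, ← hconst, hκ,
      smul_mul_assoc, one_mul, hoff, hoff', mul_sub, mul_add, mul_add, mul_smul_comm, mul_smul_comm,
      mul_one]
    simp only [smul_add, smul_sub, smul_smul, mul_comm (D.G j s) (D.G i s)]
    rw [mul_comm (R.c i j) (D.G i s * D.G j s), mul_comm (R.κ i j) (D.G i s * D.G j s)]
    abel
  · have hij' := hy i j hij
    simp only [LinearMap.sub_apply, Module.End.mul_apply, gen_vac, LinearMap.add_apply,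
      LinearMap.smul_apply, LinearMap.sum_apply, Module.algebraMap_end_apply]
    rw [← mul_assoc, hij']
    ext U
    by_cases hU : U = ∅
    · subst hU
      simp [add_mul, Finset.sum_mul, mul_assoc, Algebra.smul_def]
    · simp [Pi.single_eq_of_ne hU]

end FormData.Compatible

end ColorExt

/-! ### The graded algebra of forms. -/

namespace ColorExt

variable {k I : Type*} [Field k] [LinearOrder I] [Fintype I]

/-- A representation of the algebra `A`, generated by the family `y`, on a colour exterior algebra
with coefficients in `A`, together with a derivation `δ` into operators. It determines a
differential calculus whose forms are the operators of left multiplication. -/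
structure FormRep (k I : Type*) [Field k] [LinearOrder I] [Fintype I] (A : Type*) [Ring A]
    [Algebra k A] where
  D : FormData k I
  eps_swap : ∀ i j, D.ε i j * D.ε j i = 1
  G_ne_zero : ∀ j s, D.G j s ≠ 0
  y : I → A
  adjoin_y : Algebra.adjoin k (Set.range y) = ⊤
  Φ : A →ₐ[k] Module.End k (Finset I → A)
  Φ_vac : ∀ a b, Φ a (Pi.single ∅ b) = Pi.single ∅ (a * b)
  Φ_create : ∀ j u, Φ (y j) * create D.ε A {u} =
    D.G j u • (create D.ε A {u} * Φ (y j)) + ∑ r, D.n j r u • create D.ε A {r}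
  δ : A →ₗ[k] Module.End k (Finset I → A)
  δ_mul : ∀ a b, δ (a * b) = Φ a * δ b + δ a * Φ b
  δ_create : ∀ j s, δ (y j) * create D.ε A {s} = (-D.G j s) • (create D.ε A {s} * δ (y j))

namespace FormRep

variable {A : Type*} [Ring A] [Algebra k A] (F : FormRep k I A)

/-- The operator of left multiplication by the form `∑ e_S f(S)`. -/
def toEnd : (Finset I → A) →ₗ[k] Module.End k (Finset I → A) where
  toFun f := ∑ S, create F.D.ε A S * F.Φ (f S)
  map_add' f g := by simp [mul_add, Finset.sum_add_distrib]
  map_smul' c f := by simp [Finset.smul_sum]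

theorem toEnd_apply (f : Finset I → A) : F.toEnd f = ∑ S, create F.D.ε A S * F.Φ (f S) := rfl

theorem toEnd_single (S : Finset I) (a : A) :
    F.toEnd (Pi.single S a) = create F.D.ε A S * F.Φ a := by
  rw [toEnd_apply, Finset.sum_eq_single S]
  · simp
  · intro T _ hT; simp [Pi.single_eq_of_ne hT]
  · simp

theorem E_mul_toEnd (S : Finset I) (f : Finset I → A) :
    create F.D.ε A S * F.toEnd f = F.toEnd (create F.D.ε A S f) := by
  rw [← Finset.univ_sum_single f]
  simp only [map_sum, Finset.mul_sum, toEnd_single]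
  refine Finset.sum_congr rfl fun T _ => ?_
  rw [create_single, ← mul_assoc]
  split_ifs with h
  · rw [create_mul_create h, map_smul, toEnd_single, smul_mul_assoc]
  · rw [create_mul_create_of_not_disjoint h, zero_mul, map_zero]

theorem toEnd_vac (f : Finset I → A) : F.toEnd f (Pi.single ∅ 1) = f := by
  rw [toEnd_apply, LinearMap.sum_apply]
  simp only [Module.End.mul_apply, F.Φ_vac, create_vac, mul_one]
  exact Finset.univ_sum_single f

@[simp] theorem toEnd_one : F.toEnd (Pi.single ∅ 1) = 1 := by
  rw [toEnd_single, create_empty, map_one, one_mul]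

/-- The algebra of forms, as operators of left multiplication. -/
def form : Subalgebra k (Module.End k (Finset I → A)) where
  -- The condition says that `X` is a left multiplication for the product that `toEnd` induces on
  -- vectors. Since forms are operators, associativity comes for free.
  carrier := {X | ∀ f, X * F.toEnd f = F.toEnd (X f)}
  mul_mem' {X Y} hX hY f := by rw [mul_assoc, hY, hX]; rfl
  add_mem' {X Y} hX hY f := by rw [add_mul, hX, hY, LinearMap.add_apply, map_add]
  algebraMap_mem' c f := by
    rw [Module.algebraMap_end_apply, map_smul, Algebra.algebraMap_eq_smul_one, smul_mul_assoc,
      one_mul]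

theorem E_mem (S : Finset I) : create F.D.ε A S ∈ F.form := F.E_mul_toEnd S

/-- Induction on elements of `A`, as polynomials in the generators. -/
theorem induction {p : A → Prop} (gen : ∀ j, p (F.y j)) (alg : ∀ c, p (algebraMap k A c))
    (add : ∀ a b, p a → p b → p (a + b)) (mul : ∀ a b, p a → p b → p (a * b)) (a : A) : p a := by
  have h : a ∈ Algebra.adjoin k (Set.range F.y) := F.adjoin_y ▸ Algebra.mem_top
  induction h using Algebra.adjoin_induction with
  | mem x hx => obtain ⟨j, rfl⟩ := hx; exact gen j
  | algebraMap c => exact alg c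
  | add a b _ _ ha hb => exact add a b ha hb
  | mul a b _ _ ha hb => exact mul a b ha hb

/-- It suffices to treat a generator on vectors built up by creation operators; `Φ_create` moves the
generator past each of them, down to degree zero, where `Φ` is multiplicative. -/
theorem Φ_mem (a : A) : F.Φ a ∈ F.form := by
  induction a using F.induction with
  | gen j =>
    intro f
    refine create_induction F.eps_swap
      (p := fun f => F.Φ (F.y j) * F.toEnd f = F.toEnd (F.Φ (F.y j) f)) (fun a => ?_)
      (fun s f hf => ?_)
      (fun f g hf hg => ?_) (fun c f hf => ?_) f
    · rw [toEnd_single, create_empty, one_mul, F.Φ_vac, toEnd_single, create_empty,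
        one_mul, map_mul]
    · have h := LinearMap.congr_fun (F.Φ_create j s) f
      rw [Module.End.mul_apply] at h
      rw [← E_mul_toEnd, ← mul_assoc, F.Φ_create, h, add_mul, smul_mul_assoc, mul_assoc, hf]
      simp only [LinearMap.add_apply, LinearMap.smul_apply, LinearMap.sum_apply, map_add,
        map_smul, map_sum, Module.End.mul_apply, ← E_mul_toEnd, Finset.sum_mul, smul_mul_assoc]
    · rw [map_add, mul_add, hf, hg, map_add, map_add]
    · rw [map_smul, mul_smul_comm, hf, map_smul, map_smul]
  | alg c => rw [AlgHom.commutes]; exact algebraMap_mem _ _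
  | add a b ha hb => rw [map_add]; exact add_mem ha hb
  | mul a b ha hb => rw [map_mul]; exact mul_mem ha hb

theorem toEnd_mem (f : Finset I → A) : F.toEnd f ∈ F.form :=
  sum_mem fun S _ => mul_mem (F.E_mem S) (F.Φ_mem _)

/-- The vector `1` at `∅` is the unit, so a form is recovered from its value there. This identifies
the forms with the free right `A`-module on the `e_S`. -/
theorem toEnd_apply_vac {X : Module.End k (Finset I → A)} (hX : X ∈ F.form) :
    F.toEnd (X (Pi.single ∅ 1)) = X := by
  rw [← hX, toEnd_one, mul_one]

/-- The algebra of forms as a type. -/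
def FormAlg : Type _ := F.form

instance : Ring F.FormAlg := inferInstanceAs (Ring F.form)

instance : Algebra k F.FormAlg := inferInstanceAs (Algebra k F.form)

/-- A form is determined by its coefficients. -/
def coords : F.FormAlg ≃ₗ[k] (Finset I → A) where
  toFun X := X.1 (Pi.single ∅ 1)
  map_add' _ _ := rfl
  map_smul' _ _ := rfl
  invFun f := ⟨F.toEnd f, F.toEnd_mem f⟩
  left_inv X := Subtype.ext (F.toEnd_apply_vac X.2)
  right_inv f := F.toEnd_vac f

theorem coords_apply (X : F.FormAlg) : F.coords X = X.1 (Pi.single ∅ 1) := rfl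

theorem coords_mul (X Y : F.FormAlg) : F.coords (X * Y) = X.1 (F.coords Y) := rfl

/-- The inclusion of `A` as the forms of degree zero. -/
def coeff : A →ₐ[k] F.FormAlg := F.Φ.codRestrict F.form F.Φ_mem

theorem coeff_coe (a : A) : (F.coeff a).1 = F.Φ a := rfl

theorem coords_coeff (a : A) : F.coords (F.coeff a) = Pi.single ∅ a := by
  rw [coords_apply, coeff_coe, F.Φ_vac, mul_one]

/-- The basic form `e_S`. -/
def e (S : Finset I) : F.FormAlg := ⟨create F.D.ε A S, F.E_mem S⟩

theorem coords_e_mul_coeff (S : Finset I) (a : A) :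
    F.coords (F.e S * F.coeff a) = Pi.single S a := by
  rw [coords_mul, coords_coeff]; exact create_vac S a

theorem coords_symm_single (S : Finset I) (a : A) :
    F.coords.symm (Pi.single S a) = F.e S * F.coeff a := by
  rw [← F.coords_e_mul_coeff, LinearEquiv.symm_apply_apply]

theorem coords_e (S : Finset I) : F.coords (F.e S) = Pi.single S 1 := create_vac S 1

theorem e_mul_e {S T : Finset I} (h : Disjoint S T) :
    F.e S * F.e T = sgn F.D.ε S T • F.e (S ∪ T) := Subtype.ext (create_mul_create h)

theorem e_mul_e_of_not_disjoint {S T : Finset I} (h : ¬ Disjoint S T) : F.e S * F.e T = 0 :=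
  Subtype.ext (create_mul_create_of_not_disjoint h)

theorem e_empty : F.e ∅ = 1 := Subtype.ext create_empty

/-- The vectors of degree `m`. -/
def homog (I : Type*) (k A : Type*) [Field k] [Ring A] [Algebra k A] (m : ℕ) :
    Submodule k (Finset I → A) where
  carrier := {f | ∀ S, S.card ≠ m → f S = 0}
  add_mem' hf hg S hS := by rw [Pi.add_apply, hf S hS, hg S hS, add_zero]
  zero_mem' S _ := rfl
  smul_mem' c f hf S hS := by rw [Pi.smul_apply, hf S hS, smul_zero]

omit [Fintype I] in
theorem single_mem_homog (S : Finset I) (a : A) : Pi.single S a ∈ homog I k A S.card := by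
  intro T hT
  rw [Pi.single_eq_of_ne]
  rintro rfl
  exact hT rfl

theorem E_homog (S : Finset I) {m : ℕ} {f : Finset I → A}
    (hf : f ∈ homog I k A m) :
    create F.D.ε A S f ∈ homog I k A (S.card + m) := by
  intro U hU
  rw [create_apply]
  split_ifs with h
  · rw [hf, smul_zero]
    intro h'
    rw [← h', add_comm, Finset.card_sdiff_add_card_eq_card h] at hU
    exact hU rfl
  · rfl

theorem mem_homog_induction {m : ℕ} {f : Finset I → A} (hf : f ∈ homog I k A m)
    (Q : Submodule k (Finset I → A)) (h : ∀ S a, S.card = m → Pi.single S a ∈ Q) : f ∈ Q := by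
  rw [← Finset.univ_sum_single f]
  refine sum_mem fun S _ => ?_
  by_cases hS : S.card = m
  · exact h S _ hS
  · rw [hf S hS, Pi.single_zero]; exact zero_mem _

/-- Both terms of `Φ_create` contain exactly one creation operator, so the degree survives the
induction on the letters of `S`. -/
theorem Φ_homog (a : A) {m : ℕ} {f : Finset I → A} (hf : f ∈ homog I k A m) :
    F.Φ a f ∈ homog I k A m := by
  induction a using F.induction generalizing m f with
  | gen j =>
    refine mem_homog_induction hf ((homog I k A m).comap (F.Φ (F.y j))) ?_
    clear hf
    rintro S a rfl
    rw [Submodule.mem_comap]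
    induction S using Finset.induction_on with
    | empty => rw [F.Φ_vac]; exact single_mem_homog _ _
    | insert s S hs ih =>
      have hd : Disjoint {s} S := by simpa using hs
      have h1 : Pi.single (insert s S) a =
          (sgn F.D.ε {s} S)⁻¹ • create F.D.ε A {s} (Pi.single S a) := by
        rw [create_single, if_pos hd, smul_smul, inv_mul_cancel₀ (sgn_ne_zero F.eps_swap _ _),
          one_smul]; rfl
      rw [h1, map_smul, ← Module.End.mul_apply, F.Φ_create, Finset.card_insert_of_notMem hs,
        add_comm]
      refine Submodule.smul_mem _ _ ?_
      rw [LinearMap.add_apply, LinearMap.smul_apply, Module.End.mul_apply, LinearMap.sum_apply]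
      refine add_mem (Submodule.smul_mem _ _ ?_) (sum_mem fun r _ => ?_)
      · simpa using F.E_homog {s} ih
      · rw [LinearMap.smul_apply]
        exact Submodule.smul_mem _ _ (by simpa using F.E_homog {r} (single_mem_homog (k := k) S a))
  | alg c => rw [AlgHom.commutes]; exact Submodule.smul_mem _ _ hf
  | add a b ha hb => rw [map_add]; exact add_mem (ha hf) (hb hf)
  | mul a b ha hb => rw [map_mul]; exact ha (hb hf)

theorem toEnd_homog {l m : ℕ} {f g : Finset I → A} (hf : f ∈ homog I k A l)
    (hg : g ∈ homog I k A m) : F.toEnd f g ∈ homog I k A (l + m) := by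
  rw [toEnd_apply, LinearMap.sum_apply]
  refine sum_mem fun S _ => ?_
  by_cases hS : S.card = l
  · rw [← hS]; exact F.E_homog S (F.Φ_homog _ hg)
  · rw [hf S hS, map_zero, mul_zero]; exact zero_mem _

/-- The forms of degree `m`. -/
def degree (m : ℕ) : Submodule k F.FormAlg := (homog I k A m).comap F.coords.toLinearMap

theorem mem_degree {m : ℕ} {X : F.FormAlg} : X ∈ F.degree m ↔ F.coords X ∈ homog I k A m := Iff.rfl

theorem coords_mul' (X Y : F.FormAlg) : F.coords (X * Y) = F.toEnd (F.coords X) (F.coords Y) := by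
  rw [coords_mul, coords_apply F X, F.toEnd_apply_vac X.2]

theorem e_mem (S : Finset I) : F.e S ∈ F.degree S.card := by
  rw [mem_degree, coords_e]; exact single_mem_homog _ _

theorem coeff_mem (a : A) : F.coeff a ∈ F.degree 0 := by
  rw [mem_degree, coords_coeff]; exact single_mem_homog (∅ : Finset I) a

instance : SetLike.GradedMonoid F.degree where
  one_mem := by rw [← map_one F.coeff]; exact F.coeff_mem 1
  mul_mem l m X Y hX hY := by
    rw [mem_degree, coords_mul']; exact F.toEnd_homog hX hY

theorem degree_induction {m : ℕ} {X : F.FormAlg} (hX : X ∈ F.degree m)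
    (Q : Submodule k F.FormAlg) (h : ∀ S a, S.card = m → F.e S * F.coeff a ∈ Q) : X ∈ Q := by
  have := mem_homog_induction hX (Q.comap F.coords.symm.toLinearMap) fun S a hS => by
    simpa [coords_symm_single] using h S a hS
  simpa using this

/-- The component of degree `m`. -/
def proj (m : ℕ) : F.FormAlg →ₗ[k] F.degree m where
  toFun X := ⟨F.coords.symm fun S => if S.card = m then F.coords X S else 0, by
    rw [mem_degree, LinearEquiv.apply_symm_apply]
    intro S hS
    exact if_neg hS⟩
  map_add' X Y := by
    apply Subtype.ext
    rw [Submodule.coe_add, ← map_add]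
    refine congrArg F.coords.symm (funext fun S => ?_)
    simp only [Pi.add_apply, map_add]
    split_ifs <;> simp
  map_smul' c X := by
    apply Subtype.ext
    rw [RingHom.id_apply, Submodule.coe_smul, ← map_smul]
    refine congrArg F.coords.symm (funext fun S => ?_)
    simp only [Pi.smul_apply, map_smul]
    split_ifs <;> simp

theorem coords_proj (m : ℕ) (X : F.FormAlg) (S : Finset I) :
    F.coords (F.proj m X).1 S = if S.card = m then F.coords X S else 0 := by
  change F.coords (F.coords.symm _) S = _
  rw [LinearEquiv.apply_symm_apply]

noncomputable instance : DirectSum.Decomposition F.degree :=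
  .ofLinearMap _ (∑ m ∈ Finset.range (Fintype.card I + 1),
      DirectSum.lof k ℕ (fun m => F.degree m) m ∘ₗ F.proj m)
    (by
      ext1 X
      apply F.coords.injective
      ext S
      simp only [LinearMap.comp_apply, LinearMap.sum_apply, map_sum, LinearMap.id_apply,
        DirectSum.coeLinearMap_lof, Finset.sum_apply, coords_proj]
      rw [Finset.sum_ite_eq, if_pos]
      rw [Finset.mem_range, Nat.lt_succ_iff]
      exact Finset.card_le_univ S)
    (by
      refine DirectSum.linearMap_ext _ fun m => ?_
      ext1 X
      have hX (l : ℕ) (hl : l ≠ m) : F.proj l X.1 = 0 := by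
        apply Subtype.ext
        apply F.coords.injective
        ext S
        rw [coords_proj]
        split_ifs with h
        · exact (X.2 S (h ▸ hl)).trans (by simp)
        · simp
      have hX' : F.proj m X.1 = X := by
        apply Subtype.ext
        apply F.coords.injective
        ext S
        rw [coords_proj]
        split_ifs with h
        · rfl
        · exact (X.2 S h).symm
      simp only [LinearMap.comp_apply, LinearMap.sum_apply, DirectSum.coeLinearMap_lof,
        LinearMap.id_apply]
      rw [Finset.sum_eq_single m]
      · rw [hX']
      · intro l _ hl; rw [hX l hl, map_zero]
      · intro hm
        have h0 : X = 0 := by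
          rw [← hX']
          apply Subtype.ext
          apply F.coords.injective
          ext S
          rw [coords_proj, if_neg]
          · simp
          · rintro rfl
            exact hm (Finset.mem_range.2 (Nat.lt_succ_of_le (Finset.card_le_univ S)))
        rw [h0]; simp)

noncomputable instance : GradedAlgebra F.degree where

end FormRep

end ColorExt

theorem Submodule.mem_of_add_mem_left {k B : Type*} [CommRing k] [Ring B] [Algebra k B]
    {p : Submodule k B} {x y : B} (h : x + y ∈ p) (hx : x ∈ p) : y ∈ p :=
  (p.add_mem_iff_right hx).1 h

/-! ### The differential and the axioms of a calculus. -/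

namespace ColorExt

namespace FormRep

variable {k I : Type*} [Field k] [LinearOrder I] [Fintype I]
variable {A : Type*} [Ring A] [Algebra k A] (F : FormRep k I A)

/-- The differential of the form `∑ e_S f(S)`. -/
def dOp : (Finset I → A) →ₗ[k] Module.End k (Finset I → A) where
  -- All basic forms `e_S` are declared closed. The sign appears because coefficients stand on the
  -- right, behind `e_S`.
  toFun f := ∑ S, (-1 : k) ^ S.card • (create F.D.ε A S * F.δ (f S))
  map_add' f g := by simp [mul_add, Finset.sum_add_distrib]
  map_smul' c f := by simp [Finset.smul_sum, smul_comm c]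

theorem dOp_apply (f : Finset I → A) :
    F.dOp f = ∑ S, (-1 : k) ^ S.card • (create F.D.ε A S * F.δ (f S)) := rfl

theorem dOp_single (S : Finset I) (a : A) :
    F.dOp (Pi.single S a) = (-1 : k) ^ S.card • (create F.D.ε A S * F.δ a) := by
  rw [dOp_apply, Finset.sum_eq_single S]
  · simp
  · intro T _ hT; simp [Pi.single_eq_of_ne hT]
  · simp

theorem dOp_create (S : Finset I) (f : Finset I → A) :
    F.dOp (create F.D.ε A S f) = (-1 : k) ^ S.card • (create F.D.ε A S * F.dOp f) := by
  rw [← Finset.univ_sum_single f]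
  simp only [map_sum, Finset.mul_sum, Finset.smul_sum, dOp_single]
  refine Finset.sum_congr rfl fun T _ => ?_
  rw [create_single, mul_smul_comm, ← mul_assoc]
  split_ifs with h
  · rw [create_mul_create h, map_smul, dOp_single, smul_mul_assoc, smul_smul, smul_smul, smul_smul,
      Finset.card_union_of_disjoint h, pow_add]
    congr 1; ring
  · rw [create_mul_create_of_not_disjoint h, zero_mul, map_zero, smul_zero, smul_zero]

theorem dOp_create_one (s : I) (f : Finset I → A) :
    F.dOp (create F.D.ε A {s} f) = (-1 : k) • (create F.D.ε A {s} * F.dOp f) := by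
  rw [dOp_create, Finset.card_singleton, pow_one]

theorem δ_one : F.δ 1 = 0 := by
  have h := F.δ_mul 1 1
  rw [mul_one, map_one F.Φ, one_mul, mul_one] at h
  exact left_eq_add.1 h

theorem δ_algebraMap (c : k) : F.δ (algebraMap k A c) = 0 := by
  rw [Algebra.algebraMap_eq_smul_one, map_smul, δ_one, smul_zero]

/-- The Leibniz rule for a coefficient on the left. For a generator one moves it past `e_s` and
compares: the commutation rule `δ_create` for `d y_j` and `e_s` is what differentiating `Φ_create`
demands. -/
theorem dOp_Φ (a : A) (f : Finset I → A) :
    F.dOp (F.Φ a f) = F.δ a * F.toEnd f + F.Φ a * F.dOp f := by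
  induction a using F.induction generalizing f with
  | gen j =>
    refine create_induction F.eps_swap (p := fun f => F.dOp (F.Φ (F.y j) f) =
      F.δ (F.y j) * F.toEnd f + F.Φ (F.y j) * F.dOp f) (fun a => ?_) (fun s f hf => ?_)
      (fun f g hf hg => ?_) (fun c f hf => ?_) f
    · rw [F.Φ_vac, dOp_single, dOp_single, toEnd_single, create_empty, F.δ_mul]
      simp [add_comm]
    · have h := LinearMap.congr_fun (F.Φ_create j s) f
      rw [Module.End.mul_apply] at h
      have h1 : F.δ (F.y j) * F.toEnd (create F.D.ε A {s} f) =
          (-F.D.G j s) • (create F.D.ε A {s} * (F.δ (F.y j) * F.toEnd f)) := by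
        rw [← E_mul_toEnd, ← mul_assoc, F.δ_create, smul_mul_assoc, mul_assoc]
      have h2 : F.Φ (F.y j) * F.dOp (create F.D.ε A {s} f) =
          (-F.D.G j s) • (create F.D.ε A {s} * (F.Φ (F.y j) * F.dOp f)) +
            ∑ r, (-F.D.n j r s) • (create F.D.ε A {r} * F.dOp f) := by
        rw [dOp_create_one, mul_smul_comm, ← mul_assoc, F.Φ_create, add_mul, smul_mul_assoc,
          mul_assoc, Finset.sum_mul, smul_add, Finset.smul_sum, smul_smul, neg_one_mul]
        simp only [smul_mul_assoc, smul_smul, neg_one_mul]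
      rw [h, h1, h2]
      simp only [LinearMap.add_apply, LinearMap.smul_apply, LinearMap.sum_apply, map_add,
        map_smul, map_sum, Module.End.mul_apply, dOp_create_one, hf, smul_smul, mul_neg_one,
        mul_add, smul_add, add_assoc]
    · rw [map_add, map_add, hf, hg, map_add, map_add, mul_add, mul_add]; abel
    · rw [map_smul, map_smul, hf, map_smul, map_smul, mul_smul_comm, mul_smul_comm, smul_add]
  | alg c =>
    rw [AlgHom.commutes, δ_algebraMap, zero_mul, zero_add, Module.algebraMap_end_apply, map_smul,
      Algebra.algebraMap_eq_smul_one, smul_mul_assoc, one_mul]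
  | add a b ha hb =>
    rw [map_add, LinearMap.add_apply, map_add, ha, hb, map_add, add_mul, add_mul]
    abel
  | mul a b ha hb =>
    have := F.Φ_mem b f
    rw [map_mul, Module.End.mul_apply, ha, hb, F.δ_mul, ← this, add_mul, mul_add, mul_assoc,
      mul_assoc, mul_assoc]
    abel

/-- The conditions under which `δ` extends to the differential of a differential calculus. -/
structure IsClosed : Prop where
  mem : ∀ j, F.δ (F.y j) ∈ F.form
  homog : ∀ j, F.δ (F.y j) (Pi.single ∅ 1) ∈ homog I k A 1
  closed : ∀ j, F.dOp (F.δ (F.y j) (Pi.single ∅ 1)) = 0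
  dense : ∀ s, create F.D.ε A {s} ∈ Submodule.span k {X | ∃ a b, X = F.Φ a * F.δ b}

variable {F} (hF : F.IsClosed)

theorem dOp_mul {l : ℕ} {X : F.FormAlg} (hX : X ∈ F.degree l) (f : Finset I → A) :
    F.dOp (X.1 f) =
      F.dOp (F.coords X) * F.toEnd f + (-1 : k) ^ l • (X.1 * F.dOp f) := by
  let Q : Submodule k F.FormAlg :=
    { carrier := {X | ∀ f, F.dOp (X.1 f) =
        F.dOp (F.coords X) * F.toEnd f + (-1 : k) ^ l • (X.1 * F.dOp f)}
      add_mem' := fun {X Y} hX hY f => by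
        have e1 : (X + Y).1 = X.1 + Y.1 := rfl
        rw [e1, LinearMap.add_apply, map_add, hX, hY, map_add, map_add, add_mul, add_mul, smul_add]
        abel
      zero_mem' := fun f => by
        have e1 : (0 : F.FormAlg).1 = 0 := rfl
        rw [e1, map_zero, map_zero, zero_mul, zero_mul, smul_zero, LinearMap.zero_apply, map_zero,
          add_zero]
      smul_mem' := fun c X hX f => by
        have e1 : (c • X).1 = c • X.1 := rfl
        rw [e1, LinearMap.smul_apply, map_smul, hX, map_smul, map_smul, smul_mul_assoc,
          smul_mul_assoc, smul_add, smul_comm c] }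
  refine degree_induction F hX Q ?_ f
  rintro S a rfl f
  have e1 : (F.e S * F.coeff a).1 = create F.D.ε A S * F.Φ a := rfl
  rw [coords_e_mul_coeff, dOp_single, e1, Module.End.mul_apply, dOp_create, dOp_Φ, mul_add,
    smul_add, smul_mul_assoc, mul_assoc, mul_assoc]

include hF

theorem IsClosed.δ_mem (a : A) : F.δ a ∈ F.form := by
  induction a using F.induction with
  | gen j => exact hF.mem j
  | alg c => rw [δ_algebraMap]; exact zero_mem _
  | add a b ha hb => rw [map_add]; exact add_mem ha hb
  | mul a b ha hb =>
    rw [F.δ_mul]; exact add_mem (mul_mem (F.Φ_mem a) hb) (mul_mem ha (F.Φ_mem b))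

/-- The differential of an element of `A`. -/
def IsClosed.dA (a : A) : F.FormAlg := ⟨F.δ a, hF.δ_mem a⟩

theorem IsClosed.dA_mem (a : A) : hF.dA a ∈ F.degree 1 := by
  change F.δ a (Pi.single ∅ 1) ∈ FormRep.homog I k A 1
  induction a using F.induction with
  | gen j => exact hF.homog j
  | alg c => rw [δ_algebraMap]; exact zero_mem _
  | add a b ha hb => rw [map_add]; exact add_mem ha hb
  | mul a b ha hb =>
    rw [F.δ_mul, LinearMap.add_apply, Module.End.mul_apply, Module.End.mul_apply]
    refine add_mem (F.Φ_homog a hb) ?_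
    rw [F.Φ_vac, ← F.toEnd_apply_vac (hF.δ_mem a)]
    exact F.toEnd_homog ha (single_mem_homog ∅ _)

/-- In `d (a db + da b)` the terms `da db` and `-da db` cancel, so closedness passes from the
generators to products. -/
theorem IsClosed.dOp_dA (a : A) : F.dOp (F.coords (hF.dA a)) = 0 := by
  induction a using F.induction with
  | gen j => exact hF.closed j
  | alg c =>
    have : hF.dA (algebraMap k A c) = 0 := Subtype.ext (F.δ_algebraMap c)
    rw [this, map_zero, map_zero]
  | add a b ha hb =>
    have : hF.dA (a + b) = hF.dA a + hF.dA b := Subtype.ext (map_add _ _ _)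
    rw [this, map_add, map_add, ha, hb, add_zero]
  | mul a b ha hb =>
    have : hF.dA (a * b) = F.coeff a * hF.dA b + hF.dA a * F.coeff b := Subtype.ext (F.δ_mul a b)
    rw [this, map_add, map_add, coords_mul, coords_mul, coeff_coe, dOp_Φ, hb, mul_zero, add_zero,
      dOp_mul (hF.dA_mem a), ha, zero_mul, zero_add, pow_one,
      coords_coeff, dOp_single, create_empty, coords_apply, F.toEnd_apply_vac (hF.dA b).2,
      Finset.card_empty, pow_zero, one_smul, one_mul]
    refine (congrArg (F.δ a * F.δ b + ·) (neg_one_smul k (F.δ a * F.δ b))).trans ?_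
    exact add_neg_cancel _

theorem IsClosed.dOp_mem (f : Finset I → A) : F.dOp f ∈ F.form :=
  sum_mem fun S _ => F.form.smul_mem (mul_mem (F.E_mem S) (hF.δ_mem _)) _

/-- The differential. -/
def IsClosed.d : F.FormAlg →ₗ[k] F.FormAlg where
  toFun X := ⟨F.dOp (F.coords X), hF.dOp_mem _⟩
  map_add' _ _ := Subtype.ext ((congrArg F.dOp (map_add _ _ _)).trans (map_add _ _ _))
  map_smul' _ _ := Subtype.ext ((congrArg F.dOp (map_smul _ _ _)).trans (map_smul _ _ _))

theorem IsClosed.d_coe (X : F.FormAlg) : (hF.d X).1 = F.dOp (F.coords X) := rfl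

theorem IsClosed.d_coeff (a : A) : hF.d (F.coeff a) = hF.dA a := by
  apply Subtype.ext
  rw [d_coe, coords_coeff, dOp_single, create_empty, Finset.card_empty, pow_zero, one_smul, one_mul]
  rfl

theorem IsClosed.d_e_mul_coeff (S : Finset I) (a : A) :
    hF.d (F.e S * F.coeff a) = (-1 : k) ^ S.card • (F.e S * hF.dA a) := by
  apply Subtype.ext
  rw [d_coe, coords_e_mul_coeff, dOp_single]
  rfl

theorem IsClosed.d_mem {m : ℕ} {X : F.FormAlg} (hX : X ∈ F.degree m) :
    hF.d X ∈ F.degree (m + 1) := by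
  refine degree_induction F hX ((F.degree (m + 1)).comap hF.d) ?_
  rintro S a rfl
  rw [Submodule.mem_comap, d_e_mul_coeff]
  exact Submodule.smul_mem _ _ (SetLike.mul_mem_graded (F.e_mem S) (hF.dA_mem a))

theorem IsClosed.d_mul {m : ℕ} {X : F.FormAlg} (hX : X ∈ F.degree m) (Y : F.FormAlg) :
    hF.d (X * Y) = hF.d X * Y + (-1) ^ m * (X * hF.d Y) := by
  apply Subtype.ext
  rw [d_coe, coords_mul, dOp_mul hX, coords_apply F Y, F.toEnd_apply_vac Y.2]
  have h : ((-1 : F.FormAlg) ^ m) = algebraMap k F.FormAlg ((-1) ^ m) := by simp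
  rw [h, ← Algebra.smul_def]
  rfl

theorem IsClosed.d_d (X : F.FormAlg) : hF.d (hF.d X) = 0 := by
  have h (S : Finset I) (a : A) : hF.d (hF.d (F.e S * F.coeff a)) = 0 := by
    rw [d_e_mul_coeff, map_smul]
    apply Subtype.ext
    have h1 : F.coords (F.e S * hF.dA a) = create F.D.ε A S (F.coords (hF.dA a)) := rfl
    change (-1 : k) ^ S.card • F.dOp (F.coords (F.e S * hF.dA a)) = 0
    rw [h1, dOp_create, hF.dOp_dA, mul_zero, smul_zero, smul_zero]
  have h2 : X = ∑ S, F.e S * F.coeff (F.coords X S) := by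
    apply F.coords.injective
    rw [map_sum]
    simp only [coords_e_mul_coeff]
    exact (Finset.univ_sum_single _).symm
  rw [h2, map_sum, map_sum]
  exact Finset.sum_eq_zero fun S _ => h S _

/-- The span of the forms `a db₁ ⋯ db_m`. -/
def IsClosed.exact (m : ℕ) : Submodule k F.FormAlg :=
  Submodule.span k {X | ∃ (a : A) (b : Fin m → A),
    X = F.coeff a * (List.ofFn fun i => hF.d (F.coeff (b i))).prod}

theorem IsClosed.exact_le (m : ℕ) : hF.exact m ≤ F.degree m := by
  refine Submodule.span_le.2 ?_
  rintro _ ⟨a, b, rfl⟩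
  have h : (List.ofFn fun i => hF.d (F.coeff (b i))).prod ∈ F.degree m := by
    induction m with
    | zero => rw [List.ofFn_zero, List.prod_nil]; exact SetLike.GradedOne.one_mem
    | succ m ih =>
      rw [List.ofFn_succ, List.prod_cons, d_coeff]
      have := SetLike.mul_mem_graded (hF.dA_mem (b 0)) (ih fun i => b i.succ)
      rwa [add_comm] at this
  have := SetLike.mul_mem_graded (F.coeff_mem a) h
  rwa [zero_add] at this

theorem IsClosed.coeff_mul_exact (a : A) {m : ℕ} {X : F.FormAlg} (hX : X ∈ hF.exact m) :
    F.coeff a * X ∈ hF.exact m := by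
  induction hX using Submodule.span_induction with
  | mem X hX =>
    obtain ⟨a', b, rfl⟩ := hX
    exact Submodule.subset_span ⟨a * a', b, by rw [map_mul, mul_assoc]⟩
  | zero => rw [mul_zero]; exact zero_mem _
  | add X Y _ _ hX hY => rw [mul_add]; exact add_mem hX hY
  | smul c X _ hX => rw [mul_smul_comm]; exact Submodule.smul_mem _ _ hX

theorem IsClosed.dA_mul_exact (b : A) {m : ℕ} {X : F.FormAlg} (hX : X ∈ hF.exact m) :
    hF.dA b * X ∈ hF.exact (m + 1) := by
  induction hX using Submodule.span_induction with
  | mem X hX =>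
    obtain ⟨a, c, rfl⟩ := hX
    have key (a b : A) : F.coeff a * (hF.dA b * (List.ofFn fun i => hF.d (F.coeff (c i))).prod) ∈
        hF.exact (m + 1) := by
      refine Submodule.subset_span ⟨a, Fin.cons b c, ?_⟩
      rw [List.ofFn_succ, List.prod_cons, Fin.cons_zero, d_coeff]
      simp only [Fin.cons_succ]
    -- The coefficient is pulled out to the left through `db · a = d(ba) - b da`.
    have h : hF.dA (b * a) = F.coeff b * hF.dA a + hF.dA b * F.coeff a :=
      Subtype.ext (F.δ_mul b a)
    have h1 := key 1 (b * a)
    rw [map_one, one_mul, h, add_mul, mul_assoc] at h1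
    rw [← mul_assoc]
    exact Submodule.mem_of_add_mem_left h1 (key b a)
  | zero => rw [mul_zero]; exact zero_mem _
  | add X Y _ _ hX hY => rw [mul_add]; exact add_mem hX hY
  | smul c X _ hX => rw [mul_smul_comm]; exact Submodule.smul_mem _ _ hX

theorem IsClosed.e_mul_exact (s : I) {m : ℕ} {X : F.FormAlg} (hX : X ∈ hF.exact m) :
    F.e {s} * X ∈ hF.exact (m + 1) := by
  have h : F.e {s} ∈ Submodule.span k {X | ∃ a b, X = F.coeff a * hF.dA b} := by
    have := hF.dense s
    have him : {X | ∃ a b, X = F.Φ a * F.δ b} =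
        F.form.val '' {X | ∃ a b, X = F.coeff a * hF.dA b} := by
      ext X
      constructor
      · rintro ⟨a, b, rfl⟩; exact ⟨_, ⟨a, b, rfl⟩, rfl⟩
      · rintro ⟨_, ⟨a, b, rfl⟩, rfl⟩; exact ⟨a, b, rfl⟩
    rw [him] at this
    change (F.form.val.toLinearMap : F.FormAlg →ₗ[k] _) (F.e {s}) ∈
      Submodule.span k ((F.form.val.toLinearMap : F.FormAlg →ₗ[k] _) '' _) at this
    rw [← Submodule.map_span] at this
    obtain ⟨Z, hZ, hZ'⟩ := this
    have hZe : Z = F.e {s} := Subtype.ext hZ'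
    rwa [← hZe]
  generalize F.e {s} = Z at h ⊢
  induction h using Submodule.span_induction with
  | mem Z hZ =>
    obtain ⟨a, b, rfl⟩ := hZ
    rw [mul_assoc]
    exact hF.coeff_mul_exact a (hF.dA_mul_exact b hX)
  | zero => rw [zero_mul]; exact zero_mem _
  | add Z Y _ _ hZ hY => rw [add_mul]; exact add_mem hZ hY
  | smul c Z _ hZ => rw [smul_mul_assoc]; exact Submodule.smul_mem _ _ hZ

theorem IsClosed.e_mul_coeff_mem_exact (S : Finset I) (a : A) :
    F.e S * F.coeff a ∈ hF.exact S.card := by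
  induction S using Finset.induction_on with
  | empty =>
    rw [e_empty, one_mul]
    exact Submodule.subset_span ⟨a, Fin.elim0, by simp⟩
  | insert s S hs ih =>
    have hd : Disjoint {s} S := by simpa using hs
    have h := hF.e_mul_exact s ih
    rw [← mul_assoc, F.e_mul_e hd, smul_mul_assoc,
      Submodule.smul_mem_iff _ (sgn_ne_zero F.eps_swap _ _)] at h
    rw [Finset.card_insert_of_notMem hs]
    exact h

theorem IsClosed.degree_eq (m : ℕ) : F.degree m = hF.exact m := by
  refine le_antisymm (fun X hX => degree_induction F hX _ ?_) (hF.exact_le m)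
  rintro S a rfl
  exact hF.e_mul_coeff_mem_exact S a

end FormRep

/-- The differential calculus of a closed representation on forms. -/
noncomputable def FormRep.IsClosed.calculus {k : Type v} [Field k] {I : Type} [LinearOrder I]
    [Fintype I] {A : Type u} [Ring A] [Algebra k A] {F : FormRep k I A} (hF : F.IsClosed) :
    DifferentialCalculus k A where
  Form := F.FormAlg
  degree := F.degree
  d := hF.d
  d_mem _ _ h := hF.d_mem h
  d_mul _ _ Y h := hF.d_mul h Y
  d_d := hF.d_d
  coeff := F.coeff
  coeff_injective a b h := by
    have := congrArg F.coords h
    rw [F.coords_coeff, F.coords_coeff] at this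
    exact Pi.single_injective _ this
  mem_degree_zero X := by
    constructor
    · intro hX
      refine ⟨F.coords X ∅, F.coords.injective ?_⟩
      rw [F.coords_coeff]
      ext S
      by_cases hS : S = ∅
      · subst hS; simp
      · rw [Pi.single_eq_of_ne hS]
        exact (hX S fun h => hS (Finset.card_eq_zero.1 h)).symm
    · rintro ⟨a, rfl⟩
      exact F.coeff_mem a
  density := hF.degree_eq

end ColorExt

/-! ### Left coefficients, the volume form and its twist. -/

namespace ColorExt

namespace FormRep

variable {k I : Type*} [Field k] [LinearOrder I] [Fintype I]
variable {A : Type*} [Ring A] [Algebra k A] (F : FormRep k I A)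

theorem eq_sum_e_mul_coeff (X : F.FormAlg) : X = ∑ S, F.e S * F.coeff (F.coords X S) := by
  apply F.coords.injective
  rw [map_sum]
  simp only [coords_e_mul_coeff]
  exact (Finset.univ_sum_single _).symm

theorem coords_mul_coeff (X : F.FormAlg) (a : A) (S : Finset I) :
    F.coords (X * F.coeff a) S = F.coords X S * a := by
  conv_lhs => rw [F.eq_sum_e_mul_coeff X, Finset.sum_mul]
  simp only [mul_assoc, ← map_mul, map_sum, coords_e_mul_coeff, Finset.sum_apply]
  rw [Finset.sum_eq_single S]
  · simp
  · intro T _ hT; rw [Pi.single_eq_of_ne hT.symm]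
  · simp

/-- The span of the left multiples of the basic forms of degree `m`. -/
def leftSpan (m : ℕ) : Submodule k F.FormAlg :=
  Submodule.span k {X | ∃ (S : Finset I) (a : A), S.card = m ∧ X = F.coeff a * F.e S}

theorem mem_leftSpan (S : Finset I) (a : A) : F.coeff a * F.e S ∈ F.leftSpan S.card :=
  Submodule.subset_span ⟨S, a, rfl, rfl⟩

theorem coeff_mul_mem_leftSpan (b : A) {m : ℕ} {X : F.FormAlg} (hX : X ∈ F.leftSpan m) :
    F.coeff b * X ∈ F.leftSpan m := by
  induction hX using Submodule.span_induction with
  | mem X hX =>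
    obtain ⟨S, a, rfl, rfl⟩ := hX
    rw [← mul_assoc, ← map_mul]
    exact F.mem_leftSpan S _
  | zero => rw [mul_zero]; exact zero_mem _
  | add X Y _ _ hX hY => rw [mul_add]; exact add_mem hX hY
  | smul c X _ hX => rw [mul_smul_comm]; exact Submodule.smul_mem _ _ hX

/-- As the `G_{js}` are invertible, coefficients can be moved to the left as well. Hence the `e_S`
also span the forms as a left module, which the pairing below needs. -/
theorem e_mul_coeff_y (j s : I) : F.e {s} * F.coeff (F.y j) =
    (F.D.G j s)⁻¹ • (F.coeff (F.y j) * F.e {s} - ∑ r, F.D.n j r s • F.e {r}) := by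
  have h : F.coeff (F.y j) * F.e {s} =
      F.D.G j s • (F.e {s} * F.coeff (F.y j)) + ∑ r, F.D.n j r s • F.e {r} := by
    apply F.coords.injective
    have h := LinearMap.congr_fun (F.Φ_create j s) (Pi.single ∅ 1)
    have e1 (r : I) : create F.D.ε A {r} (Pi.single ∅ 1) = F.coords (F.e {r}) := rfl
    have e2 : create F.D.ε A {s} (F.Φ (F.y j) (Pi.single ∅ 1)) =
      F.coords (F.e {s} * F.coeff (F.y j)) := rfl
    have e3 : F.Φ (F.y j) (F.coords (F.e {s})) = F.coords (F.coeff (F.y j) * F.e {s}) := rfl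
    simpa only [LinearMap.add_apply, LinearMap.smul_apply, Module.End.mul_apply,
      LinearMap.sum_apply, e1, e2, e3, ← map_smul, ← map_sum, ← map_add] using h
  rw [h, add_sub_cancel_right, smul_smul, inv_mul_cancel₀ (F.G_ne_zero j s), one_smul]

theorem e_single_mul_coeff (s : I) (a : A) : F.e {s} * F.coeff a ∈ F.leftSpan 1 := by
  induction a using F.induction generalizing s with
  | gen j =>
    rw [e_mul_coeff_y]
    refine Submodule.smul_mem _ _ (sub_mem (F.mem_leftSpan {s} _) (sum_mem fun r _ =>
      Submodule.smul_mem _ _ ?_))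
    simpa using F.mem_leftSpan {r} 1
  | alg c =>
    rw [AlgHom.commutes, ← Algebra.commutes, ← F.coeff.commutes]; exact F.mem_leftSpan {s} _
  | add a b ha hb => rw [map_add, mul_add]; exact add_mem (ha s) (hb s)
  | mul a b ha hb =>
    rw [map_mul, ← mul_assoc]
    have h := ha s
    generalize F.e {s} * F.coeff a = Z at h ⊢
    induction h using Submodule.span_induction with
    | mem X hX =>
      obtain ⟨S, a', hS, rfl⟩ := hX
      obtain ⟨t, rfl⟩ := Finset.card_eq_one.1 hS
      rw [mul_assoc]
      exact F.coeff_mul_mem_leftSpan _ (hb t)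
    | zero => rw [zero_mul]; exact zero_mem _
    | add X Y _ _ hX hY => rw [add_mul]; exact add_mem hX hY
    | smul c X _ hX => rw [smul_mul_assoc]; exact Submodule.smul_mem _ _ hX

theorem e_single_mul_leftSpan (s : I) {m : ℕ} {X : F.FormAlg} (hX : X ∈ F.leftSpan m) :
    F.e {s} * X ∈ F.leftSpan (m + 1) := by
  induction hX using Submodule.span_induction with
  | mem X hX =>
    obtain ⟨S, a, rfl, rfl⟩ := hX
    rw [← mul_assoc]
    have h := F.e_single_mul_coeff s a
    generalize F.e {s} * F.coeff a = Z at h ⊢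
    induction h using Submodule.span_induction with
    | mem X hX =>
      obtain ⟨T, a', hT, rfl⟩ := hX
      obtain ⟨t, rfl⟩ := Finset.card_eq_one.1 hT
      rw [mul_assoc]
      by_cases ht : Disjoint {t} S
      · rw [F.e_mul_e ht, mul_smul_comm]
        refine Submodule.smul_mem _ _ ?_
        have := F.mem_leftSpan ({t} ∪ S) a'
        rwa [Finset.card_union_of_disjoint ht, Finset.card_singleton, add_comm] at this
      · rw [F.e_mul_e_of_not_disjoint ht, mul_zero]; exact zero_mem _
    | zero => rw [zero_mul]; exact zero_mem _
    | add X Y _ _ hX hY => rw [add_mul]; exact add_mem hX hY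
    | smul c X _ hX => rw [smul_mul_assoc]; exact Submodule.smul_mem _ _ hX
  | zero => rw [mul_zero]; exact zero_mem _
  | add X Y _ _ hX hY => rw [mul_add]; exact add_mem hX hY
  | smul c X _ hX => rw [mul_smul_comm]; exact Submodule.smul_mem _ _ hX

theorem e_mul_coeff_mem_leftSpan (S : Finset I) (a : A) :
    F.e S * F.coeff a ∈ F.leftSpan S.card := by
  induction S using Finset.induction_on with
  | empty => rw [e_empty, one_mul]; simpa [e_empty] using F.mem_leftSpan ∅ a
  | insert s S hs ih =>
    have hd : Disjoint {s} S := by simpa using hs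
    have h := F.e_single_mul_leftSpan s ih
    rw [← mul_assoc, F.e_mul_e hd, smul_mul_assoc,
      Submodule.smul_mem_iff _ (sgn_ne_zero F.eps_swap _ _)] at h
    rw [Finset.card_insert_of_notMem hs]
    exact h

/-- Every form of degree `m` is a left combination of basic forms. -/
theorem exists_left_coeff {m : ℕ} {X : F.FormAlg} (hX : X ∈ F.degree m) :
    ∃ a : Finset I → A, X = ∑ S with S.card = m, F.coeff (a S) * F.e S := by
  have h : X ∈ F.leftSpan m := degree_induction F hX _ (by
    rintro S a rfl; exact F.e_mul_coeff_mem_leftSpan S a)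
  clear hX
  induction h using Submodule.span_induction with
  | mem X hX =>
    obtain ⟨S, a, rfl, rfl⟩ := hX
    refine ⟨Pi.single S a, ?_⟩
    rw [Finset.sum_eq_single S]
    · simp
    · intro T _ hT; rw [Pi.single_eq_of_ne hT, map_zero, zero_mul]
    · simp
  | zero => exact ⟨0, by simp⟩
  | add X Y _ _ hX hY =>
    obtain ⟨a, rfl⟩ := hX
    obtain ⟨b, rfl⟩ := hY
    exact ⟨a + b, by simp [add_mul, Finset.sum_add_distrib]⟩
  | smul c X _ hX =>
    obtain ⟨a, rfl⟩ := hX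
    exact ⟨c • a, by simp [Finset.smul_sum]⟩

/-- The coefficient of the volume form. -/
def vol : F.FormAlg →ₗ[k] A := LinearMap.proj Finset.univ ∘ₗ F.coords.toLinearMap

theorem vol_apply (X : F.FormAlg) : F.vol X = F.coords X Finset.univ := rfl

theorem vol_mul_coeff (X : F.FormAlg) (a : A) : F.vol (X * F.coeff a) = F.vol X * a :=
  F.coords_mul_coeff X a _

theorem eq_e_univ_mul {X : F.FormAlg} (hX : X ∈ F.degree (Fintype.card I)) :
    X = F.e Finset.univ * F.coeff (F.vol X) := by
  apply F.coords.injective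
  rw [coords_e_mul_coeff]
  ext S
  by_cases hS : S = Finset.univ
  · subst hS; simp [vol_apply]
  · rw [Pi.single_eq_of_ne hS]
    exact hX S fun h => hS ((Finset.card_eq_iff_eq_univ S).1 h)

theorem e_univ_mem : F.e Finset.univ ∈ F.degree (Fintype.card I) := F.e_mem Finset.univ

theorem coeff_mul_e_univ (a : A) :
    F.coeff a * F.e Finset.univ =
      F.e Finset.univ * F.coeff (F.vol (F.coeff a * F.e Finset.univ)) := by
  refine F.eq_e_univ_mul ?_
  have := SetLike.mul_mem_graded (F.coeff_mem a) F.e_univ_mem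
  rwa [zero_add] at this

theorem vol_e_univ_mul_coeff (a : A) : F.vol (F.e Finset.univ * F.coeff a) = a := by
  rw [vol_apply, coords_e_mul_coeff]; simp

theorem vol_e_univ : F.vol (F.e Finset.univ) = 1 := by
  simpa using F.vol_e_univ_mul_coeff 1

/-- The algebra endomorphism by which `A` passes the volume form. -/
def twistHom : A →ₐ[k] A :=
  AlgHom.ofLinearMap
    { toFun := fun a => F.vol (F.coeff a * F.e Finset.univ)
      map_add' := fun a b => by rw [map_add, add_mul, map_add]
      map_smul' := fun c a => by rw [map_smul, smul_mul_assoc, map_smul, RingHom.id_apply] }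
    (by
      change F.vol (F.coeff 1 * F.e Finset.univ) = 1
      rw [map_one, one_mul, vol_e_univ])
    (fun a b => by
      change F.vol (F.coeff (a * b) * F.e Finset.univ) =
        F.vol (F.coeff a * F.e Finset.univ) * F.vol (F.coeff b * F.e Finset.univ)
      rw [map_mul F.coeff, mul_assoc, F.coeff_mul_e_univ b, ← mul_assoc, F.vol_mul_coeff,
        F.vol_e_univ_mul_coeff])

theorem twistHom_apply (a : A) : F.twistHom a = F.vol (F.coeff a * F.e Finset.univ) := rfl

/-- The point is that the corrections are scalars independent of `a`, because each `n^j_{rs}` is a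
scalar. On the volume form this makes the twist affine on generators. -/
theorem Φ_single (j : I) (S : Finset I) : ∃ c : Finset I → k, ∀ a,
    F.Φ (F.y j) (Pi.single S a) =
      (∏ s ∈ S, F.D.G j s) • (Pi.single S (F.y j * a) : Finset I → A) +
        ∑ T, c T • (Pi.single T a : Finset I → A) := by
  induction S using Finset.induction_on with
  | empty => exact ⟨0, fun a => by simp [F.Φ_vac]⟩
  | insert s S hs ih =>
    obtain ⟨c, hc⟩ := ih
    have hd : Disjoint {s} S := by simpa using hs
    have h1 (a : A) : (Pi.single (insert s S) a : Finset I → A) =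
        (sgn F.D.ε {s} S)⁻¹ • create F.D.ε A {s} (Pi.single S a) := by
      rw [create_single, if_pos hd, smul_smul, inv_mul_cancel₀ (sgn_ne_zero F.eps_swap _ _),
        one_smul]; rfl
    have hcr (r : I) (T : Finset I) : ∃ c : k, ∀ a : A,
        create F.D.ε A {r} (Pi.single T a) = c • (Pi.single ({r} ∪ T) a : Finset I → A) := by
      by_cases h : Disjoint {r} T
      · exact ⟨sgn F.D.ε {r} T, fun a => by rw [create_single, if_pos h]⟩
      · exact ⟨0, fun a => by rw [create_single, if_neg h, zero_smul]⟩
    choose w hw using hcr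
    have hsum (m : Finset I → k) (σ : Finset I → Finset I) (a : A) :
        ∑ T, m T • (Pi.single (σ T) a : Finset I → A) =
          ∑ U, (∑ T with σ T = U, m T) • (Pi.single U a : Finset I → A) := by
      simp only [Finset.sum_smul]
      rw [← Finset.sum_fiberwise (s := Finset.univ) (g := σ)]
      refine Finset.sum_congr rfl fun U _ => Finset.sum_congr rfl fun T hT => ?_
      rw [(Finset.mem_filter.1 hT).2]
    refine ⟨fun U => (sgn F.D.ε {s} S)⁻¹ * ((F.D.G j s * ∑ T with {s} ∪ T = U, c T * w s T) +
      ∑ r with {r} ∪ S = U, F.D.n j r s * w r S), fun a => ?_⟩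
    have hsum2 : ∑ r, (F.D.n j r s * w r S) • (Pi.single ({r} ∪ S) a : Finset I → A) =
        ∑ U, (∑ r with {r} ∪ S = U, F.D.n j r s * w r S) • (Pi.single U a : Finset I → A) := by
      simp only [Finset.sum_smul]
      rw [← Finset.sum_fiberwise (s := Finset.univ) (g := fun r : I => {r} ∪ S)]
      refine Finset.sum_congr rfl fun U _ => Finset.sum_congr rfl fun T hT => ?_
      rw [(Finset.mem_filter.1 hT).2]
    rw [h1, h1, map_smul, ← Module.End.mul_apply, F.Φ_create, Finset.prod_insert hs]
    simp only [LinearMap.add_apply, LinearMap.smul_apply, Module.End.mul_apply,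
      LinearMap.sum_apply, hc, map_add, map_smul, map_sum, hw, smul_add, smul_smul]
    rw [hsum, hsum2, add_assoc]
    simp only [Finset.smul_sum, smul_smul, ← Finset.sum_add_distrib, ← add_smul]
    congr 1
    · congr 1; ring
    · refine Finset.sum_congr rfl fun U _ => ?_
      congr 1; ring

/-- Each generator is rescaled by `∏ s, G_{js}`, which is nonzero, and shifted by a scalar. -/
theorem twistHom_bijective : Function.Bijective F.twistHom := by
  choose c hc using fun j => F.Φ_single j Finset.univ
  refine QuadRel.bijective_of_affine F.adjoin_y F.twistHom
    (fun j => ∏ s, F.D.G j s) (fun j => c j Finset.univ)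
    (fun j => Finset.prod_ne_zero_iff.2 fun s _ => F.G_ne_zero j s) fun j => ?_
  have h : F.twistHom (F.y j) = F.Φ (F.y j) (Pi.single Finset.univ 1) Finset.univ := by
    rw [twistHom_apply, vol_apply, coords_mul, coords_e]; rfl
  rw [h, hc]
  simp only [Pi.add_apply, Pi.smul_apply, Finset.sum_apply, Pi.single_eq_same, mul_one]
  rw [Finset.sum_eq_single Finset.univ]
  · rw [Pi.single_eq_same, Algebra.algebraMap_eq_smul_one]
  · intro T _ hT; rw [Pi.single_eq_of_ne hT.symm, smul_zero]
  · simp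

/-- The automorphism by which `A` passes the volume form. -/
noncomputable def twist : A ≃ₐ[k] A := AlgEquiv.ofBijective F.twistHom F.twistHom_bijective

theorem twist_apply (a : A) : F.twist a = F.vol (F.coeff a * F.e Finset.univ) := rfl

theorem vol_coeff_mul (a : A) {X : F.FormAlg} (hX : X ∈ F.degree (Fintype.card I)) :
    F.vol (F.coeff a * X) = F.twist a * F.vol X := by
  conv_lhs => rw [F.eq_e_univ_mul hX, ← mul_assoc, vol_mul_coeff]
  rfl

/-- Among the `e_S` of complementary degree only `e_{Tᶜ}` has a nonzero product with `e_T`. Left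
coefficients can therefore be read off, and also prescribed, which gives the two halves of the
perfect pairing. -/
theorem vol_left_mul_e {l m : ℕ} (h : l + m = Fintype.card I) (a : Finset I → A) {T : Finset I}
    (hT : T.card = m) :
    F.vol ((∑ S with S.card = l, F.coeff (a S) * F.e S) * F.e T) =
      sgn F.D.ε Tᶜ T • F.twist (a Tᶜ) := by
  rw [Finset.sum_mul, Finset.sum_eq_single Tᶜ]
  · rw [mul_assoc, F.e_mul_e disjoint_compl_left, mul_smul_comm, map_smul, twist_apply]
    rw [Finset.union_comm, Finset.union_compl]
  · intro S hS hST
    rw [mul_assoc, F.e_mul_e_of_not_disjoint, mul_zero]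
    intro hd
    refine hST (Finset.eq_of_subset_of_card_le
      (Finset.subset_compl_iff_disjoint_right.2 hd) ?_)
    rw [Finset.card_compl, (Finset.mem_filter.1 hS).2]
    omega
  · intro hT'
    exfalso
    apply hT'
    rw [Finset.mem_filter, Finset.card_compl]
    exact ⟨Finset.mem_univ _, by omega⟩

theorem eq_zero_of_vol_mul {l m : ℕ} (h : l + m = Fintype.card I) {X : F.FormAlg}
    (hX : X ∈ F.degree l) (h0 : ∀ Y ∈ F.degree m, F.vol (X * Y) = 0) : X = 0 := by
  obtain ⟨a, rfl⟩ := F.exists_left_coeff hX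
  refine Finset.sum_eq_zero fun S hS => ?_
  have hS' := (Finset.mem_filter.1 hS).2
  have hT : (Sᶜ).card = m := by rw [Finset.card_compl]; omega
  have := h0 (F.e Sᶜ) (hT ▸ F.e_mem _)
  rw [F.vol_left_mul_e h a hT, compl_compl] at this
  have h1 := (smul_eq_zero.1 this).resolve_left (sgn_ne_zero F.eps_swap _ _)
  rw [map_eq_zero_iff _ F.twist.injective] at h1
  rw [h1, map_zero, zero_mul]

theorem exists_vol_mul {l m : ℕ} (h : l + m = Fintype.card I) (φ : Finset I → A) :
    ∃ X ∈ F.degree l, ∀ T, T.card = m → F.vol (X * F.e T) = φ T := by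
  refine ⟨∑ S with S.card = l,
    F.coeff (F.twist.symm ((sgn F.D.ε S Sᶜ)⁻¹ • φ Sᶜ)) * F.e S, sum_mem fun S hS => ?_,
    fun T hT => ?_⟩
  · have := SetLike.mul_mem_graded (F.coeff_mem (F.twist.symm ((sgn F.D.ε S Sᶜ)⁻¹ • φ Sᶜ)))
      (F.e_mem S)
    rwa [zero_add, (Finset.mem_filter.1 hS).2] at this
  · rw [F.vol_left_mul_e h _ hT, AlgEquiv.apply_symm_apply, compl_compl, smul_smul,
      mul_inv_cancel₀ (sgn_ne_zero F.eps_swap _ _), one_smul]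

end FormRep

end ColorExt

/-! ### Integrability from a volume coefficient in odd dimension. -/

namespace DifferentialCalculus

variable {k : Type v} {A : Type u} [Field k] [Ring A] [Algebra k A] (C : DifferentialCalculus k A)

/-- A volume coefficient: a right `A`-linear functional on the forms of degree `n` under which the
product is a perfect pairing between complementary degrees. -/
structure Volume (n : ℕ) where
  vol : C.Form →ₗ[k] A
  ν : A ≃ₐ[k] A
  mul_coeff : ∀ X a, vol (X * C.coeff a) = vol X * a
  coeff_mul : ∀ a, ∀ X ∈ C.degree n, vol (C.coeff a * X) = ν a * vol X
  nondegenerate : ∀ l m, l + m = n → ∀ X ∈ C.degree l,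
    (∀ Y ∈ C.degree m, vol (X * Y) = 0) → X = 0
  exists_form : ∀ l m, l + m = n → ∀ φ : C.integralForms m,
    ∃ X ∈ C.degree l, ∀ Y : C.degree m, vol (X * Y) = φ.1 Y

namespace Volume

variable {C} {n : ℕ} (V : C.Volume n)

/-- The integral form `η ↦ vol (ω ∧ η)`. -/
def toIntegral (l m : ℕ) : C.degree l →ₗ[k] C.integralForms m where
  toFun ω := ⟨V.vol ∘ₗ LinearMap.mulLeft k (ω : C.Form) ∘ₗ (C.degree m).subtype, fun η a => by
    change V.vol ((ω : C.Form) * ((η : C.Form) * C.coeff a)) = V.vol ((ω : C.Form) * η) * a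
    rw [← mul_assoc, V.mul_coeff]⟩
  map_add' ω ω' := by
    refine Subtype.ext (LinearMap.ext fun η => ?_)
    change V.vol (((ω : C.Form) + ω') * η) = V.vol ((ω : C.Form) * η) + V.vol ((ω' : C.Form) * η)
    rw [add_mul, map_add]
  map_smul' c ω := by
    refine Subtype.ext (LinearMap.ext fun η => ?_)
    change V.vol ((c • (ω : C.Form)) * η) = c • V.vol ((ω : C.Form) * η)
    rw [smul_mul_assoc, map_smul]

theorem toIntegral_bijective (l m : ℕ) (h : l + m = n) :
    Function.Bijective (V.toIntegral l m) := by
  constructor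
  · rw [injective_iff_map_eq_zero]
    intro ω hω
    refine Subtype.ext (V.nondegenerate l m h ω ω.2 fun Y hY => ?_)
    have := congrArg (fun φ : C.integralForms m => φ.1 ⟨Y, hY⟩) hω
    exact this
  · intro φ
    obtain ⟨X, hX, h⟩ := V.exists_form l m h φ
    exact ⟨⟨X, hX⟩, Subtype.ext (LinearMap.ext h)⟩

/-- Forms and integral forms of complementary degrees correspond. -/
noncomputable def equiv (l m : ℕ) (h : l + m = n) : C.degree l ≃ₗ[k] C.integralForms m :=
  LinearEquiv.ofBijective (V.toIntegral l m) (V.toIntegral_bijective l m h)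

/-- The divergence that corresponds to the differential into the volume forms. -/
noncomputable def divergence (N : ℕ) (hN : N + 1 = n) (he : Even N) : C.Divergence where
  toLin := V.vol ∘ₗ C.d ∘ₗ (C.degree N).subtype ∘ₗ (V.equiv N 1 hN).symm.toLinearMap
  leibniz φ a := by
    obtain ⟨ω, rfl⟩ := (V.equiv N 1 hN).surjective φ
    have h : integralRmul (V.equiv N 1 hN ω) a = V.equiv N 1 hN (C.rmul ω a) := by
      refine Subtype.ext (LinearMap.ext fun η => ?_)
      change V.vol ((ω : C.Form) * (C.coeff a * η)) = V.vol ((ω : C.Form) * C.coeff a * η)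
      rw [mul_assoc]
    rw [h]
    simp only [LinearMap.comp_apply, LinearEquiv.coe_coe, LinearEquiv.symm_apply_apply]
    change V.vol (C.d ((ω : C.Form) * C.coeff a)) =
      V.vol (C.d ω) * a + V.vol ((ω : C.Form) * C.d (C.coeff a))
    -- The degree `N` being even gives the term `ω ∧ da` the sign that a divergence requires.
    rw [C.d_mul N _ _ ω.2, he.neg_one_pow, one_mul, map_add, V.mul_coeff]

theorem divergence_equiv {N : ℕ} (hN : N + 1 = n) (he : Even N) (ω : C.degree N) :
    (V.divergence N hN he).toLin (V.equiv N 1 hN ω) = V.vol (C.d ω) := by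
  change V.vol (C.d ((V.equiv N 1 hN).symm (V.equiv N 1 hN ω))) = _
  rw [LinearEquiv.symm_apply_apply]

/-- This is the graded Leibniz rule for `d (ω ∧ η)`. Since `l + m = N` is even, the signs `(-1) ^ l`
and `(-1) ^ (m + 1)` are opposite, and the two terms `ω ∧ dη` cancel. -/
theorem equiv_diff {N : ℕ} (hN : N + 1 = n) (he : Even N) {l m : ℕ} (h : l + (m + 1) = n)
    (h' : l + 1 + m = n) (ω : C.degree l) :
    V.equiv (l + 1) m h' (C.diff ω) =
      (V.divergence N hN he).extend m (V.equiv l (m + 1) h ω) := by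
  obtain rfl : l + m = N := by omega
  refine Subtype.ext (LinearMap.ext fun η => ?_)
  have h1 : contract (V.equiv l (m + 1) h ω) η = V.equiv (l + m) 1 hN (C.wedge ω η) := by
    refine Subtype.ext (LinearMap.ext fun ζ => ?_)
    change V.vol ((ω : C.Form) * ((η : C.Form) * ζ)) = V.vol ((ω : C.Form) * η * ζ)
    rw [mul_assoc]
  have h2 : ((V.divergence (l + m) hN he).extend m (V.equiv l (m + 1) h ω)).1 η =
      (V.divergence (l + m) hN he).toLin (contract (V.equiv l (m + 1) h ω) η) +
        (-1) ^ (m + 1) * V.vol ((ω : C.Form) * C.d η) := rfl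
  rw [h2, h1, divergence_equiv]
  change V.vol (C.d ω * η) = V.vol (C.d ((ω : C.Form) * η)) + _
  have h3 : ((-1 : C.Form) ^ l) * ((ω : C.Form) * C.d η) =
      ((-1 : k) ^ l) • ((ω : C.Form) * C.d η) := by
    rw [Algebra.smul_def, map_pow, map_neg, map_one]
  have h4 : ((-1 : A) ^ (m + 1)) * V.vol ((ω : C.Form) * C.d η) =
      -(((-1 : k) ^ m) • V.vol ((ω : C.Form) * C.d η)) := by
    rw [Algebra.smul_def, map_pow, map_neg, map_one, pow_succ]
    simp
  have h5 : (-1 : k) ^ l = (-1) ^ m := by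
    have h1 : (-1 : k) ^ l * (-1) ^ m = 1 := by rw [← pow_add, he.neg_one_pow]
    have h2 : (-1 : k) ^ m * (-1) ^ m = 1 := by rw [← mul_pow]; simp
    linear_combination (-1 : k) ^ m * h1 - (-1 : k) ^ l * h2
  rw [C.d_mul l _ _ ω.2, h3, map_add, map_smul, h4, h5, add_neg_cancel_right]

include V in
theorem isIntegrable (hdim : C.HasDimension n) {N : ℕ} (hN : N + 1 + 1 = n) (ho : Odd n) :
    C.IsIntegrable n := by
  have he : Even (N + 1) := by
    subst hN
    exact (Nat.odd_add_one.1 ho |> Nat.not_odd_iff_even.1)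
  refine ⟨hdim, V.divergence (N + 1) hN he, fun φ => ?_, V.ν, V.equiv, fun l m h a b ω => ?_,
    fun l m h h' ω => V.equiv_diff hN he h h' ω⟩
  · obtain ⟨ω, rfl⟩ := (V.equiv N (1 + 1) hN).surjective φ
    -- Under the identification with forms, the curvature is `d ∘ d`.
    rw [← V.equiv_diff hN he (m := 1) hN hN, divergence_equiv]
    change V.vol (C.d (C.d ω)) = 0
    rw [C.d_d, map_zero]
  · refine Subtype.ext (LinearMap.ext fun η => ?_)
    change V.vol (C.coeff a * (ω : C.Form) * C.coeff b * η) =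
      V.ν a * V.vol ((ω : C.Form) * (C.coeff b * η))
    rw [mul_assoc, mul_assoc, V.coeff_mul]
    subst h
    exact SetLike.mul_mem_graded (A := C.degree) ω.2 (C.lmul b η).2

end Volume

end DifferentialCalculus

namespace ColorExt

variable {k : Type v} [Field k] {I : Type} [LinearOrder I] [Fintype I] {A : Type u} [Ring A]
  [Algebra k A] {F : FormRep k I A} (hF : F.IsClosed)

theorem FormRep.vol_mul_eq {m : ℕ} {X : F.FormAlg} {φ : F.degree m →ₗ[k] A}
    (hφ : ∀ (Y : F.degree m) (a : A) (hYa : Y.1 * F.coeff a ∈ F.degree m),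
      φ ⟨Y.1 * F.coeff a, hYa⟩ = φ Y * a)
    (h : ∀ (T) (hT : F.e T ∈ F.degree m), T.card = m → F.vol (X * F.e T) = φ ⟨F.e T, hT⟩)
    (Y : F.degree m) : F.vol (X * Y.1) = φ Y := by
  let Q : Submodule k F.FormAlg :=
    (LinearMap.eqLocus (F.vol ∘ₗ LinearMap.mulLeft k X ∘ₗ (F.degree m).subtype) φ).map
      (F.degree m).subtype
  have hQ : Y.1 ∈ Q := FormRep.degree_induction F Y.2 Q (by
    rintro T a rfl
    have hT := F.e_mem T
    have hTa : F.e T * F.coeff a ∈ F.degree T.card := by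
      simpa using SetLike.mul_mem_graded hT (F.coeff_mem a)
    refine ⟨⟨F.e T * F.coeff a, hTa⟩, ?_, rfl⟩
    change F.vol (X * (F.e T * F.coeff a)) = φ ⟨F.e T * F.coeff a, hTa⟩
    rw [hφ ⟨F.e T, hT⟩ a hTa, ← mul_assoc, F.vol_mul_coeff, h T hT rfl])
  obtain ⟨Z, hZ, hZY⟩ := hQ
  rw [← Subtype.ext hZY]
  exact hZ

/-- The top coefficient is a volume coefficient. -/
noncomputable def FormRep.IsClosed.volume : hF.calculus.Volume (Fintype.card I) where
  vol := F.vol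
  ν := F.twist
  mul_coeff := F.vol_mul_coeff
  coeff_mul a _ hX := F.vol_coeff_mul a hX
  nondegenerate _ _ h _ hX h0 := F.eq_zero_of_vol_mul h hX h0
  exists_form l m h φ := by
    classical
    obtain ⟨X, hX, hX'⟩ := F.exists_vol_mul h fun T =>
      if hT : F.e T ∈ F.degree m then φ.1 ⟨F.e T, hT⟩ else 0
    refine ⟨X, hX, F.vol_mul_eq (φ := φ.1) (fun Y a _ => φ.2 Y a) fun T hT hTm => ?_⟩
    exact (hX' T hTm).trans (dif_pos hT)

theorem FormRep.IsClosed.hasDimension [Nontrivial A] :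
    hF.calculus.HasDimension (Fintype.card I) := by
  constructor
  · intro h
    have h1 : F.e Finset.univ ∈ (⊥ : Submodule k F.FormAlg) :=
      (show F.degree (Fintype.card I) = ⊥ from h) ▸ F.e_univ_mem
    have h2 := F.vol_e_univ
    rw [(Submodule.mem_bot k).1 h1, map_zero] at h2
    exact zero_ne_one h2
  · intro m hm
    change F.degree m = ⊥
    rw [eq_bot_iff]
    refine fun X hX => FormRep.degree_induction F hX ⊥ fun S a hS => ?_
    exact absurd (Finset.card_le_univ S) (by omega)

theorem FormRep.IsClosed.isIntegrable [Nontrivial A] {N : ℕ} (hN : N + 1 + 1 = Fintype.card I)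
    (ho : Odd (Fintype.card I)) : hF.calculus.IsIntegrable (Fintype.card I) :=
  DifferentialCalculus.Volume.isIntegrable hF.volume hF.hasDimension hN ho

end ColorExt

/-! ### Derivations from values on generators, and the conditions for a differential. -/

namespace QuadRel

variable {k I : Type*} [Field k] [LinearOrder I] [Fintype I] {R : QuadRel k I}
variable {A : Type*} [Ring A] [Algebra k A] {y : I → A}

/-- An algebra whose ordered monomials are a basis admits derivations into an algebra, relative to
a homomorphism, with any values on the generators that are compatible with the relations. -/
theorem exists_derivation (h : R.Holds y) (hc : ∀ i j, i < j → R.c i j ≠ 0)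
    (b : Module.Basis (Multiset I) k A) (hb : ∀ m, b m = sortedProd y m)
    {B : Type*} [Ring B] [Algebra k B] (z w : I → B) (hz : R.Holds z)
    (hw : ∀ i j, i < j → z j * w i + w j * z i =
      R.c i j • (z i * w j + w i * z j) + ∑ m, R.q i j m • w m) :
    ∃ (f : A →ₐ[k] B) (δ : A →ₗ[k] B), (∀ i, f (y i) = z i) ∧ (∀ i, δ (y i) = w i) ∧
      ∀ a a', δ (a * a') = f a * δ a' + δ a * f a' := by
  -- A derivation relative to `f` is the second component of an algebra map `a ↦ f a + δ a` into the
  -- trivial square-zero extension, and such a map exists as soon as the relations hold there.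
  obtain ⟨g, hg⟩ := exists_algHom h hc b hb
    (B := TrivSqZeroExt B B) (fun i => .inl (z i) + .inr (w i)) (by
      intro i j hij
      refine TrivSqZeroExt.ext ?_ ?_
      · simpa [TrivSqZeroExt.fst_sum, TrivSqZeroExt.algebraMap_eq_inl'] using hz i j hij
      · simpa [TrivSqZeroExt.snd_sum, TrivSqZeroExt.algebraMap_eq_inl'] using hw i j hij)
  refine ⟨(TrivSqZeroExt.fstHom k B B).comp g, (TrivSqZeroExt.sndHom B B).restrictScalars k ∘ₗ
    g.toLinearMap, fun i => ?_, fun i => ?_, fun a a' => ?_⟩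
  · simp [hg]
  · simp [hg]
  · simp 

end QuadRel

namespace ColorExt

variable {k I : Type*} [Field k] [LinearOrder I] [Fintype I]

/-- The conditions under which there is a differential with `d y_j = e_j` for `j ∉ L` and
`d y_j = (lam - 1) e_j y_j` for `j ∈ L`. -/
structure FormData.HasDifferential (D : FormData k I) (R : QuadRel k I) (L : Set I) (lam : k) :
    Prop where
  lam_ne : ∀ n, n ≠ 0 → lam ^ n ≠ 1
  isBot : ∀ θ ∈ L, ∀ i, θ ≤ i
  G_self : ∀ i ∉ L, D.G i i = 1
  G_log_self : ∀ θ ∈ L, D.G θ θ = lam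
  G_right : ∀ i j, i < j → i ∉ L → D.G j i = R.c i j
  G_log : ∀ θ ∈ L, ∀ j, θ < j → D.G j θ = 1
  G_left : ∀ i j, i < j → i ∉ L → R.c i j * D.G i j = 1
  n_swap : ∀ i j r, i < j → i ∉ L → D.n j r i - R.c i j * D.n i r j = R.q i j r
  eps : ∀ i j, i ∉ L → i ≠ j → D.ε i j = D.G i j
  eps_log : ∀ θ ∈ L, ∀ j, D.ε θ j = 1
  q_log : ∀ i j, i < j → ∀ θ ∈ L, R.q i j θ = 0
  q_log_left : ∀ θ ∈ L, ∀ j m, θ < j → R.q θ j m = 0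
  κ_log : ∀ θ ∈ L, ∀ j, θ < j → R.κ θ j = 0
  n_log : ∀ θ ∈ L, ∀ r s, D.n θ r s = 0
  n_log_right : ∀ θ ∈ L, ∀ j r, θ < j →
    (lam - 1) * D.n j r θ = if r = j then R.c θ j * D.G θ j - 1 else 0
  dense : ∀ θ ∈ L, ∃ i j, i ∉ L ∧ D.n j θ i ≠ 0 ∧ ∀ r, r ≠ θ → D.n j r i = 0

section

variable {A : Type*} [Ring A] [Algebra k A] {R : QuadRel k I}

open Classical in
/-- The differential of the generator `y_j = a`. -/
noncomputable def FormData.dgen (D : FormData k I) (L : Set I) (lam : k) (j : I) (a : A) :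
    Module.End k (Finset I → A) :=
  create D.ε A {j} * if j ∈ L then (lam - 1) • D.gen j a else 1

variable {D : FormData k I} {L : Set I} {lam : k}

theorem FormData.dgen_of_notMem {j : I} (hj : j ∉ L) (a : A) :
    D.dgen L lam j a = create D.ε A {j} := by rw [dgen, if_neg hj, mul_one]

theorem FormData.dgen_of_mem {j : I} (hj : j ∈ L) (a : A) :
    D.dgen L lam j a = (lam - 1) • (create D.ε A {j} * D.gen j a) := by
  rw [dgen, if_pos hj, mul_smul_comm]

/-- The derivative of the relation `(i, j)`. Without a logarithmic generator, moving all
coefficients behind the forms turns it into `G_right`, `G_left` and `n_swap`. -/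
theorem FormData.HasDifferential.dgen_rel (H : D.HasDifferential R L lam) (hD : D.Compatible R)
    {y : I → A} (hy : R.Holds y) (i j : I) (hij : i < j) :
    D.gen j (y j) * D.dgen L lam i (y i) + D.dgen L lam j (y j) * D.gen i (y i) =
      R.c i j • (D.gen i (y i) * D.dgen L lam j (y j) + D.dgen L lam i (y i) * D.gen j (y j)) +
        ∑ m, R.q i j m • D.dgen L lam m (y m) := by
  have hj : j ∉ L := fun hj => absurd (H.isBot j hj i) (not_le.2 hij)
  have hq : ∑ m, R.q i j m • D.dgen L lam m (y m) = ∑ m, R.q i j m • create D.ε A {m} := by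
    refine Finset.sum_congr rfl fun m _ => ?_
    by_cases hm : m ∈ L
    · rw [H.q_log i j hij m hm, zero_smul, zero_smul]
    · rw [FormData.dgen_of_notMem hm]
  rw [FormData.dgen_of_notMem hj, hq]
  -- For a logarithmic `y_i` the relation is `y_j y_i = c y_i y_j` without lower terms. The surplus
  -- `(c G_{ij} - 1) e_j y_i` on the right is supplied by the term of `y_j e_i` that `n_log_right`
  -- fixes.
  by_cases hi : i ∈ L
  · have hc : R.c i j • (D.gen i (y i) * create D.ε A {j}) =
        (R.c i j * D.G i j - 1) • (create D.ε A {j} * D.gen i (y i)) +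
          create D.ε A {j} * D.gen i (y i) := by
      have h1 (X : Module.End k (Finset I → A)) (g : k) : (g - 1) • X + X = g • X := by
        conv_rhs => rw [← sub_add_cancel g 1, add_smul, one_smul]
      rw [hD.gen_mul_create, h1]
      simp [H.n_log i hi, smul_smul]
    have hr : D.gen j (y j) * D.gen i (y i) = R.c i j • (D.gen i (y i) * D.gen j (y j)) := by
      have := hD.holds_gen hy i j hij
      simpa [H.κ_log i hi j hij, H.q_log_left i hi j _ hij] using this
    have hn : ∑ r, ((lam - 1) * D.n j r i) • create D.ε A {r} =
        (R.c i j * D.G i j - 1) • create D.ε A {j} := by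
      rw [Finset.sum_eq_single j]
      · rw [H.n_log_right i hi j j hij, if_pos rfl]
      · intro r _ hr
        rw [H.n_log_right i hi j r hij, if_neg hr, zero_smul]
      · simp
    have hn' : ∑ r, (lam - 1) • (D.n j r i • (create D.ε A {r} * D.gen i (y i))) =
        (R.c i j * D.G i j - 1) • (create D.ε A {j} * D.gen i (y i)) := by
      rw [← smul_mul_assoc, ← hn, Finset.sum_mul]
      simp only [smul_smul, smul_mul_assoc]
    rw [FormData.dgen_of_mem hi]
    generalize lam - 1 = μ at hn'
    rw [mul_smul_comm, ← mul_assoc, hD.gen_mul_create, add_mul, smul_mul_assoc,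
      mul_assoc, hr, smul_add, Finset.sum_mul, Finset.smul_sum, smul_add (R.c i j), hc]
    simp only [smul_mul_assoc, hn', H.q_log_left i hi j _ hij, zero_smul, Finset.sum_const_zero,
      H.G_log i hi j hij, one_smul, mul_smul_comm, mul_assoc, smul_comm μ (R.c i j)]
    abel
  · rw [FormData.dgen_of_notMem hi, hD.gen_mul_create, hD.gen_mul_create, H.G_right i j hij hi]
    have hn (r : I) : D.n j r i = R.c i j * D.n i r j + R.q i j r := by
      rw [← H.n_swap i j r hij hi]; ring
    simp only [smul_add, smul_smul, H.G_left i j hij hi, one_smul, Finset.smul_sum, hn, add_smul,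
      Finset.sum_add_distrib]
    abel

/-- Differentiating `y_j e_s = G_{js} e_s y_j + ∑ n e_r` with closed `e_s` and `e_r` forces this
rule; `eps` and `eps_log` are the corresponding conditions. -/
theorem FormData.HasDifferential.dgen_mul_create (H : D.HasDifferential R L lam)
    (hD : D.Compatible R) (j s : I) (a : A) :
    D.dgen L lam j a * create D.ε A {s} =
      (-D.G j s) • (create D.ε A {s} * D.dgen L lam j a) := by
  have hcr (h : D.ε j s = D.G j s) : create D.ε A {j} * create D.ε A {s} =
      (-D.G j s) • (create D.ε A {s} * create D.ε A {j}) := by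
    by_cases hs : j = s
    · subst hs; rw [create_sq, smul_zero]
    · rw [create_swap hD.eps_swap hs, h]
  by_cases hj : j ∈ L
  · rw [FormData.dgen_of_mem hj, smul_mul_assoc, mul_assoc, hD.gen_mul_create]
    simp only [H.n_log j hj, zero_smul, Finset.sum_const_zero, add_zero, mul_smul_comm]
    rw [smul_comm (lam - 1), ← mul_assoc, ← mul_assoc]
    by_cases hs : j = s
    · subst hs; simp [create_sq]
    · rw [create_swap hD.eps_swap hs, H.eps_log j hj]
      simp only [smul_mul_assoc, smul_smul]
      congr 1; ring
  · rw [FormData.dgen_of_notMem hj]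
    by_cases hs : j = s
    · subst hs; rw [create_sq, smul_zero]
    · exact hcr (H.eps j s hj hs)

/-- A compatible system of structure constants with a differential is realized by a closed
representation on forms. -/
theorem FormData.HasDifferential.exists_formRep (H : D.HasDifferential R L lam)
    (hD : D.Compatible R) {y : I → A} (hy : R.Holds y) (hc : ∀ i j, i < j → R.c i j ≠ 0)
    (b : Module.Basis (Multiset I) k A) (hb : ∀ m, b m = sortedProd y m) :
    ∃ F : FormRep k I A, F.D = D ∧ F.y = y ∧ (∀ j, F.Φ (y j) = D.gen j (y j)) ∧
      ∀ j, F.δ (y j) = D.dgen L lam j (y j) := by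
  obtain ⟨Φ, δ, hΦ, hδ, hmul⟩ := QuadRel.exists_derivation hy hc b hb
    (fun j => D.gen j (y j)) (fun j => D.dgen L lam j (y j)) (hD.holds_gen hy)
    fun i j hij => H.dgen_rel hD hy i j hij
  have hy' := QuadRel.adjoin_eq_top b hb
  refine ⟨⟨D, hD.eps_swap, hD.G_ne_zero, y, hy', Φ, fun a b => ?_, fun j u => ?_, δ, hmul,
    fun j s => ?_⟩, rfl, rfl, hΦ, hδ⟩
  · have h : a ∈ Algebra.adjoin k (Set.range y) := hy' ▸ Algebra.mem_top
    induction h using Algebra.adjoin_induction generalizing b with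
    | mem x hx =>
      obtain ⟨j, rfl⟩ := hx
      rw [hΦ, FormData.Compatible.gen_vac]
    | algebraMap c =>
      rw [AlgHom.commutes, Module.algebraMap_end_apply, ← Pi.single_smul, Algebra.smul_def]
    | add a a' _ _ ha ha' => rw [map_add, LinearMap.add_apply, ha, ha', add_mul, Pi.single_add]
    | mul a a' _ _ ha ha' => rw [map_mul, Module.End.mul_apply, ha', ha, mul_assoc]
  · rw [hΦ]; exact hD.gen_mul_create j u (y j)
  · rw [hδ]; exact H.dgen_mul_create hD j s (y j)

theorem FormData.HasDifferential.isClosed {F : FormRep k I A} (H : F.D.HasDifferential R L lam)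
    (hδ : ∀ j, F.δ (F.y j) = F.D.dgen L lam j (F.y j))
    (hΦ : ∀ j, F.Φ (F.y j) = F.D.gen j (F.y j)) : F.IsClosed where
  mem j := by
    rw [hδ]
    by_cases hj : j ∈ L
    · rw [FormData.dgen_of_mem hj, ← hΦ]
      exact F.form.smul_mem (mul_mem (F.E_mem _) (F.Φ_mem _)) _
    · rw [FormData.dgen_of_notMem hj]; exact F.E_mem _
  homog j := by
    rw [hδ]
    by_cases hj : j ∈ L
    · rw [FormData.dgen_of_mem hj, LinearMap.smul_apply, Module.End.mul_apply,
        FormData.Compatible.gen_vac, create_vac]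
      exact Submodule.smul_mem _ _ (FormRep.single_mem_homog {j} _)
    · rw [FormData.dgen_of_notMem hj, create_vac]; exact FormRep.single_mem_homog {j} _
  closed j := by
    rw [hδ]
    by_cases hj : j ∈ L
    · rw [FormData.dgen_of_mem hj, LinearMap.smul_apply, Module.End.mul_apply,
        FormData.Compatible.gen_vac, create_vac, map_smul, F.dOp_single, mul_one, hδ,
        FormData.dgen_of_mem hj, mul_smul_comm, ← mul_assoc, create_sq, zero_mul]
      simp
    · rw [FormData.dgen_of_notMem hj, create_vac, F.dOp_single, F.δ_one]; simp
  dense s := by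
    have hleft (a : A) {X} (hX : X ∈ Submodule.span k {X | ∃ a b, X = F.Φ a * F.δ b}) :
        F.Φ a * X ∈ Submodule.span k {X | ∃ a b, X = F.Φ a * F.δ b} := by
      induction hX using Submodule.span_induction with
      | mem X hX =>
        obtain ⟨a', b, rfl⟩ := hX
        exact Submodule.subset_span ⟨a * a', b, by rw [map_mul, mul_assoc]⟩
      | zero => rw [mul_zero]; exact zero_mem _
      | add X Y _ _ hX hY => rw [mul_add]; exact add_mem hX hY
      | smul c X _ hX => rw [mul_smul_comm]; exact Submodule.smul_mem _ _ hX
    have hbase (a : A) : F.δ a ∈ Submodule.span k {X | ∃ a b, X = F.Φ a * F.δ b} :=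
      Submodule.subset_span ⟨1, a, by rw [map_one, one_mul]⟩
    have hright (a b : A) :
        F.δ a * F.Φ b ∈ Submodule.span k {X | ∃ a b, X = F.Φ a * F.δ b} := by
      have := hbase (a * b)
      rw [F.δ_mul] at this
      exact Submodule.mem_of_add_mem_left this (hleft a (hbase b))
    by_cases hs : s ∈ L
    · obtain ⟨i, j, hi, hn, hr⟩ := H.dense s hs
      have h1 := hleft (F.y j) (hbase (F.y i))
      have h2 := hright (F.y i) (F.y j)
      rw [hδ, FormData.dgen_of_notMem hi] at h1 h2
      rw [F.Φ_create, Finset.sum_eq_single s (fun r _ hrs => by rw [hr r hrs, zero_smul])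
        (by simp)] at h1
      have h3 := Submodule.mem_of_add_mem_left h1 (Submodule.smul_mem _ _ h2)
      exact (Submodule.smul_mem_iff _ hn).1 h3
    · have := hbase (F.y s)
      rwa [hδ, FormData.dgen_of_notMem hs] at this

end

end ColorExt

/-! ### Partial derivatives and connectedness. -/

namespace QuadRel

theorem mul_mem_filt_sub_one {k I A : Type*} [Field k] [Ring A] [Algebra k A] {y : I → A} (i : I)
    {a : A} {m : ℕ} (h : a ∈ filt k y (m - 1)) : y i * a ∈ filt k y m := by
  cases m with
  | zero =>
    rw [Nat.zero_sub, filt_zero, Submodule.mem_bot] at h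
    rw [h, mul_zero]; exact zero_mem _
  | succ m => exact mul_mem_filt i h

/-- A coordinate with respect to the ordered monomials vanishes on words of smaller length. -/
theorem coord_filt {k I A : Type*} [Field k] [LinearOrder I] [Fintype I] [Ring A] [Algebra k A]
    {R : QuadRel k I} {y : I → A} (h : R.Holds y) (hc : ∀ i j, i < j → R.c i j ≠ 0)
    (b : Module.Basis (Multiset I) k A) (hb : ∀ m, b m = sortedProd y m) {n : ℕ} {a : A}
    (ha : a ∈ filt k y n) {m : Multiset I} (hm : n ≤ m.card) : b.repr a m = 0 := by
  rw [filt_eq_span_sorted h hc] at ha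
  induction ha using Submodule.span_induction with
  | mem x hx =>
    obtain ⟨m', hm', rfl⟩ := hx
    rw [← hb, b.repr_self, Finsupp.single_apply_eq_zero]
    rintro rfl
    exact absurd (show m.card < n from hm') (by omega)
  | zero => simp
  | add x z _ _ hx hz => rw [map_add, Finsupp.add_apply, hx, hz, add_zero]
  | smul c x _ hx => rw [map_smul, Finsupp.smul_apply, hx, smul_zero]

end QuadRel

namespace ColorExt

namespace FormRep

variable {k I : Type*} [Field k] [LinearOrder I] [Fintype I]
variable {A : Type*} [Ring A] [Algebra k A] (F : FormRep k I A)

/-- The partial derivatives: the coefficients of the differential. -/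
def pd (s : I) : A →ₗ[k] A where
  toFun a := F.δ a (Pi.single ∅ 1) {s}
  map_add' a b := by rw [map_add]; rfl
  map_smul' c a := by rw [map_smul]; rfl

theorem pd_apply (s : I) (a : A) : F.pd s a = F.δ a (Pi.single ∅ 1) {s} := rfl

variable {F}

theorem IsClosed.pd_y_mul (hF : F.IsClosed) (j s : I) (a : A) :
    F.pd s (F.y j * a) = F.D.G j s • (F.y j * F.pd s a) + ∑ u, F.D.n j s u • F.pd u a +
      F.δ (F.y j) (Pi.single ∅ a) {s} := by
  have hf : F.δ a (Pi.single ∅ 1) =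
      ∑ u, create F.D.ε A {u} (Pi.single ∅ (F.pd u a)) := by
    have h1 : F.δ a (Pi.single ∅ 1) ∈ FormRep.homog I k A 1 := hF.dA_mem a
    ext S
    rw [Finset.sum_apply]
    simp only [create_vac]
    by_cases hS : S.card = 1
    · obtain ⟨u, rfl⟩ := Finset.card_eq_one.1 hS
      rw [Finset.sum_eq_single u]
      · simp [pd_apply]
      · intro v _ hv; rw [Pi.single_eq_of_ne]; simpa using hv.symm
      · simp
    · rw [h1 S hS, Finset.sum_eq_zero]
      intro u _
      rw [Pi.single_eq_of_ne]
      rintro rfl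
      exact hS (Finset.card_singleton u)
  have hu (u : I) (c : A) : F.Φ (F.y j) (create F.D.ε A {u} (Pi.single ∅ c)) {s} =
      (if s = u then F.D.G j u • (F.y j * c) else 0) + F.D.n j s u • c := by
    rw [← Module.End.mul_apply, F.Φ_create]
    simp only [LinearMap.add_apply, LinearMap.smul_apply, LinearMap.sum_apply,
      Module.End.mul_apply, F.Φ_vac, create_vac, Pi.add_apply, Pi.smul_apply, Finset.sum_apply]
    congr 1
    · split_ifs with h
      · subst h; simp
      · rw [Pi.single_eq_of_ne (by simpa using h), smul_zero]
    · rw [Finset.sum_eq_single s]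
      · simp
      · intro r _ hr; rw [Pi.single_eq_of_ne (by simpa using hr.symm), smul_zero]
      · simp
  rw [pd_apply, F.δ_mul, LinearMap.add_apply, Module.End.mul_apply, Module.End.mul_apply, F.Φ_vac,
    mul_one, hf, map_sum, Pi.add_apply, Finset.sum_apply]
  simp only [hu, Finset.sum_add_distrib]
  simp

end FormRep

open QuadRel

namespace FormData.HasDifferential

variable {k I : Type*} [Field k] [LinearOrder I] [Fintype I] {R : QuadRel k I} {L : Set I} {lam : k}
variable {A : Type*} [Ring A] [Algebra k A] {F : FormRep k I A}
variable (H : F.D.HasDifferential R L lam)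
  (hδ : ∀ j, F.δ (F.y j) = F.D.dgen L lam j (F.y j)) (hF : F.IsClosed)

theorem eq_of_mem_log (H : F.D.HasDifferential R L lam) {θ i : I} (hθ : θ ∈ L) (hi : i ∈ L) :
    i = θ := le_antisymm (H.isBot i hi θ) (H.isBot θ hθ i)

include H hδ hF

omit H in
theorem pd_y_mul (j s : I) (hj : j ∉ L) (a : A) :
    F.pd s (F.y j * a) = F.D.G j s • (F.y j * F.pd s a) + ∑ u, F.D.n j s u • F.pd u a +
      if s = j then a else 0 := by
  rw [hF.pd_y_mul, hδ, FormData.dgen_of_notMem hj, create_vac]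
  congr 1
  split_ifs with h
  · subst h; simp
  · rw [Pi.single_eq_of_ne (by simpa using h)]

theorem pd_log_mul (j s : I) (hj : j ∈ L) (a : A) :
    F.pd s (F.y j * a) = F.D.G j s • (F.y j * F.pd s a) +
      if s = j then (lam - 1) • (F.y j * a) else 0 := by
  rw [hF.pd_y_mul, hδ, FormData.dgen_of_mem hj, LinearMap.smul_apply, Module.End.mul_apply,
    FormData.Compatible.gen_vac, create_vac]
  simp only [H.n_log j hj, zero_smul, Finset.sum_const_zero, add_zero]
  congr 1
  rw [Pi.smul_apply]
  split_ifs with h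
  · subst h; simp
  · rw [Pi.single_eq_of_ne (by simpa using h), smul_zero]

/-- An ordinary partial derivative lowers the order. A logarithmic one acts on leading terms like
the Euler operator: a word is an eigenvector up to lower order, since a letter `θ` contributes `lam
= G_{θθ}` and every other letter passes `e_θ` with factor `1`. -/
theorem pd_wordProd_mem (l : List I) :
    (∀ s ∉ L, F.pd s (wordProd F.y l) ∈ filt k F.y l.length) ∧
      ∀ θ ∈ L, F.pd θ (wordProd F.y l) - (lam ^ l.count θ - 1) • wordProd F.y l ∈
        filt k F.y l.length := by
  induction l with
  | nil =>
    have h (s : I) : F.pd s (wordProd F.y []) = 0 := by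
      rw [wordProd_nil, FormRep.pd_apply, F.δ_one]; rfl
    refine ⟨fun s _ => ?_, fun θ _ => ?_⟩
    · rw [h]; exact zero_mem _
    · rw [h]; simp
  | cons j l ih =>
    obtain ⟨ih1, ih2⟩ := ih
    have hl : wordProd F.y l ∈ filt k F.y (j :: l).length := wordProd_mem_filt (by simp)
    have ih3 (u : I) : F.pd u (wordProd F.y l) ∈ filt k F.y (j :: l).length := by
      by_cases hu : u ∈ L
      · have := ih2 u hu
        rw [← sub_add_cancel (F.pd u (wordProd F.y l)) ((lam ^ l.count u - 1) • wordProd F.y l)]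
        exact add_mem (filt_mono (by simp) this) (Submodule.smul_mem _ _ hl)
      · exact filt_mono (by simp) (ih1 u hu)
    rw [wordProd_cons]
    refine ⟨fun s hs => ?_, fun θ hθ => ?_⟩
    · by_cases hj : j ∈ L
      · rw [H.pd_log_mul hδ hF j s hj, if_neg (fun h : s = j => hs (h ▸ hj)), add_zero]
        exact Submodule.smul_mem _ _ (mul_mem_filt j (ih1 s hs))
      · rw [pd_y_mul hδ hF j s hj]
        refine add_mem (add_mem (Submodule.smul_mem _ _ (mul_mem_filt j (ih1 s hs)))
          (sum_mem fun u _ => Submodule.smul_mem _ _ (ih3 u))) ?_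
        split_ifs
        · exact hl
        · exact zero_mem _
    · have h1 := mul_mem_filt j (ih2 θ hθ)
      by_cases hj : j ∈ L
      · obtain rfl := H.eq_of_mem_log hθ hj
        have h2 := Submodule.smul_mem _ lam h1
        rw [H.pd_log_mul hδ hF j j hj, if_pos rfl, H.G_log_self j hj, List.count_cons_self,
          List.length_cons]
        convert h2 using 1
        rw [mul_sub, mul_smul_comm, pow_succ]
        module
      · have hne : j ≠ θ := fun h => hj (h ▸ hθ)
        have hlt : θ < j := lt_of_le_of_ne (H.isBot θ hθ j) hne.symm
        have hn : ∑ u, F.D.n j θ u • F.pd u (wordProd F.y l) ∈ filt k F.y (j :: l).length := by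
          exact sum_mem fun u _ => Submodule.smul_mem _ _ (ih3 u)
        rw [pd_y_mul hδ hF j θ hj, if_neg hne.symm, add_zero, H.G_log θ hθ j hlt, one_smul,
          List.count_cons_of_ne hne, add_sub_right_comm]
        rw [mul_sub, mul_smul_comm] at h1
        exact add_mem h1 hn

/-- The leading term is the usual derivative of a monomial, times the factors `G_{xs}` of the
letters before `s`. Letters equal to `s` contribute `G_{ss} = 1`, so the exponent really appears as
an integer. The remainder has order below `l.length - 1`. -/
theorem pd_wordProd_sub_mem {l : List I} (hs : l.Pairwise (· ≤ ·)) (hl : ∀ i ∈ l, i ∉ L) {s : I}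
    (hsL : s ∉ L) : F.pd s (wordProd F.y l) -
      ((l.map fun x => if x < s then F.D.G x s else 1).prod * l.count s) •
        wordProd F.y (l.erase s) ∈ filt k F.y (l.length - 1) := by
  induction l with
  | nil =>
    have h : F.pd s (wordProd F.y []) = 0 := by
      rw [wordProd_nil, FormRep.pd_apply, F.δ_one]; rfl
    rw [h]; simp
  | cons j l ih =>
    rw [List.pairwise_cons] at hs
    have hl' : ∀ i ∈ l, i ∉ L := fun i hi => hl i (List.mem_cons_of_mem _ hi)
    have h1 := mul_mem_filt_sub_one j (ih hs.2 hl')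
    have hj := hl j List.mem_cons_self
    have h2 : ∑ u, F.D.n j s u • F.pd u (wordProd F.y l) ∈ filt k F.y l.length := by
      refine sum_mem fun u _ => Submodule.smul_mem _ _ ?_
      obtain ⟨h3, h4⟩ := H.pd_wordProd_mem hδ hF l
      by_cases hu : u ∈ L
      · have := h4 u hu
        rwa [List.count_eq_zero_of_not_mem (fun h => hl' u h hu), pow_zero, sub_self, zero_smul,
          sub_zero] at this
      · exact h3 u hu
    rw [wordProd_cons, pd_y_mul hδ hF j s hj, List.length_cons, Nat.add_sub_cancel, List.map_cons,
      List.prod_cons]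
    rw [mul_sub, mul_smul_comm] at h1
    by_cases hjs : s = j
    · subst hjs
      have hg : (l.map fun x => if x < s then F.D.G x s else 1).prod = 1 := by
        refine List.prod_eq_one fun x hx => ?_
        obtain ⟨z, hz, rfl⟩ := List.mem_map.1 hx
        exact if_neg (not_lt.2 (hs.1 z hz))
      have hle : ((l.count s : ℕ) : k) • (F.y s * wordProd F.y (l.erase s)) =
          ((l.count s : ℕ) : k) • wordProd F.y l := by
        by_cases hm : s ∈ l
        · congr 1
          cases l with
          | nil => simp at hm
          | cons z l =>
            have hz : z = s := by
              rcases List.mem_cons.1 hm with h | h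
              · exact h.symm
              · exact le_antisymm ((List.pairwise_cons.1 hs.2).1 s h) (hs.1 z List.mem_cons_self)
            subst hz
            rw [List.erase_cons_head, wordProd_cons]
        · rw [List.count_eq_zero_of_not_mem hm]; simp
      rw [hg, one_mul, hle] at h1
      rw [hg, if_pos rfl, if_neg (lt_irrefl s), H.G_self s hsL, List.count_cons_self,
        List.erase_cons_head]
      convert add_mem h1 h2 using 1
      push_cast
      module
    · rw [if_neg hjs, List.count_cons_of_ne (Ne.symm hjs), add_zero,
        List.erase_cons_tail (by simpa using Ne.symm hjs), wordProd_cons]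
      rcases lt_or_gt_of_ne hjs with h | h
      · have hm : s ∉ l := fun hm => absurd (hs.1 s hm) (not_le.2 h)
        rw [List.count_eq_zero_of_not_mem hm] at h1 ⊢
        convert add_mem (Submodule.smul_mem _ (F.D.G j s) h1) h2 using 1
        push_cast
        module
      · rw [if_pos h]
        convert add_mem (Submodule.smul_mem _ (F.D.G j s) h1) h2 using 1
        module

variable (hy : R.Holds F.y) (hc : ∀ i j, i < j → R.c i j ≠ 0)
  (b : Module.Basis (Multiset I) k A) (hb : ∀ m, b m = sortedProd F.y m)

include hy hc hb

theorem repr_pd_log {θ : I} (hθ : θ ∈ L) {m m' : Multiset I} (h : m'.card ≤ m.card) :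
    b.repr (F.pd θ (b m')) m = if m' = m then lam ^ m.count θ - 1 else 0 := by
  have h2 := (H.pd_wordProd_mem hδ hF m'.sort).2 θ hθ
  have h3 := coord_filt hy hc b hb h2 (m := m) (by rwa [Multiset.length_sort])
  have hw : wordProd F.y m'.sort = b m' := (hb m').symm
  have hcount : m'.sort.count θ = m'.count θ := by
    conv_rhs => rw [← m'.sort_eq (· ≤ ·), Multiset.coe_count]
  rw [hw, hcount, map_sub, Finsupp.sub_apply, sub_eq_zero, map_smul, Finsupp.smul_apply,
    b.repr_self, smul_eq_mul] at h3
  rw [h3]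
  split_ifs with hm
  · rw [hm, Finsupp.single_eq_same, mul_one]
  · rw [Finsupp.single_eq_of_ne (Ne.symm hm), mul_zero]

theorem repr_pd_of_card_lt {s : I} (hs : s ∉ L) {m m' : Multiset I} (h : m'.card ≤ m.card) :
    b.repr (F.pd s (b m')) m = 0 := by
  have h1 := (H.pd_wordProd_mem hδ hF m'.sort).1 s hs
  rw [hb]
  exact coord_filt hy hc b hb h1 (by rwa [Multiset.length_sort])

theorem repr_pd_erase {s : I} (hs : s ∉ L) {m : Multiset I} (hm : s ∈ m) {m' : Multiset I}
    (hmL : ∀ i ∈ m', i ∉ L) (h : m'.card ≤ m.card) :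
    b.repr (F.pd s (b m')) (m.erase s) = if m' = m then
      (m'.sort.map fun x => if x < s then F.D.G x s else 1).prod * m'.sort.count s else 0 := by
  have hcard : (m.erase s).card + 1 = m.card := by
    rw [Multiset.card_erase_of_mem hm]
    exact Nat.succ_pred_eq_of_pos (Multiset.card_pos_iff_exists_mem.2 ⟨s, hm⟩)
  have h1 := H.pd_wordProd_sub_mem hδ hF (m'.pairwise_sort _)
    (fun i hi => hmL i ((Multiset.mem_sort _).1 hi)) hs
  have h2 := coord_filt hy hc b hb h1 (m := m.erase s) (by rw [Multiset.length_sort]; omega)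
  have h3 : wordProd F.y (m'.sort.erase s) = b (m'.erase s) := by
    rw [hb, ← sortedProd_coe _ ((m'.pairwise_sort _).erase s), ← Multiset.coe_erase,
      Multiset.sort_eq]
  have hw : wordProd F.y m'.sort = b m' := (hb m').symm
  rw [h3, hw, map_sub, Finsupp.sub_apply, sub_eq_zero, map_smul, Finsupp.smul_apply, b.repr_self,
    smul_eq_mul] at h2
  rw [h2]
  split_ifs with hmm
  · rw [hmm, Finsupp.single_eq_same, mul_one]
  · by_cases hsm : s ∈ m'
    · rw [Finsupp.single_eq_of_ne, mul_zero]
      intro h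
      rw [← Multiset.cons_erase hsm, ← Multiset.cons_erase hm, h] at hmm
      exact hmm rfl
    · rw [List.count_eq_zero_of_not_mem (by simpa using hsm), Nat.cast_zero, mul_zero, zero_mul]

omit H hδ hF hy hc hb [Fintype I] [LinearOrder I] in
theorem repr_apply_eq_sum (b : Module.Basis (Multiset I) k A) (f : A →ₗ[k] A) (a : A)
    (m : Multiset I) : b.repr (f a) m =
      ∑ m' ∈ (b.repr a).support, b.repr a m' * b.repr (f (b m')) m := by
  conv_lhs => rw [← b.linearCombination_repr a, Finsupp.linearCombination_apply, Finsupp.sum]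
  simp [Finsupp.finsetSum_apply]

/-- In characteristic zero only the scalars have zero differential. -/
theorem exists_eq_algebraMap [CharZero k] {a : A} (ha : ∀ s, F.pd s a = 0) :
    ∃ c : k, a = algebraMap k A c := by
  by_cases hsupp : ∀ m ∈ (b.repr a).support, m = 0
  · refine ⟨b.repr a 0, b.repr.injective ?_⟩
    rw [Algebra.algebraMap_eq_smul_one, map_smul, ← sortedProd_zero F.y, ← hb, b.repr_self]
    ext m
    rw [Finsupp.smul_apply, smul_eq_mul]
    by_cases hm : m = 0
    · subst hm; simp
    · rw [Finsupp.single_eq_of_ne hm, mul_zero]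
      by_contra h
      exact hm (hsupp m (Finsupp.mem_support_iff.2 h))
  push Not at hsupp
  obtain ⟨m₀, hm₀, hne⟩ := hsupp
  -- A monomial of maximal length in `a`; its image under a partial derivative cannot be cancelled
  -- by the other monomials.
  obtain ⟨m, hm, hmax⟩ := Finset.exists_max_image (b.repr a).support Multiset.card ⟨m₀, hm₀⟩
  -- Monomials of top length contain no logarithmic letter: otherwise the eigenvalue `lam ^ count -
  -- 1` would be nonzero.
  have hlog (m' : Multiset I) (hm' : m' ∈ (b.repr a).support) (hcard : m'.card = m.card) (θ : I)
      (hθ : θ ∈ m') : θ ∉ L := by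
    intro hθL
    have h0 := repr_apply_eq_sum b (F.pd θ) a m'
    rw [ha θ, map_zero, Finsupp.zero_apply, Finset.sum_eq_single m',
      H.repr_pd_log hδ hF hy hc b hb hθL
      le_rfl, if_pos rfl] at h0
    · refine mul_ne_zero (Finsupp.mem_support_iff.1 hm') (sub_ne_zero.2 (H.lam_ne _ ?_)) h0.symm
      exact Multiset.count_ne_zero.2 hθ
    · intro m'' hm'' hne
      rw [H.repr_pd_log hδ hF hy hc b hb hθL (hcard ▸ hmax m'' hm''), if_neg hne, mul_zero]
    · exact fun h => absurd hm' h
  have hm_ne : m ≠ 0 := by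
    rintro rfl
    have := hmax m₀ hm₀
    rw [Multiset.card_zero, Nat.le_zero, Multiset.card_eq_zero] at this
    exact hne this
  obtain ⟨s, hs⟩ := Multiset.exists_mem_of_ne_zero hm_ne
  have hsL := hlog m hm rfl s hs
  have hcard : (m.erase s).card + 1 = m.card := by
    rw [Multiset.card_erase_of_mem hs]
    exact Nat.succ_pred_eq_of_pos (Multiset.card_pos_iff_exists_mem.2 ⟨s, hs⟩)
  -- The coefficient at `m.erase s` comes from `m` alone: shorter monomials drop too low, and a
  -- different top monomial would have to agree with `m` after removal of `s`.
  have h0 := repr_apply_eq_sum b (F.pd s) a (m.erase s)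
  rw [ha s, map_zero, Finsupp.zero_apply, Finset.sum_eq_single m,
    H.repr_pd_erase hδ hF hy hc b hb hsL hs (hlog m hm rfl) le_rfl, if_pos rfl] at h0
  · refine absurd h0.symm (mul_ne_zero (Finsupp.mem_support_iff.1 hm) (mul_ne_zero ?_ ?_))
    · refine List.prod_ne_zero fun h => ?_
      obtain ⟨z, -, hz⟩ := List.mem_map.1 h
      split_ifs at hz with h
      · exact F.G_ne_zero _ _ hz
      · exact one_ne_zero hz
    · rw [Nat.cast_ne_zero, Ne, List.count_eq_zero, Multiset.mem_sort, not_not]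
      exact hs
  · intro m' hm' hne
    rcases (hmax m' hm').lt_or_eq with hlt | heq
    · rw [H.repr_pd_of_card_lt hδ hF hy hc b hb hsL (by omega), mul_zero]
    · rw [H.repr_pd_erase hδ hF hy hc b hb hsL hs (hlog m' hm' heq) heq.le, if_neg hne, mul_zero]
  · exact fun h => absurd hm h

end FormData.HasDifferential

/-- An algebra with a monomial basis and quadratic relations that has a compatible system of
structure constants of forms has a connected integrable calculus. -/
theorem FormData.HasDifferential.exists_calculus {k : Type v} [Field k] [CharZero k] {I : Type}
    [LinearOrder I] [Fintype I] {A : Type u} [Ring A] [Algebra k A] {D : FormData k I}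
    {R : QuadRel k I} {L : Set I} {lam : k} (H : D.HasDifferential R L lam) (hD : D.Compatible R)
    {y : I → A} (hy : R.Holds y) (hc : ∀ i j, i < j → R.c i j ≠ 0)
    (b : Module.Basis (Multiset I) k A) (hb : ∀ m, b m = sortedProd y m) {N : ℕ}
    (hN : N + 1 + 1 = Fintype.card I) (ho : Odd (Fintype.card I)) :
    ∃ C : DifferentialCalculus k A, C.IsConnected ∧ C.IsIntegrable (Fintype.card I) := by
  obtain ⟨F, rfl, rfl, hΦ, hδ⟩ := H.exists_formRep hD hy hc b hb
  have hF := H.isClosed hδ hΦ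
  have : Nontrivial A := ⟨b 0, 0, b.ne_zero 0⟩
  refine ⟨hF.calculus, fun a => ⟨fun ha => ?_, ?_⟩, hF.isIntegrable hN ho⟩
  · refine H.exists_eq_algebraMap hδ hF hy hc b hb fun s => ?_
    have h1 : hF.dA a = 0 := (hF.d_coeff a).symm.trans ha
    have h2 : F.δ a = 0 := congrArg Subtype.val h1
    rw [FormRep.pd_apply, h2]; rfl
  · rintro ⟨c, rfl⟩
    have h1 : hF.dA (algebraMap k A c) = 0 := Subtype.ext (F.δ_algebraMap c)
    exact (hF.d_coeff _).trans h1

end ColorExt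

/-! ### The Gelfand–Kirillov dimension. -/

namespace QuadRel

section

variable {k I : Type*} [Field k] {A : Type*} [Ring A] [Algebra k A] {y : I → A}

theorem filt_mul_le (a b : ℕ) :
    filt k y (a + 1) * filt k y (b + 1) ≤ filt k y (a + b + 1) := by
  rw [filt, filt, Submodule.span_mul_span, Submodule.span_le]
  rintro _ ⟨_, ⟨l, hl, rfl⟩, _, ⟨l', hl', rfl⟩, rfl⟩
  change wordProd y l * wordProd y l' ∈ _
  rw [← wordProd_append]
  refine wordProd_mem_filt ?_
  have h1 : l.length < a + 1 := hl
  have h2 : l'.length < b + 1 := hl'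
  rw [List.length_append]
  omega

theorem one_mem_filt (n : ℕ) : (1 : A) ∈ filt k y (n + 1) := by
  rw [← wordProd_nil y]; exact wordProd_mem_filt (by simp)

theorem pow_le_filt {V : Submodule k A} {d : ℕ} (hV : V ≤ filt k y (d + 1)) (n : ℕ) :
    (1 ⊔ V) ^ n ≤ filt k y (d * n + 1) := by
  induction n with
  | zero => rw [pow_zero, Submodule.one_le]; exact one_mem_filt _
  | succ n ih =>
    rw [pow_succ]
    refine (mul_le_mul' ih (sup_le ?_ hV)).trans (filt_mul_le _ _)
    exact Submodule.one_le.2 (one_mem_filt _)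

theorem wordProd_mem_pow (n : ℕ) (l : List I) (hl : l.length ≤ n) :
    wordProd y l ∈ (1 ⊔ Submodule.span k (Set.range y)) ^ n := by
  induction n generalizing l with
  | zero =>
    rw [List.length_eq_zero_iff.1 (Nat.le_zero.1 hl), wordProd_nil, pow_zero]
    exact Submodule.one_le.1 le_rfl
  | succ n ih =>
    rw [pow_succ']
    cases l with
    | nil =>
      rw [wordProd_nil, ← one_mul (1 : A)]
      exact Submodule.mul_mem_mul (Submodule.mem_sup_left (Submodule.one_le.1 le_rfl))
        (ih [] (by simp))
    | cons i l =>
      rw [wordProd_cons]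
      exact Submodule.mul_mem_mul (Submodule.mem_sup_right (Submodule.subset_span ⟨i, rfl⟩))
        (ih l (by simpa using hl))

end

variable {k I : Type*} [Field k] [LinearOrder I] [Fintype I] {R : QuadRel k I}
  {A : Type*} [Ring A] [Algebra k A] {y : I → A}

/-- An ordered monomial of length less than `n` has all its exponents less than `n`. -/
theorem finrank_filt_le (h : R.Holds y) (hc : ∀ i j, i < j → R.c i j ≠ 0) (n : ℕ) :
    Module.finrank k (filt k y n) ≤ n ^ Fintype.card I := by
  have hle : filt k y n ≤ Submodule.span k (Set.range fun f : I → Fin n =>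
      sortedProd y (∑ i, Multiset.replicate (f i) i)) := by
    rw [filt_eq_span_sorted h hc]
    refine Submodule.span_mono ?_
    rintro _ ⟨m, hm, rfl⟩
    refine ⟨fun i => ⟨m.count i, (Multiset.count_le_card i m).trans_lt hm⟩, ?_⟩
    change sortedProd y (∑ i, Multiset.replicate (m.count i) i) = _
    congr 1
    ext j
    rw [Multiset.count_sum', Finset.sum_eq_single j] <;>
      simp +contextual [Multiset.count_replicate]
  have : Module.Finite k (Submodule.span k (Set.range fun f : I → Fin n =>
      sortedProd y (∑ i, Multiset.replicate (f i) i))) :=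
    Module.Finite.span_of_finite k (Set.finite_range _)
  refine (Submodule.finrank_mono hle).trans ((finrank_range_le_card _).trans ?_)
  simp

/-- The independent monomials with all exponents at most `N` have length at most `N * card I`. -/
theorem pow_le_finrank (b : Module.Basis (Multiset I) k A) (hb : ∀ m, b m = sortedProd y m)
    (N n : ℕ) (hn : N * Fintype.card I ≤ n) : (N + 1) ^ Fintype.card I ≤
      Module.finrank k ↥((1 ⊔ Submodule.span k (Set.range y)) ^ n) := by
  have hV : ((1 : Submodule k A) ⊔ Submodule.span k (Set.range y)).FG :=
    Submodule.FG.sup (Submodule.one_eq_span (R := k) (A := A) ▸ Submodule.fg_span_singleton 1)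
      (Submodule.fg_span (Set.finite_range y))
  have : Module.Finite k ↥((1 ⊔ Submodule.span k (Set.range y)) ^ n) :=
    Module.Finite.iff_fg.2 (hV.pow n)
  have hinj : Function.Injective fun f : I → Fin (N + 1) =>
      ∑ i, Multiset.replicate (f i : ℕ) i := by
    intro f g hfg
    ext j
    have hcount (f : I → Fin (N + 1)) :
        (∑ i, Multiset.replicate (f i : ℕ) i).count j = f j := by
      rw [Multiset.count_sum', Finset.sum_eq_single j] <;>
        simp +contextual [Multiset.count_replicate]
    rw [← hcount f, ← hcount g]
    exact congrArg _ hfg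
  have hmem (f : I → Fin (N + 1)) : b (∑ i, Multiset.replicate (f i : ℕ) i) ∈
      (1 ⊔ Submodule.span k (Set.range y)) ^ n := by
    rw [hb]
    refine wordProd_mem_pow n _ ?_
    rw [Multiset.length_sort, Multiset.card_sum]
    simp only [Multiset.card_replicate]
    refine (Finset.sum_le_card_nsmul _ _ N fun i _ => Nat.lt_succ_iff.1 (f i).2).trans ?_
    rw [smul_eq_mul, Finset.card_univ, mul_comm]
    exact hn
  have hli : LinearIndependent k fun f : I → Fin (N + 1) =>
      (⟨b (∑ i, Multiset.replicate (f i : ℕ) i), hmem f⟩ :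
        ↥((1 ⊔ Submodule.span k (Set.range y)) ^ n)) := by
    refine LinearIndependent.of_comp (Submodule.subtype _) ?_
    exact b.linearIndependent.comp _ hinj
  have := hli.fintype_card_le_finrank
  simpa using this

end QuadRel

open QuadRel in
/-- The Gelfand–Kirillov dimension of an algebra with quadratic relations and a basis of ordered
monomials is the number of its generators. -/
theorem gkDim_eq_card {k : Type v} [Field k] {I : Type*} [LinearOrder I] [Fintype I] [Nonempty I]
    {A : Type u} [Ring A] [Algebra k A] {R : QuadRel k I} {y : I → A} (h : R.Holds y)
    (hc : ∀ i j, i < j → R.c i j ≠ 0) (b : Module.Basis (Multiset I) k A)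
    (hb : ∀ m, b m = sortedProd y m) :
    gkDim k A = ((Fintype.card I : ℝ) : EReal) := by
  have hlog : Tendsto (fun n : ℕ => Real.log n) atTop atTop :=
    Real.tendsto_log_atTop.comp tendsto_natCast_atTop_atTop
  have hlim (C : ℝ) : Tendsto (fun n : ℕ => ((Fintype.card I * (1 + C / Real.log n) : ℝ) : EReal))
      atTop (nhds ((Fintype.card I : ℝ) : EReal)) := by
    refine (continuous_coe_real_ereal.tendsto _).comp ?_
    have := ((tendsto_const_nhds (x := C)).div_atTop hlog).const_add 1 |>.const_mul
      (Fintype.card I : ℝ)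
    simpa using this
  apply le_antisymm
  · refine iSup_le fun V => ?_
    obtain ⟨V, s, rfl⟩ := V
    choose d hd using fun a : A => exists_mem_filt b hb a
    have hV : Submodule.span k (s : Set A) ≤ filt k y (s.sup d + 1) :=
      Submodule.span_le.2 fun a ha => filt_mono ((Finset.le_sup ha).trans (Nat.le_succ _)) (hd a)
    -- With `D = s.sup d`, the powers satisfy `dim ≤ ((D + 1) n) ^ card I`; dividing the logarithm
    -- by `log n` leaves `card I * (1 + log (D + 1) / log n)`.
    refine (limsup_le_limsup ?_).trans_eq (hlim (Real.log (s.sup d + 1))).limsup_eq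
    filter_upwards [eventually_ge_atTop 2] with n hn
    rw [EReal.coe_le_coe_iff]
    have hn' : (2 : ℝ) ≤ n := by exact_mod_cast hn
    have hpos : 0 < Real.log n := Real.log_pos (by linarith)
    have hfin : Module.Finite k (filt k y (s.sup d * n + 1)) :=
      Module.Finite.span_of_finite k ((List.finite_length_lt I _).image _)
    have hdim : Module.finrank k ↥((1 ⊔ Submodule.span k (s : Set A)) ^ n) ≤
        ((s.sup d + 1) * n) ^ Fintype.card I := by
      refine (Submodule.finrank_mono (pow_le_filt hV n)).trans
        ((finrank_filt_le h hc _).trans (Nat.pow_le_pow_left ?_ _))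
      rw [add_mul, one_mul]; omega
    rw [div_le_iff₀ hpos]
    rcases Nat.eq_zero_or_pos (Module.finrank k ↥((1 ⊔ Submodule.span k (s : Set A)) ^ n)) with
      h0 | h0
    · rw [h0, Nat.cast_zero, Real.log_zero]
      have : 0 ≤ Real.log ((s.sup d : ℕ) + 1 : ℝ) :=
        Real.log_nonneg (by linarith [Nat.cast_nonneg (α := ℝ) (s.sup d)])
      positivity
    · have h1 : Real.log (Module.finrank k ↥((1 ⊔ Submodule.span k (s : Set A)) ^ n)) ≤
          Real.log ((((s.sup d : ℕ) + 1) * n : ℝ) ^ Fintype.card I) :=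
        Real.log_le_log (by exact_mod_cast h0) (by exact_mod_cast hdim)
      refine h1.trans_eq ?_
      rw [Real.log_pow, Real.log_mul (by positivity) (by positivity)]
      field_simp
      ring
  · refine le_trans ?_ (le_iSup _ ⟨Submodule.span k (Set.range y),
      Submodule.fg_span (Set.finite_range y)⟩)
    refine (hlim (-Real.log (Fintype.card I))).limsup_eq.symm.trans_le (limsup_le_limsup ?_)
    filter_upwards [eventually_ge_atTop 2] with n hn
    rw [EReal.coe_le_coe_iff]
    have hn' : (2 : ℝ) ≤ n := by exact_mod_cast hn
    have hpos : 0 < Real.log n := Real.log_pos (by linarith)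
    have hI : 0 < Fintype.card I := Fintype.card_pos
    have hI' : (0 : ℝ) < Fintype.card I := by exact_mod_cast hI
    -- The largest uniform exponent allowed by length `n`; adding one to it makes up for the
    -- rounding in the division.
    have hdim := pow_le_finrank b hb (n / Fintype.card I) n (Nat.div_mul_le_self _ _)
    have h2 : (n : ℝ) / Fintype.card I ≤ (n / Fintype.card I : ℕ) + 1 :=
        (Nat.lt_floor_add_one _).le.trans_eq (by rw [Nat.floor_div_eq_div])
    rw [le_div_iff₀ hpos]
    have h1 : Real.log (((n : ℝ) / Fintype.card I) ^ Fintype.card I) ≤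
        Real.log (Module.finrank k ↥((1 ⊔ Submodule.span k (Set.range y)) ^ n)) := by
      refine Real.log_le_log (by positivity) ((pow_le_pow_left₀ (by positivity) h2 _).trans ?_)
      exact_mod_cast hdim
    refine le_trans (le_of_eq ?_) h1
    rw [Real.log_pow, Real.log_div (by positivity) (by positivity)]
    field_simp
    ring

/-! ### The five generators and their structure constants. -/

/-- The generators `t₁ < t₂ < x₁ < x₂ < x₃`. -/
abbrev Gen : Type := Fin 2 ⊕ₗ Fin 3

namespace Gen

/-- The generator `t_l`. -/
def t (l : Fin 2) : Gen := toLex (.inl l)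

/-- The generator `x_i`. -/
def x (i : Fin 3) : Gen := toLex (.inr i)

theorem forall_iff {p : Gen → Prop} : (∀ g, p g) ↔ (∀ l, p (t l)) ∧ ∀ i, p (x i) := by
  refine ⟨fun h => ⟨fun l => h _, fun i => h _⟩, fun h g => ?_⟩
  obtain ⟨g, rfl⟩ := toLex.surjective g
  rcases g with l | i
  · exact h.1 l
  · exact h.2 i

theorem cases (g : Gen) : (∃ l, g = t l) ∨ ∃ i, g = x i := by
  revert g
  rw [forall_iff]
  exact ⟨fun l => .inl ⟨l, rfl⟩, fun i => .inr ⟨i, rfl⟩⟩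

theorem sum_eq {M : Type*} [AddCommMonoid M] (f : Gen → M) :
    ∑ g, f g = ∑ l, f (t l) + ∑ i, f (x i) := by
  rw [← toLex.sum_comp, Fintype.sum_sum_type]; rfl

@[simp] theorem t_lt_t {l m : Fin 2} : t l < t m ↔ l < m := Sum.Lex.inl_lt_inl_iff

@[simp] theorem x_lt_x {i j : Fin 3} : x i < x j ↔ i < j := Sum.Lex.inr_lt_inr_iff

@[simp] theorem t_lt_x {l : Fin 2} {i : Fin 3} : t l < x i := Sum.Lex.inl_lt_inr _ _

@[simp] theorem not_x_lt_t {l : Fin 2} {i : Fin 3} : ¬ x i < t l := Sum.Lex.not_inr_lt_inl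

@[simp] theorem t_inj {l m : Fin 2} : t l = t m ↔ l = m := by simp [t]

@[simp] theorem x_inj {i j : Fin 3} : x i = x j ↔ i = j := by simp [x]

@[simp] theorem t_ne_x {l : Fin 2} {i : Fin 3} : t l ≠ x i := by simp [t, x]

@[simp] theorem x_ne_t {l : Fin 2} {i : Fin 3} : x i ≠ t l := by simp [t, x]

end Gen

/-- Structure constants of the relations `x_i t_l = a_{il} t_l x_i + b_{il} x_i + p_i` and
`x_j x_i = c_{ij} x_i x_j + κ_{ij} + ∑ q_{ij}^m x_m`. -/
structure SkewParams (k : Type*) where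
  a : Fin 3 → Fin 2 → k
  b : Fin 3 → Fin 2 → k
  p : Fin 3 → k
  c : Fin 3 → Fin 3 → k
  κ : Fin 3 → Fin 3 → k
  q : Fin 3 → Fin 3 → Fin 3 → k

namespace SkewParams

variable {k : Type*} [Field k] (P : SkewParams k)

/-- Consequences of the existence of a monomial basis and of the compatibility relations. -/
structure Consistent : Prop where
  a_ne_zero : ∀ i l, P.a i l ≠ 0
  c_self : ∀ i, P.c i i = 1
  c_mul : ∀ i j, P.c i j * P.c j i = 1
  q_self : ∀ i m, P.q i i m = 0
  q_swap : ∀ i j m, P.q j i m = -P.c j i * P.q i j m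
  b_a : ∀ s i l, P.b s l * (P.a i l - 1) = 0
  q_c : ∀ i j m s, P.q i j m * (P.c s i * P.c s j - P.c s m) = 0
  q_diag_a : ∀ s i l, P.q s i s * (P.a i l - 1) = 0
  q_a : ∀ i j m l, P.q i j m * (P.a i l * P.a j l - P.a m l) = 0
  q_b : ∀ i j m l, m ≠ i → m ≠ j → P.q i j m * (P.b m l - P.b i l - P.b j l) = 0
  κ_a : ∀ i j l, i < j → P.κ i j * (P.a i l * P.a j l - 1) = 0
  κ_c : ∀ i j s, i < j → P.κ i j * (P.c s i * P.c s j - 1) = 0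
  p_c : ∀ s i l, P.p i * (P.c s i - P.a s l) = P.b i l * P.q s i s
  p_a : ∀ i l, P.p i * (P.a i l - 1) = 0
  q_p : ∀ i j l, i < j →
    ∑ m, P.q i j m * P.p m = (P.a i l * P.b j l + P.b i l) * P.κ i j
  q_q : ∀ i j s, ∑ m, P.q i j m * P.q s m s = 0
  q_q_zero : ∀ i j, P.q 0 1 1 * P.q i j 0 = 0
  q_q_two : ∀ i j, P.q 1 2 1 * P.q i j 2 = 0

/-- The defining relations as a system of quadratic relations. -/
def rel : QuadRel k Gen where
  c g h := match ofLex g, ofLex h with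
    | .inl _, .inl _ => 1
    | .inl l, .inr i => P.a i l
    | .inr i, .inl l => (P.a i l)⁻¹
    | .inr i, .inr j => P.c i j
  κ g h := match ofLex g, ofLex h with
    | .inl _, .inr i => P.p i
    | .inr i, .inr j => P.κ i j
    | _, _ => 0
  q g h m := match ofLex g, ofLex h, ofLex m with
    | .inl l, .inr i, .inr m => if m = i then P.b i l else 0
    | .inr i, .inr j, .inr m => P.q i j m
    | _, _, _ => 0

section rel

variable (l l' l'' : Fin 2) (i j m : Fin 3)

open Gen

@[simp] theorem rel_c_tt : P.rel.c (t l) (t l') = 1 := rfl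
@[simp] theorem rel_c_tx : P.rel.c (t l) (x i) = P.a i l := rfl
@[simp] theorem rel_c_xx : P.rel.c (x i) (x j) = P.c i j := rfl
@[simp] theorem rel_κ_tt : P.rel.κ (t l) (t l') = 0 := rfl
@[simp] theorem rel_κ_tx : P.rel.κ (t l) (x i) = P.p i := rfl
@[simp] theorem rel_κ_xx : P.rel.κ (x i) (x j) = P.κ i j := rfl
@[simp] theorem rel_q_tt (g : Gen) : P.rel.q (t l) (t l') g = 0 := rfl
@[simp] theorem rel_q_t (g h : Gen) : P.rel.q g h (t l) = 0 := by
  revert g h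
  simp only [Gen.forall_iff]
  exact ⟨fun _ => ⟨fun _ => rfl, fun _ => rfl⟩, fun _ => ⟨fun _ => rfl, fun _ => rfl⟩⟩
@[simp] theorem rel_q_txx : P.rel.q (t l) (x i) (x m) = if m = i then P.b i l else 0 := rfl
@[simp] theorem rel_q_xxx : P.rel.q (x i) (x j) (x m) = P.q i j m := rfl

end rel

/-- Conditions on the matrices `N i` under which `x_i e_s = ± e_s x_i + ∑_r N i r s e_r` defines a
bimodule of forms. -/
structure IsFormMatrix (N : Fin 3 → Fin 3 → Fin 3 → k) : Prop where
  swap : ∀ i j r, i < j → N j r i - P.c i j * N i r j = P.q i j r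
  c : ∀ i j r s, N i r s * (P.c i j * P.c s j - P.c r j) = 0
  a : ∀ i l r s, N i r s * (P.a i l * P.a s l - P.a r l) = 0
  diag : ∀ j l s, P.b j l * (N j s s - P.q s j s) = 0
  b : ∀ j l r s, r ≠ s → N j r s * (P.b r l - P.b s l - P.b j l) = 0
  comm : ∀ i j r s, i < j →
    ∑ u, (N j r u * N i u s - P.c i j * (N i r u * N j u s)) = ∑ m, P.q i j m * N m r s

/-- The structure constants of forms with `d t_l` and `d x_i` as a basis. -/
def formData (N : Fin 3 → Fin 3 → Fin 3 → k) : ColorExt.FormData k Gen where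
  G g h := match ofLex g, ofLex h with
    | .inl _, .inl _ => 1
    | .inl l, .inr s => (P.a s l)⁻¹
    | .inr i, .inl l => P.a i l
    | .inr i, .inr s => P.c s i
  ε g h := match ofLex g, ofLex h with
    | .inl _, .inl _ => 1
    | .inl l, .inr s => (P.a s l)⁻¹
    | .inr i, .inl l => P.a i l
    | .inr i, .inr s => P.c s i
  n g r s := match ofLex g, ofLex r, ofLex s with
    | .inl l, .inr r, .inr s => if r = s then -P.b s l / P.a s l else 0
    | .inr i, .inr r, .inr s => N i r s
    | _, _, _ => 0

section formData

variable (N : Fin 3 → Fin 3 → Fin 3 → k) (l l' l'' : Fin 2) (i j r s : Fin 3)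

open Gen

@[simp] theorem formData_G_tt : (P.formData N).G (t l) (t l') = 1 := rfl
@[simp] theorem formData_G_tx : (P.formData N).G (t l) (x s) = (P.a s l)⁻¹ := rfl
@[simp] theorem formData_G_xt : (P.formData N).G (x i) (t l) = P.a i l := rfl
@[simp] theorem formData_G_xx : (P.formData N).G (x i) (x s) = P.c s i := rfl
@[simp] theorem formData_ε : (P.formData N).ε = (P.formData N).G := rfl
@[simp] theorem formData_n_txx : (P.formData N).n (t l) (x r) (x s) =
  if r = s then -P.b s l / P.a s l else 0 := rfl
@[simp] theorem formData_n_xxx : (P.formData N).n (x i) (x r) (x s) = N i r s := rfl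
@[simp] theorem formData_n_right (g h : Gen) : (P.formData N).n g h (t l) = 0 := by
  revert g h
  simp only [Gen.forall_iff]
  exact ⟨fun _ => ⟨fun _ => rfl, fun _ => rfl⟩, fun _ => ⟨fun _ => rfl, fun _ => rfl⟩⟩
@[simp] theorem formData_n_left (g h : Gen) : (P.formData N).n g (t l) h = 0 := by
  revert g h
  simp only [Gen.forall_iff]
  exact ⟨fun _ => ⟨fun _ => rfl, fun _ => rfl⟩, fun _ => ⟨fun _ => rfl, fun _ => rfl⟩⟩

end formData

variable {P} {N : Fin 3 → Fin 3 → Fin 3 → k}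

namespace Consistent

variable (hP : P.Consistent)

include hP

theorem c_ne_zero (i j : Fin 3) : P.c i j ≠ 0 := left_ne_zero_of_mul_eq_one (hP.c_mul i j)

/-- For each `l` either no `x_i` shifts `t_l` or no `x_s` scales it. This dichotomy settles most of
the identities involving both `a` and `b`. -/
theorem b_eq_zero_or (i : Fin 3) (l : Fin 2) : P.b i l = 0 ∨ ∀ s, P.a s l = 1 := by
  by_cases h : P.b i l = 0
  · exact .inl h
  · exact .inr fun s => sub_eq_zero.1 ((mul_eq_zero.1 (hP.b_a i s l)).resolve_left h)

theorem rel_c_ne_zero (g h : Gen) : P.rel.c g h ≠ 0 := by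
  revert g h
  simp only [Gen.forall_iff]
  exact ⟨fun l => ⟨fun l' => one_ne_zero, fun i => hP.a_ne_zero i l⟩,
    fun i => ⟨fun l => inv_ne_zero (hP.a_ne_zero i l), fun j => hP.c_ne_zero i j⟩⟩

/-- The rule for `t_l dx_s` results from differentiating `x_s t_l = a t_l x_s + b x_s + p` and
splitting the result into a part with `dt_l` and a part with `dx_s`. -/
theorem formData_compatible (hN : P.IsFormMatrix N) : (P.formData N).Compatible P.rel where
  eps_self := by
    simp only [Gen.forall_iff]
    exact ⟨fun l => rfl, hP.c_self⟩
  eps_swap := by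
    simp only [Gen.forall_iff, formData_ε]
    refine ⟨fun l => ⟨fun l' => ?_, fun i => ?_⟩, fun i => ⟨fun l => ?_, fun j => ?_⟩⟩
    · simp
    · simp [hP.a_ne_zero]
    · simp [hP.a_ne_zero]
    · simp [hP.c_mul]
  G_ne_zero := by
    simp only [Gen.forall_iff]
    refine ⟨fun l => ⟨fun l' => ?_, fun i => ?_⟩, fun i => ⟨fun l => ?_, fun j => ?_⟩⟩
    · simp
    · simp [hP.a_ne_zero]
    · simp [hP.a_ne_zero]
    · simp [hP.c_ne_zero]
  ext := by
    intro j r s u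
    rcases j.cases with ⟨l, rfl⟩ | ⟨j, rfl⟩ <;> rcases r.cases with ⟨r, rfl⟩ | ⟨r, rfl⟩ <;>
      rcases s.cases with ⟨s, rfl⟩ | ⟨s, rfl⟩ <;> rcases u.cases with ⟨u, rfl⟩ | ⟨u, rfl⟩ <;>
      simp only [formData_ε, formData_n_left, formData_n_right, zero_mul, formData_n_txx,
        formData_n_xxx, formData_G_tt, formData_G_tx, formData_G_xt, formData_G_xx]
    · split_ifs with h
      · subst h; simp [hP.a_ne_zero]
      · rw [zero_mul]
    · split_ifs with h
      · subst h
        rw [hP.c_mul]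
        rcases hP.b_eq_zero_or r l with h | h <;> simp [h]
      · rw [zero_mul]
    · by_cases h0 : N j r s = 0
      · rw [h0, zero_mul]
      · rw [← sub_eq_zero.1 ((mul_eq_zero.1 (hN.a j u r s)).resolve_left h0)]
        have := hP.a_ne_zero s u
        field_simp
        ring
    · by_cases h0 : N j r s = 0
      · rw [h0, zero_mul]
      · have h1 := sub_eq_zero.1 ((mul_eq_zero.1 (hN.c j u r s)).resolve_left h0)
        have h2 := hP.c_mul j u
        have h3 := hP.c_mul r u
        linear_combination
          N j r s * (P.c u r * P.c s u * h2 - P.c u j * P.c u r * h1 - P.c u j * h3)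
  lin := by
    intro i j m s hij
    rcases i.cases with ⟨l, rfl⟩ | ⟨i, rfl⟩ <;> rcases j.cases with ⟨j, rfl⟩ | ⟨j, rfl⟩ <;>
      rcases m.cases with ⟨m, rfl⟩ | ⟨m, rfl⟩ <;> rcases s.cases with ⟨s, rfl⟩ | ⟨s, rfl⟩ <;>
      simp only [rel_q_tt, rel_q_t, rel_q_txx, rel_q_xxx, zero_mul, Gen.not_x_lt_t,
        formData_G_tt, formData_G_tx, formData_G_xt, formData_G_xx] at hij ⊢
    · split_ifs with h
      · subst h; simp
      · rw [zero_mul]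
    · split_ifs with h
      · subst h
        rcases hP.b_eq_zero_or m l with h | h <;> simp [h]
      · rw [zero_mul]
    · exact hP.q_a i j m s
    · exact hP.q_c i j m s
  off_left := by
    intro i j r s hij
    rcases i.cases with ⟨l, rfl⟩ | ⟨i, rfl⟩ <;> rcases j.cases with ⟨j, rfl⟩ | ⟨j, rfl⟩ <;>
      rcases r.cases with ⟨r, rfl⟩ | ⟨r, rfl⟩ <;> rcases s.cases with ⟨s, rfl⟩ | ⟨s, rfl⟩ <;>
      simp only [formData_n_left, formData_n_right, zero_mul, formData_n_txx, rel_c_tt, rel_c_tx,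
        rel_c_xx, Gen.not_x_lt_t,
        formData_n_xxx, formData_G_tt, formData_G_tx, formData_G_xt, formData_G_xx] at hij ⊢
    · split_ifs with h
      · subst h; simp
      · rw [zero_mul]
    · split_ifs with h
      · subst h
        rcases hP.b_eq_zero_or r l with h | h <;> simp [h]
      · rw [zero_mul]
    · linear_combination -hN.c i j r s
  off_right := by
    intro i j r s hij
    rcases i.cases with ⟨l, rfl⟩ | ⟨i, rfl⟩ <;> rcases j.cases with ⟨j, rfl⟩ | ⟨j, rfl⟩ <;>
      rcases r.cases with ⟨r, rfl⟩ | ⟨r, rfl⟩ <;> rcases s.cases with ⟨s, rfl⟩ | ⟨s, rfl⟩ <;>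
      simp only [formData_n_left, formData_n_right, zero_mul, formData_n_txx, rel_c_tt, rel_c_tx,
        rel_c_xx, Gen.not_x_lt_t,
        formData_n_xxx, formData_G_tt, formData_G_tx, formData_G_xt, formData_G_xx] at hij ⊢
    · split_ifs with h
      · subst h; simp
      · rw [zero_mul]
    · by_cases h0 : N j r s = 0
      · rw [h0, zero_mul]
      · rw [← sub_eq_zero.1 ((mul_eq_zero.1 (hN.a j l r s)).resolve_left h0)]
        have := hP.a_ne_zero s l
        have := hP.a_ne_zero j l
        field_simp
        ring
    · linear_combination P.c i j * hN.c j i r s - N j r s * P.c s i * hP.c_mul i j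
  const := by
    intro i j r s hij
    rcases i.cases with ⟨l, rfl⟩ | ⟨i, rfl⟩ <;> rcases j.cases with ⟨j, rfl⟩ | ⟨j, rfl⟩ <;>
      rcases r.cases with ⟨r, rfl⟩ | ⟨r, rfl⟩ <;> rcases s.cases with ⟨s, rfl⟩ | ⟨s, rfl⟩ <;>
      simp only [Gen.sum_eq, formData_n_left, formData_n_right, zero_mul, mul_zero, sub_zero,
        formData_n_txx, rel_c_tt, rel_c_tx, rel_c_xx, Gen.not_x_lt_t, rel_κ_tt, rel_κ_tx, rel_κ_xx,
        formData_n_xxx, formData_G_tt, formData_G_tx, formData_G_xt, formData_G_xx,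
        Finset.sum_const_zero, zero_add, add_zero, Gen.t_ne_x, Gen.x_ne_t, if_false, ite_self,
        Gen.t_inj, Gen.x_inj, rel_q_tt, rel_q_t, rel_q_txx, rel_q_xxx] at hij ⊢
    · simp only [ite_mul, mul_ite, zero_mul, mul_zero, one_mul, Finset.sum_sub_distrib,
        Finset.sum_ite_eq', Finset.mem_univ, if_true]
      split_ifs with h
      · subst h; ring
      · ring
    · split_ifs
      · rw [one_mul, hP.p_a]
      · rfl
    · have h1 : ∑ u, ((N j r u * if u = s then -P.b s l / P.a s l else 0) -
          P.a j l * ((if r = u then -P.b u l / P.a u l else 0) * N j u s)) =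
          N j r s * (-P.b s l / P.a s l) - P.a j l * ((-P.b r l / P.a r l) * N j r s) := by
        simp
      have h2 : ∑ u, (if u = j then P.b j l else 0) * N u r s = P.b j l * N j r s := by simp
      rw [h1, h2]
      -- On the diagonal the identity to be met is `p_j (c_{rj} - a_{rl}) = b_{jl} N^j_{rr}`. With
      -- `N^j_{rr} = q_{rj}^r`, which `diag` enforces where `b_{jl} ≠ 0`, it is the hypothesis
      -- `p_c`.
      by_cases hrs : r = s
      · subst hrs
        rw [if_pos rfl]
        have h3 := hN.diag j l r
        have h4 := hP.p_c r j l
        have h5 := hP.a_ne_zero r l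
        rcases hP.b_eq_zero_or j l with hb | hb
        · have h6 : P.p j * ((P.a r l)⁻¹ * P.c r j - 1) = 0 := by
            field_simp
            rw [h4, hb, zero_mul, mul_zero]
          rw [h6, hb]
          rcases hP.b_eq_zero_or r l with hb' | hb'
          · simp [hb']
          · simp [hb']; ring
        · simp only [hb, inv_one, one_mul] at h4 ⊢
          linear_combination h4 - h3
      · rw [if_neg hrs, zero_add]
        have h3 := hN.b j l r s hrs
        by_cases h : ∀ i, P.a i l = 1
        · simp only [h]
          linear_combination h3
        · have hb (i : Fin 3) : P.b i l = 0 := (hP.b_eq_zero_or i l).resolve_right h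
          simp [hb]
    · split_ifs
      · exact hP.κ_a i j s (Gen.x_lt_x.1 hij)
      · rfl
    · rw [hN.comm i j r s (Gen.x_lt_x.1 hij)]
      split_ifs
      · rw [hP.κ_c i j s (Gen.x_lt_x.1 hij), zero_add]
      · rw [zero_add]

/-- There is no logarithmic generator here, so `2` is only a placeholder that is not a root of
unity. -/
theorem formData_hasDifferential [CharZero k] (hN : P.IsFormMatrix N) :
    (P.formData N).HasDifferential P.rel ∅ 2 where
  lam_ne n hn := by
    have h : (1 : ℕ) < 2 ^ n := Nat.one_lt_two_pow hn
    exact_mod_cast h.ne'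
  isBot θ hθ := hθ.elim
  G_self := by
    simp only [Gen.forall_iff]
    exact ⟨fun l _ => rfl, fun i _ => hP.c_self i⟩
  G_log_self θ hθ := hθ.elim
  G_right := by
    intro i j hij _
    rcases i.cases with ⟨i, rfl⟩ | ⟨i, rfl⟩ <;> rcases j.cases with ⟨j, rfl⟩ | ⟨j, rfl⟩ <;>
      simp at hij ⊢
  G_log θ hθ := hθ.elim
  G_left := by
    intro i j hij _
    rcases i.cases with ⟨i, rfl⟩ | ⟨i, rfl⟩ <;> rcases j.cases with ⟨j, rfl⟩ | ⟨j, rfl⟩ <;>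
      simp [hP.a_ne_zero, hP.c_mul] at hij ⊢
  n_swap := by
    intro i j r hij _
    rcases i.cases with ⟨i, rfl⟩ | ⟨i, rfl⟩ <;> rcases j.cases with ⟨j, rfl⟩ | ⟨j, rfl⟩ <;>
      rcases r.cases with ⟨r, rfl⟩ | ⟨r, rfl⟩ <;>
      simp at hij ⊢
    · split_ifs with h
      · subst h
        have := hP.a_ne_zero r i
        field_simp
      · rw [neg_zero]
    · exact hN.swap i j r hij
  eps _ _ _ _ := rfl
  eps_log θ hθ := hθ.elim
  q_log _ _ _ θ hθ := hθ.elim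
  q_log_left θ hθ := hθ.elim
  κ_log θ hθ := hθ.elim
  n_log θ hθ := hθ.elim
  n_log_right θ hθ := hθ.elim
  dense θ hθ := hθ.elim

end Consistent

end SkewParams

/-! ### Form matrices that need no logarithmic form. -/

namespace SkewParams

variable {k : Type*} [Field k] {P : SkewParams k}

namespace Consistent

variable (hP : P.Consistent)

include hP

theorem c_inv_eq {i j m s : Fin 3} (h : P.q i j m ≠ 0) : P.c s i * P.c s j = P.c s m :=
  sub_eq_zero.1 ((mul_eq_zero.1 (hP.q_c i j m s)).resolve_left h)

/-- In `c_{rs} c_{ri} = c_{rs}` the common factor cancels. -/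
theorem c_eq_one_of_diag {s i : Fin 3} (h : P.q s i s ≠ 0) (r : Fin 3) : P.c r i = 1 :=
  mul_left_cancel₀ (hP.c_ne_zero r s) (by rw [hP.c_inv_eq h, mul_one])

theorem q_ne_zero_swap {i j m : Fin 3} (h : P.q j i m ≠ 0) : P.q i j m ≠ 0 := by
  rw [hP.q_swap i j m] at h
  exact right_ne_zero_of_mul h

theorem q_diag_comm (i j s : Fin 3) : P.q s j s * P.q s i s * (1 - P.c i j) = 0 := by
  by_cases h : P.q s j s = 0
  · rw [h, zero_mul, zero_mul]
  · rw [hP.c_eq_one_of_diag h i, sub_self, mul_zero]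

theorem q_c_right (i j r s : Fin 3) : P.q s i r * (P.c i j * P.c s j - P.c r j) = 0 := by
  by_cases h : P.q s i r = 0
  · rw [h, zero_mul]
  · have h1 := hP.c_inv_eq h (s := j)
    have h2 := hP.c_mul i j
    have h3 := hP.c_mul s j
    have h4 := hP.c_mul r j
    linear_combination P.q s i r * (-P.c i j * P.c s j * h4 +
      P.c r j * P.c i j * P.c s j * (-h1) + P.c r j * P.c s j * P.c j s * h2 + P.c r j * h3)

/-- The form matrices when `d x_u` is the only form that does not quasi-commute with `A`. -/
def formMatrix (P : SkewParams k) (u i r s : Fin 3) : k :=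
  if r = s ∨ (i = u ∧ r ≠ u ∧ s ≠ u) then P.q s i r else 0

omit hP in
theorem formMatrix_of_ne {u i r s : Fin 3} (hi : i ≠ u) :
    formMatrix P u i r s = if r = s then P.q s i s else 0 := by
  unfold formMatrix
  by_cases h : r = s
  · subst h; simp
  · simp [h, hi]

omit hP in
theorem formMatrix_diag (u i s : Fin 3) : formMatrix P u i s s = P.q s i s := by
  simp [formMatrix]

/-- Every `x_i` acts by the diagonal of its adjoint matrix, and `x_u` also by the entries between
the other two indices. Diagonal matrices commute, and the diagonal of the commutator identity is
`q_q`. Off the diagonal, `hoff` kills the diagonal entries that would interfere, and `hu` keeps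
`x_u` out of the relation between the other two generators. -/
theorem isFormMatrix (u : Fin 3) (hu : ∀ i j, i ≠ u → j ≠ u → P.q i j u = 0)
    (hoff : ∀ r s, r ≠ s → r ≠ u → s ≠ u → P.q s u r ≠ 0 →
      (∀ i z, i ≠ u → z ≠ u → P.q z i z = 0) ∧ ∀ i, P.q i u u = 0) :
    P.IsFormMatrix (formMatrix P u) where
  swap i j r hij := by
    have h1 := hP.q_swap i j r
    have h2 := hP.c_mul i j
    have h3 : P.c i j * P.q j i r = -P.q i j r := by
      rw [h1]; linear_combination -P.q i j r * h2
    have hne := hij.ne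
    unfold formMatrix
    by_cases hri : r = i
    · subst hri
      have h4 : ¬(r = j ∨ r = u ∧ r ≠ u ∧ j ≠ u) := by tauto
      rw [if_pos (.inl rfl), if_neg h4]; ring
    by_cases hrj : r = j
    · subst hrj
      have h4 : ¬(r = i ∨ r = u ∧ r ≠ u ∧ i ≠ u) := by tauto
      rw [if_neg h4, if_pos (.inl rfl), h3]; ring
    by_cases hju : j = u
    · subst hju; simp [hri, hrj, hne]
    by_cases hiu : i = u
    · subst hiu; simp [hri, hrj, hne.symm, h3]
    have hru : r = u := by omega
    subst hru
    simp [hri, hrj, hju, hiu, hu i j hiu hju]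
  c i j r s := by
    unfold formMatrix
    split_ifs
    · exact hP.q_c_right i j r s
    · rw [zero_mul]
  a i l r s := by
    unfold formMatrix
    split_ifs
    · rw [mul_comm (P.a i l)]; exact hP.q_a s i r l
    · rw [zero_mul]
  diag j l s := by rw [formMatrix_diag, sub_self, mul_zero]
  b j l r s hrs := by
    unfold formMatrix
    split_ifs with h
    · rcases h with h | ⟨rfl, h1, h2⟩
      · exact absurd h hrs
      · exact hP.q_b s j r l hrs h1
    · rw [zero_mul]
  comm i j r s hij := by
    by_cases hrs : r = s
    · subst hrs
      have h1 : ∑ m, P.q i j m * formMatrix P u m r r = 0 := by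
        simp only [formMatrix_diag]; exact hP.q_q i j r
      rw [h1]
      by_cases hi : i = u
      · have hj : j ≠ u := hi ▸ hij.ne'
        simp only [formMatrix_of_ne hj, ite_mul, zero_mul, mul_ite, mul_zero,
          Finset.sum_sub_distrib, Finset.sum_ite_eq, Finset.sum_ite_eq', Finset.mem_univ, if_true,
          formMatrix_diag]
        linear_combination hP.q_diag_comm i j r
      · simp only [formMatrix_of_ne hi, ite_mul, zero_mul, mul_ite, mul_zero,
          Finset.sum_sub_distrib, Finset.sum_ite_eq, Finset.sum_ite_eq', Finset.mem_univ, if_true,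
          formMatrix_diag]
        linear_combination hP.q_diag_comm i j r
    · have h1 : ∑ m, P.q i j m * formMatrix P u m r s = P.q i j u * formMatrix P u u r s := by
        refine Finset.sum_eq_single u (fun m _ hm => ?_) (by simp)
        rw [formMatrix_of_ne hm, if_neg hrs, mul_zero]
      have hz (i : Fin 3) (hi : i ≠ u) (z : Fin 3) (hz : z = r ∨ z = s) :
          P.q z i z * formMatrix P u u r s = 0 := by
        unfold formMatrix
        split_ifs with h
        · obtain ⟨-, hr, hs⟩ := h.resolve_left hrs
          by_cases h0 : P.q s u r = 0
          · rw [h0, mul_zero]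
          · rw [(hoff r s hrs hr hs h0).1 i z hi (by rcases hz with rfl | rfl <;> assumption),
              zero_mul]
        · rw [mul_zero]
      have hz' (i : Fin 3) : P.q i u u * formMatrix P u u r s = 0 := by
        unfold formMatrix
        split_ifs with h
        · obtain ⟨-, hr, hs⟩ := h.resolve_left hrs
          by_cases h0 : P.q s u r = 0
          · rw [h0, mul_zero]
          · rw [(hoff r s hrs hr hs h0).2 i, zero_mul]
        · rw [mul_zero]
      rw [h1]
      by_cases hi : i = u
      · subst hi
        have hj : j ≠ i := hij.ne'
        have h2 : P.q i j i * formMatrix P i i r s = 0 := by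
          rw [hP.q_swap j i i, mul_assoc, hz', mul_zero]
        rw [h2]
        simp only [formMatrix_of_ne hj, ite_mul, zero_mul, mul_ite, mul_zero,
          Finset.sum_sub_distrib, Finset.sum_ite_eq, Finset.sum_ite_eq', Finset.mem_univ, if_true]
        linear_combination hz j hj r (.inl rfl) - P.c i j * hz j hj s (.inr rfl)
      by_cases hj : j = u
      · subst hj
        rw [hz']
        simp only [formMatrix_of_ne hi, ite_mul, zero_mul, mul_ite, mul_zero,
          Finset.sum_sub_distrib, Finset.sum_ite_eq, Finset.sum_ite_eq', Finset.mem_univ, if_true]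
        linear_combination hz i hi s (.inr rfl) - P.c i j * hz i hi r (.inl rfl)
      · rw [hu i j hi hj, zero_mul]
        simp only [formMatrix_of_ne hi, formMatrix_of_ne hj, ite_mul, zero_mul, mul_ite, mul_zero]
        simp [hrs]

/-- The form matrices when the derived algebra is spanned by `x_w`. -/
theorem isFormMatrix_of_derived {u v w : Fin 3} (huv : u ≠ v) (huw : u ≠ w) (hvw : v ≠ w)
    (hq : ∀ i j m, m ≠ w → P.q i j m = 0) (hu : P.q w u w ≠ 0) (hv : P.q w v w ≠ 0)
    (h3 : P.q u v w ≠ 0) :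
    P.IsFormMatrix fun i r s => P.q w i w *
      if r = w then if s = w then 1 else if s = u then P.q u v w / P.q w v w else 0 else 0 := by
  -- The nonzero constants force `c = 1`, `a = 1` and `b = 0`, so this is an honest Lie algebra. All
  -- matrices are multiples of one matrix, hence commute, and `x_w` acts by zero. The entry in
  -- column `u` is chosen so that the swap condition for `u` and `v` returns `q_{uv}^w`.
  have hcu := hP.c_eq_one_of_diag hu
  have hcv := hP.c_eq_one_of_diag hv
  have hi (i : Fin 3) : i = u ∨ i = v ∨ i = w := by omega
  have hcw (i : Fin 3) : P.c i w = 1 := by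
    rcases hi i with rfl | rfl | rfl
    · simpa [hcu] using hP.c_mul i w
    · simpa [hcv] using hP.c_mul i w
    · exact hP.c_self i
  have hc (i j : Fin 3) : P.c i j = 1 := by
    rcases hi j with rfl | rfl | rfl
    · exact hcu i
    · exact hcv i
    · exact hcw i
  have hau (l : Fin 2) : P.a u l = 1 :=
    sub_eq_zero.1 ((mul_eq_zero.1 (hP.q_diag_a w u l)).resolve_left hu)
  have hav (l : Fin 2) : P.a v l = 1 :=
    sub_eq_zero.1 ((mul_eq_zero.1 (hP.q_diag_a w v l)).resolve_left hv)
  have haw (l : Fin 2) : P.a w l = 1 := by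
    have := sub_eq_zero.1 ((mul_eq_zero.1 (hP.q_a u v w l)).resolve_left h3)
    rw [← this, hau, hav, one_mul]
  have ha (i : Fin 3) (l : Fin 2) : P.a i l = 1 := by
    rcases hi i with rfl | rfl | rfl
    · exact hau l
    · exact hav l
    · exact haw l
  have hbu (l : Fin 2) : P.b u l = 0 := by
    have := hP.p_c w u l
    rw [hc, ha, sub_self, mul_zero] at this
    exact (mul_eq_zero.1 this.symm).resolve_right hu
  have hbv (l : Fin 2) : P.b v l = 0 := by
    have := hP.p_c w v l
    rw [hc, ha, sub_self, mul_zero] at this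
    exact (mul_eq_zero.1 this.symm).resolve_right hv
  have hbw (l : Fin 2) : P.b w l = 0 := by
    have := (mul_eq_zero.1 (hP.q_b u v w l huw.symm hvw.symm)).resolve_left h3
    rwa [hbu, hbv, sub_zero, sub_zero] at this
  have hb (i : Fin 3) (l : Fin 2) : P.b i l = 0 := by
    rcases hi i with rfl | rfl | rfl
    · exact hbu l
    · exact hbv l
    · exact hbw l
  have hsw (i j m : Fin 3) : P.q j i m = -P.q i j m := by rw [hP.q_swap, hc, neg_one_mul]
  refine ⟨fun i j r hij => ?_, fun i j r s => ?_, fun i l r s => ?_, fun j l s => ?_,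
    fun j l r s _ => ?_, fun i j r s _ => ?_⟩
  · rw [hc, one_mul]
    by_cases hr : r = w
    · subst hr
      generalize hf : (fun s => if s = r then 1 else if s = u then P.q u v r / P.q r v r else 0) = f
      have hfr : f r = 1 := by rw [← hf]; exact if_pos rfl
      have hfu : f u = P.q u v r / P.q r v r := by
        rw [← hf]; exact (if_neg huw).trans (if_pos rfl)
      have hfv : f v = 0 := by rw [← hf]; exact (if_neg hvw).trans (if_neg huv.symm)
      have hr := hP.q_self r r
      have hfi : (if i = r then 1 else if i = u then P.q u v r / P.q r v r else 0) = f i := by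
        rw [← hf]
      have hfj : (if j = r then 1 else if j = u then P.q u v r / P.q r v r else 0) = f j := by
        rw [← hf]
      simp only [if_true, hfi, hfj]
      have huv' : P.q r v r * (P.q u v r / P.q r v r) = P.q u v r := by field_simp
      rcases hi i with h | h | h <;> rcases hi j with h' | h' | h' <;>
        first
        | exact absurd (h.trans h'.symm) hij.ne
        | rw [h, h']
          simp only [hfr, hfu, hfv, hr, huv', mul_zero, zero_mul, mul_one, zero_sub, sub_zero,
            hsw u v, hsw r u, hsw r v]
    · simp [hr, hq i j r hr]
  · simp only [hc]; ring
  · simp only [ha]; ring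
  · rw [hb, zero_mul]
  · simp only [hb]; ring
  · rw [hc]
    have h1 : ∑ m, P.q i j m * (P.q w m w *
        if r = w then if s = w then 1 else if s = u then P.q u v w / P.q w v w else 0 else 0) = 0 := by
      refine Finset.sum_eq_zero fun m _ => ?_
      by_cases hm : m = w
      · subst hm; rw [hP.q_self, zero_mul, mul_zero]
      · rw [hq i j m hm, zero_mul]
    rw [h1]
    exact Finset.sum_eq_zero fun m _ => by ring

end Consistent

end SkewParams

/-! ### The colour version of `so₃`, with a logarithmic form. -/

namespace SkewParams

variable {k : Type*} [Field k] (P : SkewParams k)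

/-- The structure constants of forms with `t₁⁻¹ d t₁` in place of `d t₁`, when the `x_i` generate a
colour version of `so₃`. -/
def logData : ColorExt.FormData k Gen where
  G g h := match ofLex g, ofLex h with
    | .inl l, .inl m => if l = 0 ∧ m = 0 then 2 else 1
    | .inl l, .inr s => if l = 0 then 2 * P.a s l else P.a s l
    | .inr i, .inl l => if l = 0 then 1 else P.a i l
    | .inr i, .inr s => P.c s i
  ε g h := match ofLex g, ofLex h with
    | .inl _, .inl _ => 1
    | .inl l, .inr s => if l = 0 then 1 else P.a s l
    | .inr i, .inl l => if l = 0 then 1 else P.a i l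
    | .inr i, .inr s => P.c s i
  n g r s := match ofLex g, ofLex r, ofLex s with
    | .inr i, .inr r, .inl l => if l = 0 ∧ r = i then 1 else 0
    | .inr i, .inl l, .inr s =>
      if l = 0 ∧ s = i then (∑ j, ∑ m, P.q i j m * P.q i m j) / 8 else 0
    | .inr i, .inr r, .inr s => P.q s i r / 2
    | _, _, _ => 0

section logData

variable (l m : Fin 2) (i j r s : Fin 3)

open Gen

@[simp] theorem logData_G_tt : P.logData.G (t l) (t m) = if l = 0 ∧ m = 0 then 2 else 1 := rfl
@[simp] theorem logData_G_tx :
  P.logData.G (t l) (x s) = if l = 0 then 2 * P.a s l else P.a s l := rfl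
@[simp] theorem logData_G_xt : P.logData.G (x i) (t l) = if l = 0 then 1 else P.a i l := rfl
@[simp] theorem logData_G_xx : P.logData.G (x i) (x s) = P.c s i := rfl
@[simp] theorem logData_ε_tt : P.logData.ε (t l) (t m) = 1 := rfl
@[simp] theorem logData_ε_tx : P.logData.ε (t l) (x s) = if l = 0 then 1 else P.a s l := rfl
@[simp] theorem logData_ε_xt : P.logData.ε (x i) (t l) = if l = 0 then 1 else P.a i l := rfl
@[simp] theorem logData_ε_xx : P.logData.ε (x i) (x s) = P.c s i := rfl
@[simp] theorem logData_n_t (g h : Gen) : P.logData.n (t l) g h = 0 := by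
  revert g h
  simp only [Gen.forall_iff]
  exact ⟨fun _ => ⟨fun _ => rfl, fun _ => rfl⟩, fun _ => ⟨fun _ => rfl, fun _ => rfl⟩⟩
@[simp] theorem logData_n_xtt : P.logData.n (x i) (t l) (t m) = 0 := rfl
@[simp] theorem logData_n_xxt :
  P.logData.n (x i) (x r) (t l) = if l = 0 ∧ r = i then 1 else 0 := rfl
@[simp] theorem logData_n_xtx : P.logData.n (x i) (t l) (x s) =
  if l = 0 ∧ s = i then (∑ j, ∑ m, P.q i j m * P.q i m j) / 8 else 0 := rfl
@[simp] theorem logData_n_xxx : P.logData.n (x i) (x r) (x s) = P.q s i r / 2 := rfl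

end logData

variable {P}

namespace Consistent

variable (hP : P.Consistent)

include hP

theorem q_c_left (i r s u : Fin 3) : P.q s i r * (P.c u i - P.c s u * P.c u r) = 0 := by
  have h1 := hP.q_c_right i u r s
  have h2 := hP.c_mul i u
  have h3 := hP.c_mul r u
  linear_combination (-P.c u r * P.c u i) * h1 + P.q s i r * (P.c u r * P.c s u * h2 - P.c u i * h3)

variable (hq : ∀ s i, P.q s i s = 0) (h0 : P.q 1 2 0 ≠ 0) (h1 : P.q 0 2 1 ≠ 0) (h2 : P.q 0 1 2 ≠ 0)

include hq h0 h1 h2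

-- The three nonzero constants give `c_{si} c_{sj} = c_{sm}` for `{i, j, m} = {0, 1, 2}` and all
-- `s`, which leaves a single sign `γ`: the Lie case `γ = 1` and the colour case `γ = -1`.
omit hq in
theorem exists_c_eq : ∃ γ : k, γ * γ = 1 ∧ ∀ i j, i ≠ j → P.c i j = γ := by
  have e1 := hP.c_inv_eq h2 (s := 0)
  have e2 := hP.c_inv_eq h2 (s := 1)
  have e3 := hP.c_inv_eq h1 (s := 0)
  have e4 := hP.c_inv_eq h1 (s := 2)
  have e5 := hP.c_inv_eq h0 (s := 1)
  have e6 := hP.c_inv_eq h0 (s := 2)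
  simp only [hP.c_self, one_mul, mul_one] at e1 e2 e3 e4 e5 e6
  have e7 : P.c 0 1 * P.c 0 1 = 1 := by
    have := hP.c_inv_eq h0 (s := 0)
    rwa [hP.c_self, ← e1] at this
  have e8 : P.c 1 0 = P.c 0 1 := by
    linear_combination P.c 0 1 * hP.c_mul 1 0 - P.c 1 0 * e7
  have e9 : P.c 2 0 = P.c 0 1 := by
    have := hP.c_mul 2 0
    rw [← e1] at this
    linear_combination P.c 0 1 * this - P.c 2 0 * e7
  refine ⟨P.c 0 1, e7, fun i j hij => ?_⟩
  fin_cases i <;> fin_cases j <;> simp at hij ⊢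
  · exact e1.symm
  · exact e8
  · exact e2.symm.trans e8
  · exact e9
  · exact e4.symm.trans e9

omit hq in
theorem a_mul {i j m : Fin 3} (hij : i ≠ j) (him : i ≠ m) (hjm : j ≠ m) (l : Fin 2) :
    P.a i l * P.a j l = P.a m l := by
  have e0 := sub_eq_zero.1 ((mul_eq_zero.1 (hP.q_a 1 2 0 l)).resolve_left h0)
  have e1 := sub_eq_zero.1 ((mul_eq_zero.1 (hP.q_a 0 2 1 l)).resolve_left h1)
  have e2 := sub_eq_zero.1 ((mul_eq_zero.1 (hP.q_a 0 1 2 l)).resolve_left h2)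
  fin_cases i <;> fin_cases j <;> simp at hij <;> fin_cases m <;> simp at him hjm ⊢ <;>
    first | assumption | (rw [mul_comm]; assumption)

omit hq in
theorem a_sq (i : Fin 3) (l : Fin 2) : P.a i l * P.a i l = 1 := by
  have hne (i j m : Fin 3) (hij : i ≠ j) (him : i ≠ m) (hjm : j ≠ m) : P.a i l * P.a i l = 1 := by
    have e1 := hP.a_mul h0 h1 h2 hij him hjm l
    have e2 := hP.a_mul h0 h1 h2 him hij hjm.symm l
    refine mul_right_cancel₀ (hP.a_ne_zero j l) ?_
    rw [mul_assoc, e1, e2, one_mul]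
  fin_cases i
  · exact hne 0 1 2 (by decide) (by decide) (by decide)
  · exact hne 1 0 2 (by decide) (by decide) (by decide)
  · exact hne 2 0 1 (by decide) (by decide) (by decide)

omit hq in
theorem b_eq_zero [CharZero k] (i : Fin 3) (l : Fin 2) : P.b i l = 0 := by
  have e0 := (mul_eq_zero.1 (hP.q_b 1 2 0 l (by decide) (by decide))).resolve_left h0
  have e1 := (mul_eq_zero.1 (hP.q_b 0 2 1 l (by decide) (by decide))).resolve_left h1
  have e2 := (mul_eq_zero.1 (hP.q_b 0 1 2 l (by decide) (by decide))).resolve_left h2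
  fin_cases i
  · change P.b 0 l = 0
    linear_combination (-1 / 2 : k) * e1 + (-1 / 2 : k) * e2
  · change P.b 1 l = 0
    linear_combination (-1 / 2 : k) * e0 + (-1 / 2 : k) * e2
  · change P.b 2 l = 0
    linear_combination (-1 / 2 : k) * e0 + (-1 / 2 : k) * e1

theorem p_eq_zero [CharZero k] (i : Fin 3) : P.p i = 0 := by
  have hb := hP.b_eq_zero h0 h1 h2
  have e0 := hP.q_p 1 2 0 (by decide)
  have e1 := hP.q_p 0 2 0 (by decide)
  have e2 := hP.q_p 0 1 0 (by decide)
  have hq' (s i : Fin 3) : P.q i s s = 0 := by rw [hP.q_swap, hq, mul_zero]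
  simp only [hb, Fin.sum_univ_three, hq, hq', zero_mul, add_zero, mul_zero, zero_add] at e0 e1 e2
  fin_cases i
  · exact (mul_eq_zero.1 e0).resolve_left h0
  · exact (mul_eq_zero.1 e1).resolve_left h1
  · exact (mul_eq_zero.1 e2).resolve_left h2

omit hq in
theorem q_a_right (i r s : Fin 3) (l : Fin 2) :
    P.q s i r * (P.a i l - P.a s l * P.a r l) = 0 := by
  have h := hP.q_a s i r l
  have h' := hP.a_sq h0 h1 h2 s l
  linear_combination P.a s l * h - P.q s i r * P.a i l * h'

/-- For `γ = 1` the product `x y = [x, y] / 2 + K(x, y) / 8`, with `K` the Killing form, makes the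
span of `1` and the `x_i` a quaternion algebra; for imaginary units `K(x, x) = -8` and `x² = -1`.
`logData` lets `x_i` act on the span of the logarithmic form, in the role of `1`, and the `dx_s` by
left multiplication. This identity and `logData_lin` say that the action is a representation; the
same formulas work for `γ = -1`. -/
theorem logData_comm [CharZero k] (i j r s : Fin 3) (hij : i < j) :
    (if r = j ∧ s = i then (∑ j, ∑ m, P.q i j m * P.q i m j) / 8 else 0) -
      P.c i j * (if r = i ∧ s = j then (∑ i, ∑ m, P.q j i m * P.q j m i) / 8 else 0) +
      ∑ u, (P.q u j r / 2 * (P.q s i u / 2) - P.c i j * (P.q u i r / 2 * (P.q s j u / 2))) =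
    ∑ m, P.q i j m * (P.q s m r / 2) := by
  obtain ⟨γ, hγ, hc⟩ := hP.exists_c_eq h0 h1 h2
  have hq' (s i : Fin 3) : P.q i s s = 0 := by rw [hP.q_swap, hq, mul_zero]
  have e0 : P.q 2 1 0 = -γ * P.q 1 2 0 := by rw [hP.q_swap 1 2, hc 2 1 (by decide)]
  have e1 : P.q 2 0 1 = -γ * P.q 0 2 1 := by rw [hP.q_swap 0 2, hc 2 0 (by decide)]
  have e2 : P.q 1 0 2 = -γ * P.q 0 1 2 := by rw [hP.q_swap 0 1, hc 1 0 (by decide)]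
  rw [hc i j hij.ne]
  have hγ' : γ = 1 ∨ γ = -1 := mul_self_eq_one_iff.1 hγ
  fin_cases i <;> fin_cases j <;> simp at hij <;> fin_cases r <;> fin_cases s <;>
    simp [Fin.sum_univ_three, hq, hq', hP.q_self, e0, e1, e2] <;>
    rcases hγ' with rfl | rfl <;> ring

theorem logData_lin [CharZero k] (i j s : Fin 3) (hij : i < j) :
    (∑ u, ∑ m, P.q j u m * P.q j m u) / 8 * (P.q s i j / 2) -
      P.c i j * ((∑ u, ∑ m, P.q i u m * P.q i m u) / 8 * (P.q s j i / 2)) =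
    P.q i j s * ((∑ u, ∑ m, P.q s u m * P.q s m u) / 8) := by
  obtain ⟨γ, hγ, hc⟩ := hP.exists_c_eq h0 h1 h2
  have hq' (s i : Fin 3) : P.q i s s = 0 := by rw [hP.q_swap, hq, mul_zero]
  have e0 : P.q 2 1 0 = -γ * P.q 1 2 0 := by rw [hP.q_swap 1 2, hc 2 1 (by decide)]
  have e1 : P.q 2 0 1 = -γ * P.q 0 2 1 := by rw [hP.q_swap 0 2, hc 2 0 (by decide)]
  have e2 : P.q 1 0 2 = -γ * P.q 0 1 2 := by rw [hP.q_swap 0 1, hc 1 0 (by decide)]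
  rw [hc i j hij.ne]
  have hγ' : γ = 1 ∨ γ = -1 := mul_self_eq_one_iff.1 hγ
  fin_cases i <;> fin_cases j <;> simp at hij <;> fin_cases s <;>
    simp [Fin.sum_univ_three, hq, hq', hP.q_self, e0, e1, e2] <;>
    rcases hγ' with rfl | rfl <;> ring

theorem logData_compatible [CharZero k] : P.logData.Compatible P.rel := by
  obtain ⟨γ, hγ, hc⟩ := hP.exists_c_eq h0 h1 h2
  have hb := hP.b_eq_zero h0 h1 h2
  have hp := hP.p_eq_zero hq h0 h1 h2
  have ha := hP.a_sq h0 h1 h2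
  have hcc (i j : Fin 3) : P.c i j = P.c j i := by
    by_cases h : i = j
    · rw [h]
    · rw [hc i j h, hc j i (Ne.symm h)]
  have hcc' (i j : Fin 3) : P.c i j * P.c i j = 1 := by
    conv_lhs => rw [hcc i j]
    rw [← hP.c_mul i j, hcc i j]
  have hqc (i j m : Fin 3) : P.c i j * P.q j i m = -P.q i j m := by
    rw [hP.q_swap i j]; linear_combination -P.q i j m * hP.c_mul i j
  refine ⟨?_, ?_, ?_, ?_, ?_, ?_, ?_, ?_⟩
  · simp only [Gen.forall_iff]
    exact ⟨fun l => rfl, hP.c_self⟩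
  · intro i j
    rcases i.cases with ⟨i, rfl⟩ | ⟨i, rfl⟩ <;> rcases j.cases with ⟨j, rfl⟩ | ⟨j, rfl⟩
    · simp
    · simp only [logData_ε_tx, logData_ε_xt]
      split_ifs
      · rw [one_mul]
      · exact ha j i
    · simp only [logData_ε_tx, logData_ε_xt]
      split_ifs
      · rw [one_mul]
      · exact ha i j
    · exact hP.c_mul j i
  · intro i j
    rcases i.cases with ⟨i, rfl⟩ | ⟨i, rfl⟩ <;> rcases j.cases with ⟨j, rfl⟩ | ⟨j, rfl⟩
    · simp only [logData_G_tt]; split_ifs <;> simp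
    · simp only [logData_G_tx]; split_ifs <;> simp [hP.a_ne_zero]
    · simp only [logData_G_xt]; split_ifs <;> simp [hP.a_ne_zero]
    · exact hP.c_ne_zero _ _
  · intro j r s u
    rcases j.cases with ⟨j, rfl⟩ | ⟨j, rfl⟩ <;> rcases r.cases with ⟨r, rfl⟩ | ⟨r, rfl⟩ <;>
      rcases s.cases with ⟨s, rfl⟩ | ⟨s, rfl⟩ <;> rcases u.cases with ⟨u, rfl⟩ | ⟨u, rfl⟩ <;>
      simp only [logData_n_t, zero_mul, logData_n_xtt, logData_n_xxt, logData_n_xtx, logData_n_xxx,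
        logData_G_xx, logData_G_xt, logData_ε_tt, logData_ε_tx, logData_ε_xt, logData_ε_xx]
    · split_ifs with h h' h'
      · rw [mul_one, sub_self, mul_zero]
      · rw [h.2, mul_one, sub_self, mul_zero]
      · rw [zero_mul]
      · rw [zero_mul]
    · split_ifs with h h' h'
      · rw [h.2, hcc, mul_one, sub_self, mul_zero]
      · exact absurd h.1 h'
      · rw [zero_mul]
      · rw [zero_mul]
    · split_ifs with h h' h'
      · ring
      · rw [h.2]; ring
      · rw [zero_mul]
      · rw [zero_mul]
    · split_ifs with h h' h'
      · rw [h.2]; ring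
      · exact absurd h.1 h'
      · rw [zero_mul]
      · rw [zero_mul]
    · split_ifs with h
      · ring
      · linear_combination hP.q_a_right h0 h1 h2 j r s u / 2
    · linear_combination hP.q_c_left j r s u / 2
  · intro i j m s hij
    rcases i.cases with ⟨l, rfl⟩ | ⟨i, rfl⟩ <;> rcases j.cases with ⟨j, rfl⟩ | ⟨j, rfl⟩ <;>
      rcases m.cases with ⟨m, rfl⟩ | ⟨m, rfl⟩ <;> rcases s.cases with ⟨s, rfl⟩ | ⟨s, rfl⟩ <;>
      simp only [rel_q_tt, rel_q_t, rel_q_txx, rel_q_xxx, zero_mul, Gen.not_x_lt_t, hb, ite_self,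
        logData_G_xx, logData_G_xt] at hij ⊢
    · split_ifs with h
      · ring
      · exact hP.q_a i j m s
    · exact hP.q_c i j m s
  · intro i j r s hij
    rcases i.cases with ⟨l, rfl⟩ | ⟨i, rfl⟩ <;> rcases j.cases with ⟨j, rfl⟩ | ⟨j, rfl⟩ <;>
      rcases r.cases with ⟨r, rfl⟩ | ⟨r, rfl⟩ <;> rcases s.cases with ⟨s, rfl⟩ | ⟨s, rfl⟩ <;>
      simp only [logData_n_t, zero_mul, logData_n_xtt, logData_n_xxt, logData_n_xtx, logData_n_xxx,
        logData_G_xx, logData_G_xt, rel_c_xx, Gen.not_x_lt_t] at hij ⊢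
    · by_cases h : r = 0 ∧ s = i
      · rw [if_pos h, if_pos h.1, h.2, hcc', sub_self, mul_zero]
      · rw [if_neg h, zero_mul]
    · by_cases h : s = 0 ∧ r = i
      · rw [if_pos h, if_pos h.1, h.2]; ring
      · rw [if_neg h, zero_mul]
    · linear_combination (-1 / 2 : k) * hP.q_c_right i j r s
  · intro i j r s hij
    rcases i.cases with ⟨l, rfl⟩ | ⟨i, rfl⟩ <;> rcases j.cases with ⟨j, rfl⟩ | ⟨j, rfl⟩ <;>
      rcases r.cases with ⟨r, rfl⟩ | ⟨r, rfl⟩ <;> rcases s.cases with ⟨s, rfl⟩ | ⟨s, rfl⟩ <;>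
      simp only [logData_n_t, zero_mul, logData_n_xtt, logData_n_xxt, logData_n_xtx, logData_n_xxx,
        logData_G_xx, logData_G_xt, logData_G_tt, logData_G_tx, rel_c_tx, rel_c_xx,
        Gen.not_x_lt_t] at hij ⊢
    · by_cases h : r = 0 ∧ s = j
      · obtain ⟨rfl, rfl⟩ := h
        by_cases hl : l = 0
        · simp only [hl, and_self, if_true]
          ring
        · simp only [hl, false_and, if_false]
          ring
      · rw [if_neg h, zero_mul]
    · by_cases h : s = 0 ∧ r = j
      · obtain ⟨rfl, rfl⟩ := h
        have := ha r l
        by_cases hl : l = 0 <;> simp [hl] at this ⊢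
        · linear_combination (-2 : k) * this
        · linear_combination (-1 : k) * this
      · rw [if_neg h, zero_mul]
    · have h := hP.q_a s j r l
      have h' := ha j l
      have key : P.q s j r * (P.a s l - P.a j l * P.a r l) = 0 := by
        linear_combination P.a j l * h - P.q s j r * P.a s l * h'
      split_ifs
      · linear_combination key
      · linear_combination key / 2
    · by_cases h : r = 0 ∧ s = j
      · rw [if_pos h, if_pos h.1, h.2, hcc, mul_one, sub_self, mul_zero]
      · rw [if_neg h, zero_mul]
    · by_cases h : s = 0 ∧ r = j
      · rw [if_pos h, if_pos h.1, h.2, hP.c_mul, sub_self, mul_zero]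
      · rw [if_neg h, zero_mul]
    · linear_combination P.c i j * hP.q_c_right j i r s / 2 - P.q s j r * P.c s i * hP.c_mul i j / 2
  · intro i j r s hij
    rcases i.cases with ⟨l, rfl⟩ | ⟨i, rfl⟩ <;> rcases j.cases with ⟨j, rfl⟩ | ⟨j, rfl⟩ <;>
      rcases r.cases with ⟨r, rfl⟩ | ⟨r, rfl⟩ <;> rcases s.cases with ⟨s, rfl⟩ | ⟨s, rfl⟩ <;>
      simp only [Gen.sum_eq, logData_n_t, zero_mul, mul_zero, sub_zero, logData_n_xtt,
        logData_n_xxt, logData_n_xtx, logData_n_xxx, rel_c_tx, rel_c_xx, Gen.not_x_lt_t, rel_κ_tt,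
        rel_κ_tx, rel_κ_xx, hb, hp, logData_G_xt, logData_G_xx, Fin.sum_univ_two,
        Finset.sum_const_zero, zero_add, add_zero, Gen.t_ne_x, Gen.x_ne_t, if_false, ite_self,
        Gen.t_inj, Gen.x_inj, rel_q_tt, rel_q_t, rel_q_txx, rel_q_xxx] at hij ⊢
    · have hij' : i ≠ j := (Gen.x_lt_x.1 hij).ne
      rw [Finset.sum_eq_zero, add_zero]
      · split_ifs with h h'
        · ring
        · exact hP.κ_a i j s (Gen.x_lt_x.1 hij)
        · rfl
      · intro u _
        have h3 (y z : k) :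
            ((if r = 0 ∧ u = j then y else 0) * if s = 0 ∧ u = i then z else 0) = 0 := by
          split_ifs with h h'
          · exact absurd (h'.2.symm.trans h.2) hij'
          all_goals simp
        have h4 (y z : k) :
            ((if r = 0 ∧ u = i then y else 0) * if s = 0 ∧ u = j then z else 0) = 0 := by
          split_ifs with h h'
          · exact absurd (h.2.symm.trans h'.2) hij'
          all_goals simp
        rw [h3, h4, mul_zero, sub_zero]
    · by_cases hr : r = 0
      · simp only [hr, true_and, ite_mul, zero_mul, mul_ite, mul_zero, Finset.sum_sub_distrib,
          Finset.sum_ite_eq', Finset.sum_ite_eq, Finset.mem_univ, if_true]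
        exact hP.logData_lin hq h0 h1 h2 i j s (Gen.x_lt_x.1 hij)
      · simp [hr]
    · by_cases hs : s = 0
      · simp only [hs, true_and, mul_ite, mul_one, mul_zero, Finset.sum_sub_distrib,
          Finset.sum_ite_eq', Finset.sum_ite_eq, Finset.mem_univ, if_true]
        linear_combination (-1 / 2 : k) * hqc i j r
      · simp [hs]
    · rw [← hP.logData_comm hq h0 h1 h2 i j r s (Gen.x_lt_x.1 hij)]
      have hκ : (if r = s then P.κ i j * (P.c s i * P.c s j - 1) else 0) = 0 := by
        split_ifs
        · exact hP.κ_c i j s (Gen.x_lt_x.1 hij)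
        · rfl
      rw [hκ]
      simp only [true_and, one_ne_zero, false_and, if_false, mul_zero, sub_zero, add_zero, zero_add,
        ite_mul, one_mul, zero_mul, ite_and]

/-- With `e` the logarithmic form, `dx_i = x_i e - e x_i` and `dt₁ = t₁ e - e t₁ = e t₁`. The `2` is
the scalar in `t₁ e = 2 e t₁`; `t₁` must scale the `dx_s` by the same `2`, up to `a`, because `x_i
e` involves `dx_i`. -/
theorem logData_hasDifferential [CharZero k] : P.logData.HasDifferential P.rel {Gen.t 0} 2 := by
  have hb := hP.b_eq_zero h0 h1 h2
  have hp := hP.p_eq_zero hq h0 h1 h2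
  have ha := hP.a_sq h0 h1 h2
  have hqc (i j m : Fin 3) : P.c i j * P.q j i m = -P.q i j m := by
    rw [hP.q_swap i j]; linear_combination -P.q i j m * hP.c_mul i j
  have h01 (l : Fin 2) (hl : l ≠ 0) : l = 1 := by omega
  constructor
  · intro n hn
    have h : (1 : ℕ) < 2 ^ n := Nat.one_lt_two_pow hn
    exact_mod_cast h.ne'
  · rintro _ rfl i
    rcases i.cases with ⟨i, rfl⟩ | ⟨i, rfl⟩
    · rcases eq_or_ne i 0 with rfl | hi
      · exact le_rfl
      · exact (Gen.t_lt_t.2 (Fin.pos_iff_ne_zero.2 hi)).le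
    · exact Gen.t_lt_x.le
  · simp only [Gen.forall_iff, Set.mem_singleton_iff, Gen.t_inj]
    exact ⟨fun l hl => by simp [hl], fun i _ => hP.c_self i⟩
  · rintro _ rfl
    simp
  · intro i j hij hi
    rcases i.cases with ⟨i, rfl⟩ | ⟨i, rfl⟩ <;> rcases j.cases with ⟨j, rfl⟩ | ⟨j, rfl⟩ <;>
      simp at hij hi ⊢
    · intro h; omega
    · intro h; exact absurd h hi
  · rintro _ rfl j hj
    rcases j.cases with ⟨j, rfl⟩ | ⟨j, rfl⟩ <;> simp at hj ⊢
    omega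
  · intro i j hij hi
    rcases i.cases with ⟨i, rfl⟩ | ⟨i, rfl⟩ <;> rcases j.cases with ⟨j, rfl⟩ | ⟨j, rfl⟩ <;>
      simp at hij hi ⊢
    · intro h; omega
    · rw [if_neg hi, ha]
    · rw [hP.c_mul]
  · intro i j r hij hi
    rcases i.cases with ⟨i, rfl⟩ | ⟨i, rfl⟩ <;> rcases j.cases with ⟨j, rfl⟩ | ⟨j, rfl⟩ <;>
      rcases r.cases with ⟨r, rfl⟩ | ⟨r, rfl⟩ <;>
      simp [hb] at hij hi ⊢
    · intro h; exact absurd h hi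
    · simp [hij.ne, hij.ne']
    · linear_combination (-1 / 2 : k) * hqc i j r
  · intro i j hi hij
    rcases i.cases with ⟨i, rfl⟩ | ⟨i, rfl⟩ <;> rcases j.cases with ⟨j, rfl⟩ | ⟨j, rfl⟩ <;>
      simp at hi hij ⊢
    · intro h; exact absurd h hi
    · simp [hi]
  · rintro _ rfl j
    rcases j.cases with ⟨j, rfl⟩ | ⟨j, rfl⟩ <;> simp
  · rintro i j - _ rfl
    simp
  · rintro _ rfl j m -
    rcases j.cases with ⟨j, rfl⟩ | ⟨j, rfl⟩ <;> rcases m.cases with ⟨m, rfl⟩ | ⟨m, rfl⟩ <;>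
      simp [hb]
  · rintro _ rfl j -
    rcases j.cases with ⟨j, rfl⟩ | ⟨j, rfl⟩ <;> simp [hp]
  · rintro _ rfl r s
    simp
  · rintro _ rfl j r hj
    rcases j.cases with ⟨j, rfl⟩ | ⟨j, rfl⟩ <;> rcases r.cases with ⟨r, rfl⟩ | ⟨r, rfl⟩ <;>
      simp at hj ⊢
    · simp [hj.ne']
    · split_ifs
      · linear_combination (-2 : k) * ha j 0
      · rfl
  · rintro _ rfl
    -- `x_0 dx_0 - dx_0 x_0` is the Killing norm of `x_0` divided by `8`, times the logarithmic
    -- form, and this norm is a nonzero product of structure constants.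
    refine ⟨Gen.x 0, Gen.x 0, by simp, ?_, ?_⟩
    · have hq' (s i : Fin 3) : P.q i s s = 0 := by rw [hP.q_swap, hq, mul_zero]
      simp only [logData_n_xtx, and_self, if_true, Fin.sum_univ_three, hP.q_self, hq, hq', mul_zero,
        add_zero, zero_add]
      have h3 : P.q 0 1 2 * P.q 0 2 1 + P.q 0 2 1 * P.q 0 1 2 =
          2 * (P.q 0 1 2 * P.q 0 2 1) := by ring
      rw [h3]
      exact div_ne_zero (mul_ne_zero two_ne_zero (mul_ne_zero h2 h1)) (by norm_num)
    · intro r hr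
      rcases r.cases with ⟨r, rfl⟩ | ⟨r, rfl⟩
      · have : r ≠ 0 := fun h => hr (by rw [h])
        simp [this]
      · simp [hP.q_self]

end Consistent

end SkewParams

/-! ### The vanishing patterns of the structure constants. -/

namespace SkewParams

/-- A case distinction for the structure constants `p_m = q_{12}^m`, `r_m = q_{13}^m`,
`s_m = q_{23}^m`. -/
theorem struct_cases {k : Type*} [Field k] {p₁ p₂ p₃ r₁ r₂ r₃ s₁ s₂ s₃ : k}
    (hp₀ : p₂ * p₁ + p₃ * r₁ = 0) (hp₂ : p₁ * r₃ + p₂ * s₃ = 0) (hps : p₃ * s₂ = 0)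
    (hr₀ : r₂ * p₁ + r₃ * r₁ = 0) (hr₂ : r₁ * r₃ + r₂ * s₃ = 0)
    (hs₀ : s₂ * p₁ + s₃ * r₁ = 0) (hs₂ : s₁ * r₃ + s₂ * s₃ = 0)
    (h₀p : p₂ * p₁ = 0) (h₀r : p₂ * r₁ = 0) (h₀s : p₂ * s₁ = 0)
    (h₂r : s₂ * r₃ = 0) (h₂s : s₂ * s₃ = 0) :
    (s₁ = 0 ∧ (p₃ ≠ 0 ∨ r₂ ≠ 0 → s₂ = 0 ∧ s₃ = 0 ∧ p₁ = 0 ∧ r₁ = 0)) ∨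
    (r₂ = 0 ∧ (p₃ ≠ 0 ∨ s₁ ≠ 0 → r₁ = 0 ∧ r₃ = 0 ∧ p₂ = 0 ∧ s₂ = 0)) ∨
    (p₃ = 0 ∧ (r₂ ≠ 0 ∨ s₁ ≠ 0 → p₁ = 0 ∧ p₂ = 0 ∧ r₃ = 0 ∧ s₃ = 0)) ∨
    (p₂ = 0 ∧ p₃ = 0 ∧ r₂ = 0 ∧ r₃ = 0 ∧ s₂ = 0 ∧ s₃ = 0 ∧ p₁ ≠ 0 ∧ r₁ ≠ 0 ∧ s₁ ≠ 0) ∨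
    (p₁ = 0 ∧ p₃ = 0 ∧ r₁ = 0 ∧ r₃ = 0 ∧ s₁ = 0 ∧ s₃ = 0 ∧ p₂ ≠ 0 ∧ r₂ ≠ 0 ∧ s₂ ≠ 0) ∨
    (p₁ = 0 ∧ p₂ = 0 ∧ r₁ = 0 ∧ r₂ = 0 ∧ s₁ = 0 ∧ s₂ = 0 ∧ p₃ ≠ 0 ∧ r₃ ≠ 0 ∧ s₃ ≠ 0) ∨
    (p₁ = 0 ∧ p₂ = 0 ∧ r₁ = 0 ∧ r₃ = 0 ∧ s₂ = 0 ∧ s₃ = 0 ∧ p₃ ≠ 0 ∧ r₂ ≠ 0 ∧ s₁ ≠ 0) := by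
  -- Most hypotheses become vanishing products, so only the zero pattern of the nine constants
  -- matters and can be searched exhaustively.
  have e1 : p₃ * r₁ = 0 := by linear_combination hp₀ - h₀p
  have e2 : s₁ * r₃ = 0 := by linear_combination hs₂ - h₂s
  simp only [mul_eq_zero] at e1 e2 hps h₀p h₀r h₀s h₂r h₂s
  by_cases hp3 : p₃ = 0 <;> by_cases hr2 : r₂ = 0 <;> by_cases hs1 : s₁ = 0 <;>
    by_cases hp1 : p₁ = 0 <;> by_cases hp2 : p₂ = 0 <;> by_cases hs2 : s₂ = 0 <;>
    by_cases hs3 : s₃ = 0 <;> by_cases hr1 : r₁ = 0 <;> by_cases hr3 : r₃ = 0 <;> simp_all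

namespace Consistent

variable {k : Type*} [Field k] {P : SkewParams k} (hP : P.Consistent)

include hP

theorem q_ne_zero_iff_swap (i j m : Fin 3) : P.q j i m ≠ 0 ↔ P.q i j m ≠ 0 :=
  ⟨hP.q_ne_zero_swap, hP.q_ne_zero_swap⟩

theorem q_eq_zero_swap {i j m : Fin 3} (h : P.q i j m = 0) : P.q j i m = 0 := by
  rw [hP.q_swap i j m, h, mul_zero]

theorem q_diag_swap (i j : Fin 3) : P.q j i j = -P.q i j j := by
  by_cases h : P.q j i j = 0
  · rw [h, hP.q_eq_zero_swap h, neg_zero]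
  · rw [hP.q_swap i j, hP.c_eq_one_of_diag h, neg_one_mul]

/-- `isFormMatrix` with its quantified hypotheses expressed in single constants, in the shape that
the case distinction delivers. -/
theorem isFormMatrix_of_index {u v w : Fin 3} (huv : u ≠ v) (huw : u ≠ w) (hvw : v ≠ w)
    (h : P.q v w u = 0)
    (hd : P.q u v w ≠ 0 ∨ P.q u w v ≠ 0 →
      P.q v w w = 0 ∧ P.q v w v = 0 ∧ P.q u v u = 0 ∧ P.q u w u = 0) :
    P.IsFormMatrix (formMatrix P u) := by
  have hcase (i : Fin 3) (hi : i ≠ u) : i = v ∨ i = w := by omega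
  have hall (i : Fin 3) : i = u ∨ i = v ∨ i = w := by omega
  have hdiag (h : P.q u v w ≠ 0 ∨ P.q u w v ≠ 0) :
      (∀ i z, i ≠ u → z ≠ u → P.q z i z = 0) ∧ ∀ i, P.q i u u = 0 := by
    obtain ⟨h1, h2, h3, h4⟩ := hd h
    refine ⟨fun i z hi hz => ?_, fun i => ?_⟩
    · rcases hcase i hi with rfl | rfl <;> rcases hcase z hz with rfl | rfl
      · exact hP.q_self _ _
      · exact hP.q_eq_zero_swap h1
      · exact h2
      · exact hP.q_self _ _
    · rcases hall i with rfl | rfl | rfl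
      · exact hP.q_self _ _
      · exact hP.q_eq_zero_swap h3
      · exact hP.q_eq_zero_swap h4
  refine hP.isFormMatrix u (fun i j hi hj => ?_) fun r s hrs hr hs hq => hdiag ?_
  · rcases hcase i hi with rfl | rfl <;> rcases hcase j hj with rfl | rfl
    · exact hP.q_self _ _
    · exact h
    · exact hP.q_eq_zero_swap h
    · exact hP.q_self _ _
  · rw [hP.q_ne_zero_iff_swap] at hq
    rcases hcase r hr with rfl | rfl <;> rcases hcase s hs with rfl | rfl
    · exact absurd rfl hrs
    · exact .inr hq
    · exact .inl hq
    · exact absurd rfl hrs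

/-- There is a calculus of forms for every consistent choice of the structure constants. -/
theorem exists_formData [CharZero k] : ∃ (D : ColorExt.FormData k Gen) (L : Set Gen) (lam : k),
    D.Compatible P.rel ∧ D.HasDifferential P.rel L lam := by
  have of_matrix (N : Fin 3 → Fin 3 → Fin 3 → k) (hN : P.IsFormMatrix N) :
      ∃ (D : ColorExt.FormData k Gen) (L : Set Gen) (lam : k),
        D.Compatible P.rel ∧ D.HasDifferential P.rel L lam :=
    ⟨P.formData N, ∅, 2, hP.formData_compatible hN, hP.formData_hasDifferential hN⟩
  have e1 := hP.q_diag_swap 0 1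
  have e2 := hP.q_diag_swap 0 2
  have e3 := hP.q_diag_swap 1 2
  have hq (i j s : Fin 3) := hP.q_q i j s
  simp only [Fin.sum_univ_three] at hq
  have hq0 (i j : Fin 3) := hq i j 0
  have hq1 (i j : Fin 3) := hq i j 1
  have hq2 (i j : Fin 3) := hq i j 2
  simp only [hP.q_self, mul_zero, zero_add, add_zero, e1, e2, e3] at hq0 hq1 hq2
  have h0 := hP.q_q_zero
  have h2 := hP.q_q_two
  -- The trace-like relations `q_q`, one for each diagonal position, together with the two separated
  -- relations at the middle index.
  have key := struct_cases (hq0 0 1) (by linear_combination -hq2 0 1)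
    (by linear_combination hq1 0 1 + h0 0 1) (hq0 0 2) (by linear_combination -hq2 0 2) (hq0 1 2)
    (by linear_combination -hq2 1 2) (h0 0 1) (h0 0 2) (h0 1 2) (h2 0 2) (h2 1 2)
  have n01 (m : Fin 3) (h : P.q 0 1 m = 0) := hP.q_eq_zero_swap h
  have n02 (m : Fin 3) (h : P.q 0 2 m = 0) := hP.q_eq_zero_swap h
  have n12 (m : Fin 3) (h : P.q 1 2 m = 0) := hP.q_eq_zero_swap h
  have all (m : Fin 3) (h01 : P.q 0 1 m = 0) (h02 : P.q 0 2 m = 0) (h12 : P.q 1 2 m = 0) :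
      ∀ i j, P.q i j m = 0 := by
    intro i j
    fin_cases i <;> fin_cases j <;> first | exact hP.q_self _ _ | assumption |
      (apply hP.q_eq_zero_swap; assumption)
  rcases key with ⟨h, h'⟩ | ⟨h, h'⟩ | ⟨h, h'⟩ | h | h | h | h
  · refine of_matrix _ (hP.isFormMatrix_of_index (u := 0) (v := 1) (w := 2) (by decide) (by decide)
      (by decide) h fun hd => ?_)
    obtain ⟨h1, h2, h3, h4⟩ := h' hd
    exact ⟨h2, h1, h3, h4⟩
  · refine of_matrix _ (hP.isFormMatrix_of_index (u := 1) (v := 0) (w := 2) (by decide) (by decide)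
      (by decide) h fun hd => ?_)
    rw [hP.q_ne_zero_iff_swap 0 1] at hd
    obtain ⟨h1, h2, h3, h4⟩ := h' hd
    exact ⟨h2, h1, n01 1 h3, h4⟩
  · refine of_matrix _ (hP.isFormMatrix_of_index (u := 2) (v := 0) (w := 1) (by decide) (by decide)
      (by decide) h fun hd => ?_)
    rw [hP.q_ne_zero_iff_swap 0 2, hP.q_ne_zero_iff_swap 1 2] at hd
    obtain ⟨h1, h2, h3, h4⟩ := h' hd
    exact ⟨h2, h1, n02 2 h3, n12 2 h4⟩
  · obtain ⟨p2, p3, r2, r3, s2, s3, p1, r1, s1⟩ := h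
    refine of_matrix _ (hP.isFormMatrix_of_derived (u := 1) (v := 2) (w := 0) (by decide)
      (by decide) (by decide) (fun i j m hm => ?_) p1 r1 s1)
    fin_cases m
    · exact absurd rfl hm
    · exact all 1 p2 r2 s2 i j
    · exact all 2 p3 r3 s3 i j
  · obtain ⟨p1, p3, r1, r3, s1, s3, p2, r2, s2⟩ := h
    refine of_matrix _ (hP.isFormMatrix_of_derived (u := 0) (v := 2) (w := 1) (by decide)
      (by decide) (by decide) (fun i j m hm => ?_) ((hP.q_ne_zero_iff_swap _ _ _).2 p2) s2 r2)
    fin_cases m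
    · exact all 0 p1 r1 s1 i j
    · exact absurd rfl hm
    · exact all 2 p3 r3 s3 i j
  · obtain ⟨p1, p2, r1, r2, s1, s2, p3, r3, s3⟩ := h
    refine of_matrix _ (hP.isFormMatrix_of_derived (u := 0) (v := 1) (w := 2) (by decide)
      (by decide) (by decide) (fun i j m hm => ?_) ((hP.q_ne_zero_iff_swap _ _ _).2 r3)
      ((hP.q_ne_zero_iff_swap _ _ _).2 s3) p3)
    fin_cases m
    · exact all 0 p1 r1 s1 i j
    · exact all 1 p2 r2 s2 i j
    · exact absurd rfl hm
  -- Each bracket is a nonzero multiple of the third generator: the `so₃` pattern, where the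
  -- logarithmic form is used.
  · obtain ⟨p1, p2, r1, r3, s2, s3, p3, r2, s1⟩ := h
    have hdiag (s i : Fin 3) : P.q s i s = 0 := by
      fin_cases s <;> fin_cases i <;> first | exact hP.q_self _ _ | assumption |
        (apply hP.q_eq_zero_swap; assumption)
    exact ⟨P.logData, {Gen.t 0}, 2, hP.logData_compatible hdiag s1 r2 p3,
      hP.logData_hasDifferential hdiag s1 r2 p3⟩

end Consistent

end SkewParams

/-! ### The basis of ordered monomials. -/

open MvPolynomial

/-- The ordered word with `β l` letters `t_l` and `α i` letters `x_i`. -/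
def Gen.word (α : Fin 3 → ℕ) (β : Fin 2 →₀ ℕ) : List Gen :=
  List.replicate (β 0) (Gen.t 0) ++ (List.replicate (β 1) (Gen.t 1) ++
    (List.replicate (α 0) (Gen.x 0) ++ (List.replicate (α 1) (Gen.x 1) ++
      List.replicate (α 2) (Gen.x 2))))

theorem Gen.pairwise_word (α : Fin 3 → ℕ) (β : Fin 2 →₀ ℕ) :
    (Gen.word α β).Pairwise (· ≤ ·) := by
  have htt : Gen.t 0 ≤ Gen.t 1 := (Gen.t_lt_t.2 (by decide)).le
  have htx (l : Fin 2) (i : Fin 3) : Gen.t l ≤ Gen.x i := Gen.t_lt_x.le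
  have h01 : Gen.x 0 ≤ Gen.x 1 := (Gen.x_lt_x.2 (by decide)).le
  have h02 : Gen.x 0 ≤ Gen.x 2 := (Gen.x_lt_x.2 (by decide)).le
  have h12 : Gen.x 1 ≤ Gen.x 2 := (Gen.x_lt_x.2 (by decide)).le
  simp only [Gen.word, List.pairwise_append, List.pairwise_replicate, List.mem_append,
    List.mem_replicate]
  refine ⟨by simp, ⟨by simp, ⟨by simp, ⟨by simp, by simp, ?_⟩, ?_⟩, ?_⟩, ?_⟩
  · rintro _ ⟨-, rfl⟩ _ ⟨-, rfl⟩; exact h12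
  · rintro _ ⟨-, rfl⟩ _ (⟨-, rfl⟩ | ⟨-, rfl⟩)
    exacts [h01, h02]
  · rintro _ ⟨-, rfl⟩ _ (⟨-, rfl⟩ | ⟨-, rfl⟩ | ⟨-, rfl⟩) <;> exact htx _ _
  · rintro _ ⟨-, rfl⟩ _ (⟨-, rfl⟩ | ⟨-, rfl⟩ | ⟨-, rfl⟩ | ⟨-, rfl⟩)
    exacts [htt, htx _ _, htx _ _, htx _ _]

theorem Gen.count_t_word (α : Fin 3 → ℕ) (β : Fin 2 →₀ ℕ) (l : Fin 2) :
    (Gen.word α β : Multiset Gen).count (Gen.t l) = β l := by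
  fin_cases l <;> simp [Gen.word, ← Multiset.coe_add]

theorem Gen.count_x_word (α : Fin 3 → ℕ) (β : Fin 2 →₀ ℕ) (i : Fin 3) :
    (Gen.word α β : Multiset Gen).count (Gen.x i) = α i := by
  fin_cases i <;> simp [Gen.word, ← Multiset.coe_add]

/-- Multisets of generators are given by the multiplicities of the generators. -/
noncomputable def Gen.multisetEquiv : (Σ _ : Fin 3 → ℕ, Fin 2 →₀ ℕ) ≃ Multiset Gen :=
  Equiv.ofBijective (fun γ => (Gen.word γ.1 γ.2 : Multiset Gen)) <| by
    constructor
    · rintro ⟨α, β⟩ ⟨α', β'⟩ h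
      have hα : α = α' := by
        funext i
        rw [← Gen.count_x_word α β i, ← Gen.count_x_word α' β' i]
        exact congrArg _ h
      have hβ : β = β' := by
        ext l
        rw [← Gen.count_t_word α β l, ← Gen.count_t_word α' β' l]
        exact congrArg _ h
      rw [hα, hβ]
    · intro m
      refine ⟨⟨fun i => m.count (Gen.x i),
        Finsupp.equivFunOnFinite.symm fun l => m.count (Gen.t l)⟩, ?_⟩
      ext g
      rcases g.cases with ⟨l, rfl⟩ | ⟨i, rfl⟩
      · rw [Gen.count_t_word]; rfl
      · rw [Gen.count_x_word]

/-- The family `t₁, t₂, x₁, x₂, x₃` in an algebra. -/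
def Gen.family {A : Type*} (t : Fin 2 → A) (x : Fin 3 → A) (g : Gen) : A :=
  Sum.elim t x (ofLex g)

@[simp] theorem Gen.family_t {A : Type*} (t : Fin 2 → A) (x : Fin 3 → A) (l : Fin 2) :
    Gen.family t x (Gen.t l) = t l := rfl

@[simp] theorem Gen.family_x {A : Type*} (t : Fin 2 → A) (x : Fin 3 → A) (i : Fin 3) :
    Gen.family t x (Gen.x i) = x i := rfl

section PBW

variable {k A : Type*} [Field k] [Ring A] [Algebra k A] (ι : MvPolynomial (Fin 2) k →ₐ[k] A)
  (x : Fin 3 → A)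

/-- Evaluation of a left polynomial in the `x_i`. -/
noncomputable def skewEval (f : (Fin 3 → ℕ) →₀ MvPolynomial (Fin 2) k) : A :=
  f.sum fun α r => ι r * (List.ofFn fun i => x i ^ α i).prod

variable {ι x}

/-- The left `k[t₁, t₂]`-basis `x^α` combined with the monomial basis of `k[t₁, t₂]`; the pairs of
exponents are reindexed by multisets of generators. -/
theorem exists_pbw_basis (h : Function.Bijective (skewEval ι x)) :
    ∃ b : Module.Basis (Multiset Gen) k A,
      ∀ m, b m = sortedProd (Gen.family (fun l => ι (X l)) x) m := by
  let L : ((Fin 3 → ℕ) →₀ MvPolynomial (Fin 2) k) →ₗ[k] A := Finsupp.lsum k fun α =>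
    (LinearMap.mulRight k (List.ofFn fun i => x i ^ α i).prod).comp ι.toLinearMap
  have hL : Function.Bijective L := h
  let b₀ : Module.Basis (Σ _ : Fin 3 → ℕ, Fin 2 →₀ ℕ) k
      ((Fin 3 → ℕ) →₀ MvPolynomial (Fin 2) k) :=
    Finsupp.basis fun _ => MvPolynomial.basisMonomials (Fin 2) k
  refine ⟨(b₀.map (LinearEquiv.ofBijective L hL)).reindex Gen.multisetEquiv, fun m => ?_⟩
  obtain ⟨⟨α, β⟩, rfl⟩ := Gen.multisetEquiv.surjective m
  rw [Module.Basis.reindex_apply, Equiv.symm_apply_apply, Module.Basis.map_apply]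
  change L (b₀ ⟨α, β⟩) = sortedProd _ ((Gen.word α β : List Gen) : Multiset Gen)
  rw [sortedProd_coe _ (Gen.pairwise_word α β)]
  have h1 : b₀ ⟨α, β⟩ = Finsupp.single α (monomial β 1) := by simp [b₀]
  have h2 : L (Finsupp.single α (monomial β 1)) =
      ι (monomial β 1) * (List.ofFn fun i => x i ^ α i).prod := by simp [L, mul_assoc]
  have h3 : (monomial β 1 : MvPolynomial (Fin 2) k) = X 0 ^ β 0 * X 1 ^ β 1 := by
    rw [monomial_eq, Finsupp.prod_fintype _ _ (fun _ => pow_zero _), Fin.prod_univ_two, C_1,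
      one_mul]
  rw [h1, h2, h3]
  simp [Gen.word, wordProd, List.map_replicate, List.ofFn_succ, mul_assoc]

/-- Comparison of coefficients at `1, x₁, x₂, x₃`, which turns each overlap below into scalar
identities. -/
theorem coeff_eq_zero_of_skewEval (h : Function.Injective (skewEval ι x))
    {r₀ : MvPolynomial (Fin 2) k} {r : Fin 3 → MvPolynomial (Fin 2) k}
    (hr : ι r₀ + ∑ m, ι (r m) * x m = 0) : r₀ = 0 ∧ ∀ m, r m = 0 := by
  let e (m : Fin 3) : Fin 3 → ℕ := Pi.single m 1
  let L : ((Fin 3 → ℕ) →₀ MvPolynomial (Fin 2) k) →ₗ[k] A := Finsupp.lsum k fun α =>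
    (LinearMap.mulRight k (List.ofFn fun i => x i ^ α i).prod).comp ι.toLinearMap
  have hL : Function.Injective L := h
  let f : (Fin 3 → ℕ) →₀ MvPolynomial (Fin 2) k :=
    Finsupp.single 0 r₀ + ∑ m, Finsupp.single (e m) (r m)
  have hs (α : Fin 3 → ℕ) (s : MvPolynomial (Fin 2) k) :
      L (Finsupp.single α s) = ι s * (List.ofFn fun i => x i ^ α i).prod := by simp [L, mul_assoc]
  have he (m : Fin 3) : (List.ofFn fun i => x i ^ e m i).prod = x m := by
    fin_cases m <;> simp [e, List.ofFn_succ]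
  have hf : f = 0 := by
    apply hL
    rw [map_zero, ← hr, map_add, map_sum]
    congr 1
    · rw [hs]; simp [List.ofFn_succ]
    · exact Finset.sum_congr rfl fun m _ => by rw [hs, he]
  have he0 (m : Fin 3) : e m ≠ 0 := by simp [e]
  have hem (m n : Fin 3) : e m = e n ↔ m = n := by
    constructor
    · intro h
      by_contra hmn
      have := congrFun h m
      simp [e, hmn] at this
    · rintro rfl; rfl
  constructor
  · have := DFunLike.congr_fun hf 0
    simpa [f, Finsupp.finsetSum_apply, Finsupp.single_apply, he0] using this
  · intro m
    have := DFunLike.congr_fun hf (e m)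
    simpa [f, Finsupp.finsetSum_apply, Finsupp.single_apply, (he0 m).symm, hem] using this

/-- A translation of the variables `t_l` preserves the monomial basis. -/
theorem skewEval_bijective_translate (h : Function.Bijective (skewEval ι x)) (β : Fin 2 → k) :
    Function.Bijective (skewEval (ι.comp (aeval fun l => X l + C (β l))) x) := by
  let σ (γ : Fin 2 → k) : MvPolynomial (Fin 2) k →ₐ[k] MvPolynomial (Fin 2) k :=
    aeval fun l => X l + C (γ l)
  have hσ (γ γ' : Fin 2 → k) (hγ : ∀ l, γ l + γ' l = 0) (r : MvPolynomial (Fin 2) k) :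
      σ γ (σ γ' r) = r := by
    have : (σ γ).comp (σ γ') = AlgHom.id k _ := by
      ext l
      simp [σ, MvPolynomial.algebraMap_eq, add_assoc, ← C_add, hγ]
    exact DFunLike.congr_fun this r
  let e : ((Fin 3 → ℕ) →₀ MvPolynomial (Fin 2) k) ≃ ((Fin 3 → ℕ) →₀ MvPolynomial (Fin 2) k) :=
    { toFun := Finsupp.mapRange (σ β) (map_zero _)
      invFun := Finsupp.mapRange (σ fun l => -β l) (map_zero _)
      left_inv := fun f => by
        ext1 α; simp only [Finsupp.mapRange_apply]; exact hσ _ _ (fun l => by ring) _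
      right_inv := fun f => by
        ext1 α; simp only [Finsupp.mapRange_apply]; exact hσ _ _ (fun l => by ring) _ }
  have : skewEval (ι.comp (σ β)) x = skewEval ι x ∘ e := by
    funext f
    exact (Finsupp.sum_mapRange_index (f := σ β) (hf := map_zero _) (g := f)
      (h := fun α r => ι r * (List.ofFn fun i => x i ^ α i).prod)
      (fun α => by rw [map_zero, zero_mul])).symm
  change Function.Bijective (skewEval (ι.comp (σ β)) x)
  rw [this]
  exact h.comp e.bijective

end PBW

/-! ### Overlap identities and consistency of the structure constants. -/

open MvPolynomial

theorem MvPolynomial.eq_zero_of_C_mul_X_add_C {k σ : Type*} [CommRing k] {l : σ} {u v : k}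
    (h : C u * X l + C v = (0 : MvPolynomial σ k)) : u = 0 ∧ v = 0 := by
  classical
  have h0 := congrArg (coeff 0) h
  have h1 := congrArg (coeff (Finsupp.single l 1)) h
  have h2 : (0 : σ →₀ ℕ) ≠ Finsupp.single l 1 := fun h => by simpa using DFunLike.congr_fun h l
  simp [coeff_C, coeff_C_mul, h2] at h0 h1
  exact ⟨h1, h0⟩

namespace SkewParams

variable {k A : Type*} [Field k] [Ring A] [Algebra k A] {ι : MvPolynomial (Fin 2) k →ₐ[k] A}
  {x : Fin 3 → A} {P : SkewParams k}

theorem mul_mul_t (hxt : ∀ i l, x i * ι (X l) =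
      P.a i l • (ι (X l) * x i) + P.b i l • x i + algebraMap k A (P.p i))
    (hba : ∀ s i l, P.b s l * (P.a i l - 1) = 0) (i j : Fin 3) (l : Fin 2) :
    x i * x j * ι (X l) = (P.a i l * P.a j l) • (ι (X l) * (x i * x j)) +
      (P.b i l + P.b j l) • (x i * x j) + (P.a j l * P.p i) • x j + P.p j • x i := by
  have hb : P.a j l * P.b i l = P.b i l := by linear_combination hba i j l
  rw [mul_assoc, hxt j l, mul_add, mul_add, mul_smul_comm, ← mul_assoc, hxt i l, mul_smul_comm,
    Algebra.algebraMap_eq_smul_one, Algebra.algebraMap_eq_smul_one, mul_smul_comm, mul_one, add_mul,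
    add_mul, smul_mul_assoc, smul_mul_assoc, smul_mul_assoc, one_mul, mul_assoc, smul_add, smul_add,
    smul_smul, smul_smul, smul_smul, hb]
  module

/-- The element `x_j x_i t_l` is expanded in two ways. The constant coefficients at `x_i` and `x_j`
also receive terms with `p`, which is why the identity for `b` is asserted only for the other
indices. -/
theorem overlap_xxt (h : Function.Injective (skewEval ι x))
    (hxt : ∀ i l, x i * ι (X l) =
      P.a i l • (ι (X l) * x i) + P.b i l • x i + algebraMap k A (P.p i))
    (hba : ∀ s i l, P.b s l * (P.a i l - 1) = 0) (i j : Fin 3)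
    (hxx : x j * x i =
      P.c i j • (x i * x j) + algebraMap k A (P.κ i j) + ∑ m, P.q i j m • x m) (l : Fin 2) :
    P.κ i j * (P.a i l * P.a j l - 1) = 0 ∧
    ∑ m, P.q i j m * P.p m = (P.b i l + P.b j l) * P.κ i j ∧
    ∀ m, P.q i j m * (P.a i l * P.a j l - P.a m l) = 0 ∧
      (m ≠ i → m ≠ j → P.q i j m * (P.b m l - P.b i l - P.b j l) = 0) := by
  have e1 := mul_mul_t hxt hba i j l
  have e2 := mul_mul_t hxt hba j i l
  have e3 (m : Fin 3) := hxt m l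
  set T := ι (X l) with hT
  simp only [Algebra.algebraMap_eq_smul_one] at hxx e3
  have key : ι (C (P.κ i j * (1 - P.a i l * P.a j l)) * X l +
        C (∑ m, P.q i j m * P.p m - (P.b i l + P.b j l) * P.κ i j)) +
      ∑ m, ι (C (P.q i j m * (P.a m l - P.a i l * P.a j l)) * X l +
        C (P.q i j m * (P.b m l - P.b i l - P.b j l) +
          ((if m = i then (P.c i j - P.a i l) * P.p j else 0) +
            if m = j then (P.c i j * P.a j l - 1) * P.p i else 0))) * x m = 0 := by
    have e4 : x j * x i * T =
        P.c i j • (x i * x j * T) + P.κ i j • T + ∑ m, P.q i j m • (x m * T) := by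
      conv_lhs => rw [hxx]
      simp only [add_mul, smul_mul_assoc, one_mul, Finset.sum_mul]
    rw [e1, e2, hxx] at e4
    have hC (u v : k) : ι (C u * X l + C v) = u • T + v • 1 := by
      rw [map_add, map_mul, ← MvPolynomial.algebraMap_eq, AlgHom.commutes, AlgHom.commutes,
        ← Algebra.smul_def, Algebra.algebraMap_eq_smul_one]
    have hS (u : k) (m : Fin 3) : ∑ n, (if n = m then u else 0) • x n = u • x m := by simp
    simp only [hC, add_mul, smul_mul_assoc, one_mul, add_smul, Finset.sum_add_distrib, hS, e3,
      smul_add, mul_add, mul_smul_comm, mul_one, Finset.mul_sum, Finset.smul_sum, smul_smul] at e4 ⊢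
    simp only [Fin.sum_univ_three] at e4 ⊢
    rw [eq_comm, ← sub_eq_zero] at e4
    rw [← e4]
    module
  obtain ⟨h0, h1⟩ := coeff_eq_zero_of_skewEval h key
  obtain ⟨h2, h3⟩ := eq_zero_of_C_mul_X_add_C h0
  refine ⟨by linear_combination -h2, sub_eq_zero.1 h3, fun m => ?_⟩
  obtain ⟨h4, h5⟩ := eq_zero_of_C_mul_X_add_C (h1 m)
  exact ⟨by linear_combination -h4, fun hi hj => by simpa [hi, hj] using h5⟩

/-- Since `t_l` and `t_{l'}` commute, `x_i t_l t_{l'}` has two expansions; compare the coefficients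
of `t_l`. -/
theorem overlap_xtt (h : Function.Injective (skewEval ι x))
    (hxt : ∀ i l, x i * ι (X l) =
      P.a i l • (ι (X l) * x i) + P.b i l • x i + algebraMap k A (P.p i)) (i : Fin 3)
    (l : Fin 2) : P.p i * (P.a i l - 1) = 0 := by
  obtain ⟨l', hl⟩ : ∃ l' : Fin 2, l ≠ l' := ⟨l + 1, by fin_cases l <;> decide⟩
  have hcomm : ι (X l') * ι (X l) = ι (X l) * ι (X l') := by rw [← map_mul, mul_comm, map_mul]
  have e (m n : Fin 2) : x i * (ι (X m) * ι (X n)) =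
      (P.a i m * P.a i n) • (ι (X m) * ι (X n) * x i) + (P.a i m * P.b i n) • (ι (X m) * x i) +
        (P.a i m * P.p i) • ι (X m) + (P.a i n * P.b i m) • (ι (X n) * x i) +
        (P.b i m * P.b i n) • x i + (P.b i m * P.p i) • 1 + P.p i • ι (X n) := by
    rw [← mul_assoc, hxt i m, add_mul, add_mul, smul_mul_assoc, smul_mul_assoc, mul_assoc, hxt i n,
      Algebra.algebraMap_eq_smul_one, smul_mul_assoc, one_mul, mul_add, mul_add, mul_smul_comm,
      mul_smul_comm, mul_smul_comm, mul_one, ← mul_assoc]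
    module
  have e1 := e l l'
  rw [← hcomm, e l' l, hcomm, ← sub_eq_zero] at e1
  have key : ι (C (P.p i * (P.a i l - 1)) * X l + C (P.p i * (1 - P.a i l')) * X l' +
      C (P.p i * (P.b i l - P.b i l'))) + ∑ m, ι 0 * x m = 0 := by
    have hC (u : k) : ι (C u) = u • 1 := by
      rw [← MvPolynomial.algebraMap_eq, AlgHom.commutes, Algebra.algebraMap_eq_smul_one]
    simp only [map_add, map_mul, hC, smul_mul_assoc, one_mul, map_zero, zero_mul,
      Finset.sum_const_zero, add_zero]
    rw [← neg_eq_zero, ← e1]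
    module
  have h0 := congrArg (coeff (Finsupp.single l 1)) (coeff_eq_zero_of_skewEval h key).1
  have h2 : (0 : Fin 2 →₀ ℕ) ≠ Finsupp.single l 1 := fun h => by simpa using DFunLike.congr_fun h l
  have h3 : Finsupp.single l' 1 ≠ Finsupp.single l 1 := fun h =>
    hl ((Finsupp.single_left_inj one_ne_zero).1 h).symm
  simpa only [coeff_add, coeff_C_mul, coeff_X, coeff_C, if_true, if_neg h2, if_neg h3, mul_one,
    mul_zero, add_zero, coeff_zero] using h0

/-- Two structure constants whose product enters a Jacobi identity can only be nonzero together
if all `x_i` commute up to terms of lower order. -/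
theorem mul_eq_zero_or_c_eq_one (hc_self : ∀ i, P.c i i = 1) (hc_mul : ∀ i j, P.c i j * P.c j i = 1)
    (hq_self : ∀ i m, P.q i i m = 0) (hq_swap : ∀ i j m, P.q j i m = -P.c j i * P.q i j m)
    (hqc : ∀ i j m s, P.q i j m * (P.c s i * P.c s j - P.c s m) = 0) :
    (∀ i j m s, P.q i j m * P.q s m s = 0) ∨ ∀ i j, P.c i j = 1 := by
  refine or_iff_not_imp_left.2 fun hne => ?_
  push Not at hne
  obtain ⟨i, j, m, s, hne⟩ := hne
  have h1 := left_ne_zero_of_mul hne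
  have h2 := right_ne_zero_of_mul hne
  have hc0 (i j : Fin 3) : P.c i j ≠ 0 := left_ne_zero_of_mul_eq_one (hc_mul i j)
  have hcol {s i : Fin 3} (h : P.q s i s ≠ 0) (r : Fin 3) : P.c r i = 1 := by
    have := sub_eq_zero.1 ((mul_eq_zero.1 (hqc s i s r)).resolve_left h)
    exact mul_left_cancel₀ (hc0 r s) (by rw [this, mul_one])
  have hrow {i : Fin 3} (h : ∀ r, P.c r i = 1) (r : Fin 3) : P.c i r = 1 := by
    have := hc_mul r i
    rwa [h, one_mul] at this
  have hij : i ≠ j := by rintro rfl; exact h1 (hq_self i m)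
  have hm := hcol h2
  have hw : ∀ {u v : Fin 3}, u ≠ v → ∃ w : Fin 3, u ≠ w ∧ v ≠ w := by decide
  have hthird {u v w : Fin 3} (huv : u ≠ v) (huw : u ≠ w) (hvw : v ≠ w) (hu : ∀ r, P.c r u = 1)
      (hvw' : P.c v w = 1) (y z : Fin 3) : P.c y z = 1 := by
    have hwv : P.c w v = 1 := by
      have := hc_mul v w
      rwa [hvw', one_mul] at this
    have hy : y = u ∨ y = v ∨ y = w := by omega
    have hz : z = u ∨ z = v ∨ z = w := by omega
    rcases hz with rfl | rfl | rfl
    · exact hu y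
    all_goals
      rcases hy with rfl | rfl | rfl
      · exact hrow hu _
      all_goals first | exact hc_self _ | assumption
  by_cases hmi : m = i
  · subst hmi
    obtain ⟨w, hw1, hw2⟩ : ∃ w : Fin 3, m ≠ w ∧ j ≠ w := hw hij
    exact hthird hij hw1 hw2 hm (hrow (hcol h1) w)
  by_cases hmj : m = j
  · subst hmj
    have h3 : P.q m i m ≠ 0 := by
      rw [hq_swap i m]; exact mul_ne_zero (neg_ne_zero.2 (hc0 _ _)) h1
    obtain ⟨w, hw1, hw2⟩ : ∃ w : Fin 3, m ≠ w ∧ i ≠ w := hw hij.symm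
    exact hthird hij.symm hw1 hw2 hm (hrow (hcol h3) w)
  -- Here `i, j, m` are distinct. The column of `m` is trivial, and `c_{ii} c_{ij} = c_{im}` then
  -- makes the remaining `c_{ij}` equal to `1`.
  · refine hthird hmi hmj hij hm ?_
    have := sub_eq_zero.1 ((mul_eq_zero.1 (hqc i j m i)).resolve_left h1)
    rwa [hc_self, one_mul, hm] at this

/-- The Jacobi identity for the linear parts of the commutators. -/
theorem jacobi (h : Function.Injective (skewEval ι x)) (κ : Fin 3 → Fin 3 → k)
    (q : Fin 3 → Fin 3 → Fin 3 → k)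
    (hxx : ∀ i j, x j * x i - x i * x j = κ i j • (1 : A) + ∑ m, q i j m • x m) (n : Fin 3) :
    ∑ m, (q 0 1 m * q m 2 n + q 1 2 m * q m 0 n + q 2 0 m * q m 1 n) = 0 := by
  have hC (u : k) : ι (C u) = u • 1 := by
    rw [← MvPolynomial.algebraMap_eq, AlgHom.commutes, Algebra.algebraMap_eq_smul_one]
  have e (i j r : Fin 3) : x r * (x j * x i - x i * x j) - (x j * x i - x i * x j) * x r =
      ∑ m, q i j m • (κ m r • (1 : A) + ∑ n, q m r n • x n) := by
    rw [hxx i j]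
    simp only [← hxx _ r, mul_add, add_mul, mul_smul_comm, smul_mul_assoc, mul_one, one_mul,
      Finset.mul_sum, Finset.sum_mul, add_sub_add_left_eq_sub, ← Finset.sum_sub_distrib, smul_sub]
  have key : ι (C (∑ m, (q 0 1 m * κ m 2 + q 1 2 m * κ m 0 + q 2 0 m * κ m 1))) +
      ∑ n, ι (C (∑ m, (q 0 1 m * q m 2 n + q 1 2 m * q m 0 n + q 2 0 m * q m 1 n))) * x n = 0 := by
    -- The cyclic sum of double commutators, which vanishes in any associative algebra.
    have e4 : (0 : A) = ∑ m, q 0 1 m • (κ m 2 • (1 : A) + ∑ n, q m 2 n • x n) +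
        ∑ m, q 1 2 m • (κ m 0 • (1 : A) + ∑ n, q m 0 n • x n) +
        ∑ m, q 2 0 m • (κ m 1 • (1 : A) + ∑ n, q m 1 n • x n) := by
      rw [← e, ← e, ← e]; noncomm_ring
    simp only [hC, smul_mul_assoc, one_mul]
    rw [e4]
    simp only [Fin.sum_univ_three]
    module
  have := (coeff_eq_zero_of_skewEval h key).2 n
  rwa [C_eq_zero] at this

end SkewParams

open MvPolynomial

namespace SkewParams

variable {k A : Type*} [Field k] [Ring A] [Algebra k A] {ι : MvPolynomial (Fin 2) k →ₐ[k] A}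
  {x : Fin 3 → A} {P : SkewParams k}

/-- If all `x_i` commute up to terms of lower order, then the diagonal relations follow from the
Jacobi identity and two of them. -/
theorem q_q_of_c_eq_one [CharZero k] (h : Function.Injective (skewEval ι x))
    (hc : ∀ i j, P.c i j = 1) (hq_self : ∀ i m, P.q i i m = 0)
    (hq_swap : ∀ i j m, P.q j i m = -P.q i j m)
    (hxx : ∀ i j, i < j → x j * x i =
      P.c i j • (x i * x j) + algebraMap k A (P.κ i j) + ∑ m, P.q i j m • x m)
    (h₈ : ∀ s i j, i < j →
      ∑ m ∈ Finset.Iio s, P.q i j m * P.q m s s - ∑ m ∈ Finset.Ioi s, P.q i j m * P.q m s s = 0) :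
    (∀ i j s, ∑ m, P.q i j m * P.q s m s = 0) ∧ (∀ i j, P.q 0 1 1 * P.q i j 0 = 0) ∧
      ∀ i j, P.q 1 2 1 * P.q i j 2 = 0 := by
  have hjac := jacobi h
    -- The constants `κ` are meaningful only for `i < j`, so they are made antisymmetric here.
    (fun i j => if i < j then P.κ i j else if j < i then -P.κ j i else 0) P.q (by
    intro i j
    rcases lt_trichotomy i j with hij | rfl | hij
    · rw [hxx i j hij, hc, one_smul, if_pos hij, Algebra.algebraMap_eq_smul_one]
      abel
    · simp [hq_self]
    · rw [hxx j i hij, hc, one_smul, if_neg hij.not_gt, if_pos hij, Algebra.algebraMap_eq_smul_one]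
      simp only [hq_swap j i, neg_smul, Finset.sum_neg_distrib]
      abel)
  have I0 : Finset.Iio (0 : Fin 3) = ∅ := by decide
  have I1 : Finset.Iio (1 : Fin 3) = {0} := by decide
  have I2 : Finset.Iio (2 : Fin 3) = {0, 1} := by decide
  have J0 : Finset.Ioi (0 : Fin 3) = {1, 2} := by decide
  have J1 : Finset.Ioi (1 : Fin 3) = {2} := by decide
  have J2 : Finset.Ioi (2 : Fin 3) = ∅ := by decide
  have f0 (i j : Fin 3) (hij : i < j) := h₈ 0 i j hij
  have f1 (i j : Fin 3) (hij : i < j) := h₈ 1 i j hij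
  have f2 (i j : Fin 3) (hij : i < j) := h₈ 2 i j hij
  have n12 : (1 : Fin 3) ≠ 2 := by decide
  have n01 : (0 : Fin 3) ≠ 1 := by decide
  simp only [I0, I1, I2, J0, J1, J2, Finset.sum_empty, Finset.sum_singleton, Finset.sum_pair n12,
    Finset.sum_pair n01, hq_swap 0 1, hq_swap 0 2, hq_swap 1 2] at f0 f1 f2
  have g0 := hjac 0
  have g1 := hjac 1
  have g2 := hjac 2
  simp only [Fin.sum_univ_three, hq_self, hq_swap 0 1, hq_swap 0 2, hq_swap 1 2] at g0 g1 g2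
  have a01 := f0 0 1 (by decide)
  have a02 := f0 0 2 (by decide)
  have a12 := f0 1 2 (by decide)
  have b01 := f1 0 1 (by decide)
  have b02 := f1 0 2 (by decide)
  have b12 := f1 1 2 (by decide)
  have c01 := f2 0 1 (by decide)
  have c02 := f2 0 2 (by decide)
  have c12 := f2 1 2 (by decide)
  have hall {p : Fin 3 → Fin 3 → Prop} (hs : ∀ i, p i i) (hw : ∀ i j, p i j → p j i) (h01 : p 0 1)
      (h02 : p 0 2) (h12 : p 1 2) (i j : Fin 3) : p i j := by
    fin_cases i <;> fin_cases j <;> first | exact hs _ | assumption | (apply hw; assumption)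
  -- For positions `0` and `2` the relations `h₈` are, up to sign, the diagonal relations. At
  -- position `1` they carry the wrong relative sign; the right one follows from the Jacobi
  -- identity, by which the adjoint matrix of a bracket has trace zero. Half the sum and half the
  -- difference of the two versions make both products vanish.
  have key0 (i j : Fin 3) : P.q 0 1 1 * P.q i j 0 = 0 := by
    refine hall (p := fun i j => P.q 0 1 1 * P.q i j 0 = 0) (fun i => ?_) (fun i j h => ?_) ?_ ?_ ?_
      i j
    · rw [hq_self, mul_zero]
    · rw [hq_swap i j, mul_neg, h, neg_zero]
    · linear_combination (1 / 2 : k) * (b01 + g2 + a01 - c01)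
    · linear_combination (1 / 2 : k) * (b02 - g1 + a02 - c02)
    · linear_combination (1 / 2 : k) * (b12 + g0 + a12 - c12)
  have key2 (i j : Fin 3) : P.q 1 2 1 * P.q i j 2 = 0 := by
    refine hall (p := fun i j => P.q 1 2 1 * P.q i j 2 = 0) (fun i => ?_) (fun i j h => ?_) ?_ ?_ ?_
      i j
    · rw [hq_self, mul_zero]
    · rw [hq_swap i j, mul_neg, h, neg_zero]
    · linear_combination (1 / 2 : k) * (b01 - g2 - a01 + c01)
    · linear_combination (1 / 2 : k) * (b02 + g1 - a02 + c02)
    · linear_combination (1 / 2 : k) * (b12 - g0 - a12 + c12)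
  refine ⟨fun i j s => ?_, key0, key2⟩
  have hsw (i j : Fin 3) (h : ∑ m, P.q i j m * P.q s m s = 0) :
      ∑ m, P.q j i m * P.q s m s = 0 := by
    simp only [hq_swap i j, neg_mul, Finset.sum_neg_distrib, h, neg_zero]
  refine hall (p := fun i j => ∑ m, P.q i j m * P.q s m s = 0) (fun i => ?_) hsw ?_ ?_ ?_ i j
  · simp [hq_self]
  all_goals
    clear hjac
    fin_cases s <;> simp only [Fin.sum_univ_three, Fin.zero_eta, Fin.mk_one, Fin.reduceFinMk,
      hq_self, hq_swap 0 1, hq_swap 0 2, hq_swap 1 2]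
  · linear_combination a01
  · linear_combination -g2 - a01 + c01
  · linear_combination -c01
  · linear_combination a02
  · linear_combination g1 - a02 + c02
  · linear_combination -c02
  · linear_combination a12
  · linear_combination -g0 - a12 + c12
  · linear_combination -c12

/-- A monomial basis and the compatibility relations make the structure constants consistent. -/
theorem consistent [CharZero k] (h : Function.Injective (skewEval ι x))
    (ha : ∀ i l, P.a i l ≠ 0) (hc_self : ∀ i, P.c i i = 1)
    (hc_mul : ∀ i j, P.c i j * P.c j i = 1) (hq_self : ∀ i m, P.q i i m = 0)
    (hq_swap : ∀ i j m, P.q j i m = -P.c j i * P.q i j m)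
    (hxt : ∀ i l, x i * ι (X l) =
      P.a i l • (ι (X l) * x i) + P.b i l • x i + algebraMap k A (P.p i))
    (hxx : ∀ i j, i < j → x j * x i =
      P.c i j • (x i * x j) + algebraMap k A (P.κ i j) + ∑ m, P.q i j m • x m)
    (hba : ∀ s i l, P.b s l * (P.a i l - 1) = 0)
    (h₂ : ∀ s i l, P.q s i s * (P.a i l - 1) = 0)
    (h₃ : ∀ s i l, P.p i * (P.c s i - P.a s l) = P.b i l * P.q s i s)
    (h₇ : ∀ s i j m, i < j → P.q i j m * (P.c s j * P.c s i - P.c s m) = 0)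
    (h₈ : ∀ s i j, i < j →
      ∑ m ∈ Finset.Iio s, P.c s m * P.q i j m * P.q m s s -
        ∑ m ∈ Finset.Ioi s, P.q i j m * P.q m s s +
        P.q s i s * P.q s j s * (1 - P.c i j) + (P.c s j * P.c s i - 1) * P.κ i j = 0) :
    P.Consistent := by
  have ext_lt {p : Fin 3 → Fin 3 → k → Prop} (m : Fin 3) (h0 : ∀ i j, p i j 0)
      (hlt : ∀ i j, i < j → p i j (P.q i j m))
      (hsw : ∀ i j, i < j → p i j (P.q i j m) → p j i (-P.c j i * P.q i j m)) (i j : Fin 3) :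
      p i j (P.q i j m) := by
    rcases lt_trichotomy i j with hij | rfl | hij
    · exact hlt i j hij
    · rw [hq_self]; exact h0 i i
    · rw [hq_swap]; exact hsw j i hij (hlt j i hij)
  have hqc (i j m s : Fin 3) : P.q i j m * (P.c s i * P.c s j - P.c s m) = 0 := by
    refine ext_lt (p := fun i j z => z * (P.c s i * P.c s j - P.c s m) = 0) m ?_ ?_ ?_ i j
    · intro i j; rw [zero_mul]
    · intro i j hij; linear_combination h₇ s i j m hij
    · intro i j _ h; linear_combination -P.c j i * h
  have hov (i j : Fin 3) (hij : i < j) (l : Fin 2) := overlap_xxt h hxt hba i j (hxx i j hij) l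
  have hqq : (∀ i j s, ∑ m, P.q i j m * P.q s m s = 0) ∧ (∀ i j, P.q 0 1 1 * P.q i j 0 = 0) ∧
      (∀ i j, P.q 1 2 1 * P.q i j 2 = 0) ∧
      ∀ i j s, i < j → P.κ i j * (P.c s i * P.c s j - 1) = 0 := by
    -- Either all products in question vanish one by one, and `h₈` reduces to its term with `κ`, or
    -- all `c_{ij} = 1`, where that term is trivial and the Jacobi identity applies.
    rcases mul_eq_zero_or_c_eq_one hc_self hc_mul hq_self hq_swap hqc with hz | hc
    · have hz' (i j m s : Fin 3) : P.q i j m * P.q m s s = 0 := by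
        rw [hq_swap s m]; linear_combination -P.c m s * hz i j m s
      refine ⟨fun i j s => Finset.sum_eq_zero fun m _ => hz i j m s, fun i j => ?_, fun i j => ?_,
        fun i j s hij => ?_⟩
      · rw [mul_comm]; exact hz' i j 0 1
      · rw [mul_comm, hq_swap 2 1]; linear_combination -P.c 1 2 * hz' i j 2 1
      · have h8 := h₈ s i j hij
        have h1 : ∑ m ∈ Finset.Iio s, P.c s m * P.q i j m * P.q m s s = 0 :=
          Finset.sum_eq_zero fun m _ => by rw [mul_assoc, hz', mul_zero]
        have h2 : ∑ m ∈ Finset.Ioi s, P.q i j m * P.q m s s = 0 :=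
          Finset.sum_eq_zero fun m _ => hz' i j m s
        have h3 : P.q s j s * (1 - P.c i j) = 0 := by
          have h4 := hqc s j s i
          have h5 : P.c i s ≠ 0 := left_ne_zero_of_mul_eq_one (hc_mul i s)
          refine mul_left_cancel₀ h5 ?_
          linear_combination -h4
        rw [h1, h2] at h8
        linear_combination h8 - P.q s i s * h3
    · obtain ⟨h1, h2, h3⟩ := q_q_of_c_eq_one h hc hq_self
        (fun i j m => by rw [hq_swap, hc, neg_one_mul]) hxx fun s i j hij => by
          simpa [hc] using h₈ s i j hij
      exact ⟨h1, h2, h3, fun i j s _ => by simp [hc]⟩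
  obtain ⟨hqq, hq0, hq2, hκc⟩ := hqq
  exact
    { a_ne_zero := ha
      c_self := hc_self
      c_mul := hc_mul
      q_self := hq_self
      q_swap := hq_swap
      b_a := hba
      q_c := hqc
      q_diag_a := h₂
      q_a := fun i j m l => by
        refine ext_lt (p := fun i j z => z * (P.a i l * P.a j l - P.a m l) = 0) m ?_ ?_ ?_ i j
        · intro i j; rw [zero_mul]
        · intro i j hij; exact ((hov i j hij l).2.2 m).1
        · intro i j _ h; linear_combination -P.c j i * h
      q_b := fun i j m l => by
        refine ext_lt (p := fun i j z => m ≠ i → m ≠ j → z * (P.b m l - P.b i l - P.b j l) = 0) m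
          ?_ ?_ ?_ i j
        · intro i j _ _; rw [zero_mul]
        · intro i j hij; exact ((hov i j hij l).2.2 m).2
        · intro i j _ h hj hi; linear_combination -P.c j i * h hi hj
      κ_a := fun i j l hij => (hov i j hij l).1
      κ_c := fun i j s hij => hκc i j s hij
      p_c := h₃
      p_a := overlap_xtt h hxt
      q_p := fun i j l hij => by
        rw [(hov i j hij l).2.1]
        linear_combination -P.κ i j * hba j i l
      q_q := hqq
      q_q_zero := hq0
      q_q_two := hq2 }

end SkewParams

/-! ### Normalization of the `t_l` and the conclusion. -/

open MvPolynomial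

theorem SkewParams.holds_family {k A : Type*} [Field k] [Ring A] [Algebra k A]
    {ι : MvPolynomial (Fin 2) k →ₐ[k] A} {x : Fin 3 → A} {P : SkewParams k}
    (hxt : ∀ i l, x i * ι (X l) =
      P.a i l • (ι (X l) * x i) + P.b i l • x i + algebraMap k A (P.p i))
    (hxx : ∀ i j, i < j → x j * x i =
      P.c i j • (x i * x j) + algebraMap k A (P.κ i j) + ∑ m, P.q i j m • x m) :
    P.rel.Holds (Gen.family (fun l => ι (X l)) x) := by
  intro i j hij
  rcases i.cases with ⟨l, rfl⟩ | ⟨i, rfl⟩ <;> rcases j.cases with ⟨m, rfl⟩ | ⟨j, rfl⟩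
  · simp [← map_mul, mul_comm]
  · simp only [Gen.sum_eq, Gen.family_t, Gen.family_x, rel_c_tx, rel_κ_tx, rel_q_t, rel_q_txx,
      zero_smul, Finset.sum_const_zero, zero_add, ite_smul, Finset.sum_ite_eq', Finset.mem_univ,
      if_true, hxt]
    abel
  · exact absurd hij Gen.not_x_lt_t
  · simpa [Gen.sum_eq] using hxx i j (Gen.x_lt_x.1 hij)

/-- After a translation of the variables `t_l`, the structure constants are consistent. -/
theorem exists_translate {k : Type*} [Field k] {a b : Fin 3 → Fin 2 → k}
    (h₁ : ∀ s i l, b s l * (a i l - 1) = b i l * (a s l - 1)) :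
    ∃ β : Fin 2 → k, ∀ s i l, (b s l - (a s l - 1) * β l) * (a i l - 1) = 0 := by
  have (l : Fin 2) : ∃ β, ∀ s i, (b s l - (a s l - 1) * β) * (a i l - 1) = 0 := by
    by_cases h : ∃ i, a i l - 1 ≠ 0
    · obtain ⟨i, hi⟩ := h
      -- The translation that removes `b_{il}`; by `h₁` it removes every `b_{sl}` at once. If all
      -- `a_{il} = 1`, nothing has to be moved.
      refine ⟨b i l / (a i l - 1), fun s j => ?_⟩
      have : b s l - (a s l - 1) * (b i l / (a i l - 1)) = 0 := by
        field_simp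
        linear_combination h₁ s i l
      rw [this, zero_mul]
    · push Not at h
      exact ⟨0, fun s i => by rw [h i, mul_zero]⟩
  choose β hβ using this
  exact ⟨β, fun s i l => hβ l s i⟩

theorem theorem4p5 {k : Type*} [Field k] [CharZero k] {A : Type*} [Ring A] [Algebra k A]
    -- `A = σ(k[t₁, t₂])⟨x₁, x₂, x₃⟩`
    (ι : MvPolynomial (Fin 2) k →ₐ[k] A) (x : Fin 3 → A)
    (hA : IsSkewPBWExtension (ι : MvPolynomial (Fin 2) k →+* A) x)
    -- the constants; `a i l` is `a_{ill}`, `q₀ i j` is `q_{i,j}^{(0)}`, `q i j m` is `q_{i,j}^{(m)}`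
    (a b : Fin 3 → Fin 2 → k) (p : Fin 3 → k) (c q₀ : Fin 3 → Fin 3 → k)
    (q : Fin 3 → Fin 3 → Fin 3 → k)
    (ha : ∀ i l, a i l ≠ 0) (hc : ∀ i j, i < j → c i j ≠ 0)
    -- the defining relations
    (hxt : ∀ i l, x i * ι (MvPolynomial.X l) =
      a i l • (ι (MvPolynomial.X l) * x i) + b i l • x i + algebraMap k A (p i))
    (hxx : ∀ i j, i < j → x j * x i =
      c i j • (x i * x j) + algebraMap k A (q₀ i j) + ∑ m, q i j m • x m)
    -- conventions that extend `c i j` and `q i j m` from `i < j` to all `i`, `j`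
    (hc_self : ∀ i, c i i = 1) (hc_swap : ∀ i j, i < j → c j i = (c i j)⁻¹)
    (hq_self : ∀ i m, q i i m = 0)
    (hq_swap : ∀ i j m, i < j → q j i m = -(c i j)⁻¹ * q i j m)
    -- the compatibility relations
    (h₁ : ∀ s i l, b s l * (a i l - 1) = b i l * (a s l - 1))
    (h₂ : ∀ s i l, q s i s * (a i l - 1) = 0)
    (h₃ : ∀ s i l, p i * (c s i - a s l) = b i l * q s i s)
    (h₄ : ∀ s i j, i < j → q i j s * (c s j * c s i - 1) = 0)
    (h₅ : ∀ s i j, i < j → q s j s * (c i j - 1) = q i j i * (c s j - 1))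
    (h₆ : ∀ s i j, i < j → q s i s * (c i j - 1) = q i j j * (c s i - 1))
    (h₇ : ∀ s i j m, i < j → q i j m * (c s j * c s i - (c m s)⁻¹) = 0)
    (h₈ : ∀ s i j, i < j →
      ∑ m ∈ Finset.Iio s, (c m s)⁻¹ * q i j m * q m s s - ∑ m ∈ Finset.Ioi s, q i j m * q m s s
        + q s i s * q s j s * (1 - c i j) + (c s j * c s i - 1) * q₀ i j = 0) :
    IsDifferentiallySmooth k A := by
  obtain ⟨β, hβ⟩ := exists_translate h₁
  have hbij := skewEval_bijective_translate hA.basis β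
  set ι' := ι.comp (aeval fun l => X l + C (β l)) with hι'
  have hX (l : Fin 2) : ι' (X l) = ι (X l) + β l • 1 := by
    rw [hι', AlgHom.comp_apply, aeval_X, map_add, ← MvPolynomial.algebraMap_eq, AlgHom.commutes,
      Algebra.algebraMap_eq_smul_one]
  let P : SkewParams k := ⟨a, fun i l => b i l - (a i l - 1) * β l, p, c, q₀, q⟩
  have hc_mul (i j : Fin 3) : c i j * c j i = 1 := by
    rcases lt_trichotomy i j with h | rfl | h
    · rw [hc_swap i j h, mul_inv_cancel₀ (hc i j h)]
    · rw [hc_self, one_mul]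
    · rw [hc_swap j i h, inv_mul_cancel₀ (hc j i h)]
  have hc_inv (i j : Fin 3) : (c i j)⁻¹ = c j i := inv_eq_of_mul_eq_one_right (hc_mul i j)
  have hq_swap' (i j m : Fin 3) : q j i m = -c j i * q i j m := by
    rcases lt_trichotomy i j with h | rfl | h
    · rw [hq_swap i j m h, hc_inv]
    · simp [hq_self]
    · rw [hq_swap j i m h, hc_inv]
      linear_combination -q j i m * hc_mul i j
  have hxt' (i : Fin 3) (l : Fin 2) : x i * ι' (X l) =
      P.a i l • (ι' (X l) * x i) + P.b i l • x i + algebraMap k A (P.p i) := by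
    rw [hX, mul_add, hxt, add_mul, mul_smul_comm, smul_mul_assoc, mul_one, one_mul]
    module
  have hP : P.Consistent := SkewParams.consistent hbij.1 ha hc_self hc_mul hq_self hq_swap' hxt' hxx
    hβ h₂
    -- The translation changes `b_{il}` by a multiple of `a_{ill} - 1`, and `h₂` annihilates the
    -- product of this factor with `q_{s,i}^{(s)}`.
    (fun s i l => by
      change p i * (c s i - a s l) = (b i l - (a i l - 1) * β l) * q s i s
      linear_combination h₃ s i l + β l * h₂ s i l)
    (fun s i j m hij => by
      have := h₇ s i j m hij
      rwa [hc_inv] at this)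
    (fun s i j hij => by
      have := h₈ s i j hij
      simpa only [hc_inv] using this)
  obtain ⟨bas, hbas⟩ := exists_pbw_basis hbij
  have hy := SkewParams.holds_family hxt' hxx
  have hc0 : ∀ i j : Gen, i < j → P.rel.c i j ≠ 0 := fun i j _ => hP.rel_c_ne_zero i j
  obtain ⟨D, L, lam, hD, H⟩ := hP.exists_formData
  have hcard : Fintype.card Gen = 5 := rfl
  refine ⟨?_, Fintype.card Gen, gkDim_eq_card hy hc0 bas hbas,
    H.exists_calculus hD hy hc0 bas hbas (N := 3) rfl (by rw [hcard]; decide)⟩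
  refine ⟨⟨(Set.finite_range (Gen.family (fun l => ι' (X l)) x)).toFinset, ?_⟩⟩
  rw [Set.Finite.coe_toFinset]
  exact QuadRel.adjoin_eq_top bas hbas
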